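/- Let $\alpha\in\mathbb{R}$ and $\lambda=e^{i\alpha}$, and let $F=F_\lambda:\mathbb{C}\to\mathbb{C}$, $F(z)=\lambda\,(z-H(z))$, where $H(z)=1$ if $\operatorname{Im} z\ge 0$ and $H(z)=-1$ if $\operatorname{Im} z<0$. Let $\mathcal{F}=\{z\in\mathbb{C} : \operatorname{Im}(F^i(z))=0 \text{ for some integer } i\ge 0\}$ be the critical set and let $\mathcal{U}=\mathbb{C}\setminus\overline{\mathcal{F}}$ be the regular set. Suppose that $\alpha=2\pi p/q$ with $p,q\in\mathbb{N}$, $\gcd(p,q)=1$ and $q\ge 3$, and let $V$ be a connected component of $\mathcal{U}$. Then: (a) The boundary $\partial V$ is a convex polygon, and $V$ is the open region enclosed by it. The polygon has at most $q$ sides if $q$ is even and at most $2q$ sides if $q$ is odd. (b) $V$ is periodic, that is, $F^m(V)=V$ for some $m\ge 1$. Let $\ell$ be its period, the least such $m$. If $\gcd(\ell,q)=1$, then either $\partial V$ is a regular polygon with $q$ sides, or $q$ is odd and $\partial V$ has $2q$ sides. (c) For some values of $\alpha$ there are connected components of $\mathcal{U}$ that are not regular polygons. In particular, for $\alpha=11\pi/6$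 there is a connected component of $\mathcal{U}$ whose boundary is a convex hexagon that is not regular, and the period of this component is $20$. -/

import Mathlib

noncomputable section

namespace PiecewiseRotation

/-- `H z = 1` on the closed upper half-plane and `H z = -1` on the open lower half-plane. -/
def H (z : ℂ) : ℂ :=
  if 0 ≤ z.im then 1 else -1

/-- The piecewise rotation `F_λ(z) = λ (z - H(z))` with `λ = exp(i α)`. -/
def F (α : ℝ) (z : ℂ) : ℂ :=
  Complex.exp (α * Complex.I) * (z - H z)

/-- The critical set: the real line together with all its preimages under `F`. -/
def criticalSet (α : ℝ) : Set ℂ :=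
  {z | ∃ i : ℕ, ((F α)^[i] z).im = 0}

/-- The regular set `U`: the complement of the closure of the critical set. -/
def regularSet (α : ℝ) : Set ℂ :=
  (closure (criticalSet α))ᶜ

/-- `V` is a connected component of the regular set. -/
def IsTile (α : ℝ) (V : Set ℂ) : Prop :=
  ∃ z ∈ regularSet α, V = connectedComponentIn (regularSet α) z

/-- `ℓ` is the period of the set `V`: the least positive integer with `F^ℓ(V) = V`. -/
def IsPeriod (α : ℝ) (V : Set ℂ) (ℓ : ℕ) : Prop :=
  IsLeast {m : ℕ | 0 < m ∧ (F α)^[m] '' V = V} ℓ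

/-- The vertices of `P` are, in counterclockwise order, the vertices of a convex polygon with
exactly `n ≥ 3` sides: every vertex other than the two endpoints of a side lies strictly to the left
of that (directed) side. In particular the vertices are distinct and no three are collinear. -/
def IsConvexPolygon {n : ℕ} (P : Polygon ℂ n) : Prop :=
  3 ≤ n ∧ ∀ i j : Fin n, j ≠ i → j ≠ finRotate n i →
    0 < ((starRingEnd ℂ) (P (finRotate n i) - P i) * (P j - P i)).im

/-- All sides of `P` have the same length, and all its angles are equal. For convex polygons
this is regularity. -/
def IsRegular {n : ℕ} (P : Polygon ℂ n) : Prop :=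
  (∀ i j : Fin n, dist (P i) (P (finRotate n i)) = dist (P j) (P (finRotate n j))) ∧
  (∀ i j : Fin n,
    EuclideanGeometry.angle (P i) (P (finRotate n i)) (P (finRotate n (finRotate n i))) =
      EuclideanGeometry.angle (P j) (P (finRotate n j)) (P (finRotate n (finRotate n j))))

/-- The boundary of `V` is the convex polygon `P` (with `n` sides), and `V` is the open region
enclosed by it. -/
def BoundedBy {n : ℕ} (V : Set ℂ) (P : Polygon ℂ n) : Prop :=
  IsConvexPolygon P ∧ frontier V = P.boundary ℝ ∧
    V = interior (convexHull ℝ (Set.range P.vertices))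

end PiecewiseRotation

end

/-! Write `λ = exp (π i p / h)` with `p` coprime to `h` and `h ≥ 2`. For even `q` this is `q = 2h`;
for odd `q` it is `h = q` with `p` doubled. On each open half-plane the map is a unit translation
followed by the rotation `λ`, so all points with a common itinerary are moved by the same isometry.
They form a `Cell`, an intersection of half-planes whose normals take only `2h` directions. By
`component_eq` the components of the regular set are the interiors of cells.

Periodicity rests on the boundedness of orbits (`isBounded_orbit`). Arbitrarily far out there is a
closed necklace of regular `2h`-gons with side 1, which the map permutes up to sign
(`exists_barrier`). A point inside the necklace that is about to jump over it already lies in one of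
its polygons, so nothing escapes (`F_mem_trap`). A bounded orbit recurs, and since the map is
injective and isometric on cells, the cell returns to itself after some `d` steps. As `λ ^ (2h) =
1`, the iterate `d * (2h)` is a translation on the cell, and boundedness makes it trivial. Along the
closed orbit the distances to the real line have a constant sum over the cell, so the cell is
bounded too (`tile_periodic`).

A bounded tile is the region cut out by its `2h` support lines (`tile_eq_openRegion`), hence a
convex polygon with at most `2h` sides (`boundedBy_openRegion`). If `ℓ` is its period, the return
map rotates by `π p ℓ / h`. When that rotation is nontrivial it has a centre, and the support
numbers about this centre are invariant under index shifts by `p ℓ` and by `2h`, hence by their gcd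
(`rotInvariant_support`). For `ℓ` coprime to `q` the gcd is 1 when `q` is even, giving a regular
`q`-gon. It is 2 when `q` is odd: side lengths then depend only on parity, and either one class
vanishes (regular `q`-gon) or there are `2q` sides.

For `α = 11π/6` one tile is computed outright (`exists_hexagon`): ten iterates of it lie below the
real line, the tenth is minus the tile, and oddness of the map gives the other ten. -/

noncomputable section

/-! ### Itineraries, cells, and components of the regular set -/

namespace PiecewiseRotation

open Complex

/-- The multiplier `λ = exp(i α)`. -/
def mult (α : ℝ) : ℂ := Complex.exp (α * Complex.I)

lemma F_def (α : ℝ) (z : ℂ) : F α z = mult α * (z - H z) := rfl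

lemma mult_ne_zero (α : ℝ) : mult α ≠ 0 := Complex.exp_ne_zero _

lemma norm_mult (α : ℝ) : ‖mult α‖ = 1 := Complex.norm_exp_ofReal_mul_I α

lemma H_of_pos {z : ℂ} (h : 0 < z.im) : H z = 1 := if_pos h.le

lemma H_of_neg {z : ℂ} (h : z.im < 0) : H z = -1 := if_neg (not_le.2 h)

lemma H_neg {z : ℂ} (h : z.im ≠ 0) : H (-z) = -H z := by
  rcases lt_or_gt_of_ne h with h | h
  · rw [H_of_neg h, H_of_pos (by simpa using h)]; simp
  · rw [H_of_pos h, H_of_neg (by simpa using h)]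

lemma F_neg {α : ℝ} {z : ℂ} (h : z.im ≠ 0) : F α (-z) = -F α z := by
  rw [F_def, F_def, H_neg h]; ring

lemma H_eq_of_mul_pos {z w : ℂ} (h : 0 < z.im * w.im) : H z = H w := by
  rcases mul_pos_iff.1 h with h | h
  · rw [H_of_pos h.1, H_of_pos h.2]
  · rw [H_of_neg h.1, H_of_neg h.2]

lemma im_H (z : ℂ) : (H z).im = 0 := by
  unfold H; split_ifs <;> simp

lemma F_injective (α : ℝ) : Function.Injective (F α) := by
  intro z w h
  rw [F_def, F_def] at h
  have h1 := mul_left_cancel₀ (mult_ne_zero α) h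
  have him : z.im = w.im := by
    have := congrArg Complex.im h1
    simpa [im_H] using this
  have hH : H z = H w := by simp only [H, him]
  rw [hH] at h1
  exact sub_left_injective h1

/-- The points whose orbit always stays on the same side of the real line as that of `z`. -/
def Cell (α : ℝ) (z : ℂ) : Set ℂ :=
  {w | ∀ i : ℕ, 0 < ((F α)^[i] z).im * ((F α)^[i] w).im}

lemma iterate_eq_of_same_side {α : ℝ} {z w : ℂ} {n : ℕ}
    (h : ∀ i < n, 0 < ((F α)^[i] z).im * ((F α)^[i] w).im) :
    (F α)^[n] w = (F α)^[n] z + mult α ^ n * (w - z) := by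
  induction n with
  | zero => simp
  | succ n ih =>
    have h1 := ih fun i hi => h i (by omega)
    rw [Function.iterate_succ_apply', Function.iterate_succ_apply', F_def, F_def,
      ← H_eq_of_mul_pos (h n (by omega)), h1]
    ring

lemma iterate_of_mem_Cell {α : ℝ} {z w : ℂ} (h : w ∈ Cell α z) (n : ℕ) :
    (F α)^[n] w = (F α)^[n] z + mult α ^ n * (w - z) :=
  iterate_eq_of_same_side fun i _ => h i

/-- The iterates are affine on the cell, so membership becomes a list of affine inequalities in `w`.
The converse needs strong induction: the affine formula at time `i` is available only once the
earlier inequalities hold. -/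
lemma mem_Cell_iff {α : ℝ} {z w : ℂ} : w ∈ Cell α z ↔
    ∀ i : ℕ, 0 < ((F α)^[i] z).im * (((F α)^[i] z).im + (mult α ^ i * (w - z)).im) := by
  constructor
  · intro h i
    have h2 := h i
    rw [iterate_of_mem_Cell h i] at h2
    simpa using h2
  · intro h i
    induction i using Nat.strong_induction_on with
    | _ n ih =>
      rw [iterate_eq_of_same_side ih]
      simpa using h n

lemma convex_Cell (α : ℝ) (z : ℂ) : Convex ℝ (Cell α z) := by
  intro u hu v hv a b ha hb hab
  rw [mem_Cell_iff] at *
  intro i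
  have e : mult α ^ i * (a • u + b • v - z)
      = (a : ℂ) * (mult α ^ i * (u - z)) + (b : ℂ) * (mult α ^ i * (v - z)) := by
    have hab' : (a : ℂ) + b = 1 := by exact_mod_cast hab
    simp only [real_smul]
    linear_combination (mult α ^ i * z) * hab'
  rw [e]
  simp only [add_im, im_ofReal_mul]
  have h1 := hu i
  have h2 := hv i
  set y := ((F α)^[i] z).im
  set A := (mult α ^ i * (u - z)).im
  set B := (mult α ^ i * (v - z)).im
  have h3 : y * (y + (a * A + b * B)) = a * (y * (y + A)) + b * (y * (y + B)) := by
    linear_combination (-(y * y)) * hab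
  rw [h3]
  rcases ha.eq_or_lt with h | h
  · have : b = 1 := by linarith
    subst this; subst h; simpa using h2
  · have := mul_pos h h1
    have := mul_nonneg hb h2.le
    linarith

lemma Cell_disjoint_criticalSet (α : ℝ) (z : ℂ) : Disjoint (Cell α z) (criticalSet α) := by
  rw [Set.disjoint_left]
  rintro w hw ⟨i, hi⟩
  have := hw i
  rw [hi] at this
  simp at this

lemma interior_Cell_subset (α : ℝ) (z : ℂ) : interior (Cell α z) ⊆ regularSet α := by
  have h := (Cell_disjoint_criticalSet α z).mono_left interior_subset
  exact (h.closure_right isOpen_interior).subset_compl_right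

lemma isOpen_regularSet (α : ℝ) : IsOpen (regularSet α) := isClosed_closure.isOpen_compl

lemma im_ne_zero_of_mem_regularSet {α : ℝ} {z : ℂ} (hz : z ∈ regularSet α) (i : ℕ) :
    ((F α)^[i] z).im ≠ 0 := fun h => hz (subset_closure ⟨i, h⟩)

/-- As long as the component has kept one itinerary, the next iterate is affine on it; its imaginary
part has no zero on the regular set, so by connectedness it keeps its sign. Conversely the interior
of a cell is convex and regular. -/
lemma component_eq {α : ℝ} {z : ℂ} (hz : z ∈ regularSet α) :
    connectedComponentIn (regularSet α) z = interior (Cell α z) := by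
  set V := connectedComponentIn (regularSet α) z with hV
  have hpre : IsPreconnected V := isPreconnected_connectedComponentIn
  have hVU : V ⊆ regularSet α := connectedComponentIn_subset _ _
  have hopen : IsOpen V := (isOpen_regularSet α).connectedComponentIn
  have hzV : z ∈ V := mem_connectedComponentIn hz
  have key : ∀ i : ℕ, ∀ w ∈ V, 0 < ((F α)^[i] z).im * ((F α)^[i] w).im := by
    intro i
    induction i using Nat.strong_induction_on with
    | _ n ih =>
      have hf : ∀ w ∈ V, (F α)^[n] w = (F α)^[n] z + mult α ^ n * (w - z) := fun w hw =>
        iterate_eq_of_same_side fun i hi => ih i hi w hw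
      have hc : ContinuousOn
          (fun w => ((F α)^[n] z).im * ((F α)^[n] z + mult α ^ n * (w - z)).im) V := by
        fun_prop
      intro w hw
      by_contra hneg
      have hzz : 0 < ((F α)^[n] z).im * ((F α)^[n] z + mult α ^ n * (z - z)).im := by
        rw [sub_self, mul_zero, add_zero]
        exact mul_self_pos.2 (im_ne_zero_of_mem_regularSet hz n)
      rw [hf w hw] at hneg
      have := hpre.intermediate_value hw hzV hc ⟨not_lt.1 hneg, hzz.le⟩
      obtain ⟨v, hv, hv0⟩ := this
      simp only at hv0
      rw [← hf v hv] at hv0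
      rcases mul_eq_zero.1 hv0 with h | h
      · exact im_ne_zero_of_mem_regularSet hz n h
      · exact im_ne_zero_of_mem_regularSet (hVU hv) n h
  have h1 : V ⊆ interior (Cell α z) := interior_maximal (fun w hw i => key i w hw) hopen
  refine h1.antisymm ?_
  exact (convex_Cell α z).interior.isPreconnected.subset_connectedComponentIn (h1 hzV)
    (interior_Cell_subset α z)

end PiecewiseRotation

end

/-! ### Trigonometric sums along the rotation orbit -/

noncomputable section

namespace PiecewiseRotation

open Real

/-- The `π`-periodic odd function `sign (sin θ) cos θ`. -/
def signedCos (θ : ℝ) : ℝ := Real.sign (sin θ) * cos θ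

lemma sign_sin_add_nat_mul_pi (θ : ℝ) (n : ℕ) :
    Real.sign (sin (θ + n * π)) = (-1) ^ n * Real.sign (sin θ) := by
  rw [sin_add_nat_mul_pi]
  rcases neg_one_pow_eq_or ℝ n with h | h <;> simp [h, Real.sign_neg]

lemma signedCos_add_nat_mul_pi (θ : ℝ) (n : ℕ) : signedCos (θ + n * π) = signedCos θ := by
  unfold signedCos
  rw [sign_sin_add_nat_mul_pi, cos_add_nat_mul_pi]
  rcases neg_one_pow_eq_or ℝ n with h | h <;> simp [h]

lemma signedCos_neg (θ : ℝ) : signedCos (-θ) = -signedCos θ := by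
  simp [signedCos, Real.sign_neg]

lemma abs_sign_le_one (x : ℝ) : |Real.sign x| ≤ 1 := by
  rcases Real.sign_apply_eq x with h | h | h <;> simp [h]

lemma abs_signedCos_le (θ : ℝ) : |signedCos θ| ≤ |cos θ| := by
  rw [signedCos, abs_mul]
  exact mul_le_of_le_one_left (abs_nonneg _) (abs_sign_le_one _)

lemma abs_sin_add_nat_mul_pi (θ : ℝ) (n : ℕ) : |sin (θ + n * π)| = |sin θ| := by
  rw [sin_add_nat_mul_pi, abs_mul, abs_pow, abs_neg, abs_one, one_pow, one_mul]

lemma abs_cos_add_nat_mul_pi (θ : ℝ) (n : ℕ) : |cos (θ + n * π)| = |cos θ| := by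
  rw [cos_add_nat_mul_pi, abs_mul, abs_pow, abs_neg, abs_one, one_pow, one_mul]

/-- The argument of `λ ^ t * exp (π i / (2 h))` for `λ = exp (π i p / h)`. -/
def ang (p h t : ℕ) : ℝ := π * (2 * p * t + 1) / (2 * h)

variable {p h : ℕ}

lemma ang_add_period (hh : h ≠ 0) (t : ℕ) : ang p h (t + h) = ang p h t + p * π := by
  unfold ang; push_cast; field_simp; ring

/-- Modulo `π` the angles are odd multiples of `π / (2h)`, a set symmetric under negation. The
hypothesis says that `t'` is the mirror partner of `t`. -/
lemma ang_reflect (hh : h ≠ 0) {t t' : ℕ} (H : h ∣ p * (t + t') + 1) :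
    ∃ w : ℕ, ang p h t' = -ang p h t + w * π := by
  obtain ⟨w, hw⟩ := H
  refine ⟨w, ?_⟩
  have : (p : ℝ) * (t + t') + 1 = h * w := by exact_mod_cast hw
  unfold ang
  field_simp
  linear_combination 2 * this

lemma sin_ang_ne_zero (hh : h ≠ 0) (t : ℕ) : sin (ang p h t) ≠ 0 := by
  intro h0
  obtain ⟨n, hn⟩ := sin_eq_zero_iff.1 h0
  unfold ang at hn
  have hπ := pi_ne_zero
  field_simp at hn
  have h1 : (n : ℤ) * 2 * h = 2 * p * t + 1 := by exact_mod_cast hn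
  have h2 : (n * h) * 2 = 2 * ((p : ℤ) * t) + 1 := by linarith
  omega

lemma ang_eq_remainder (hh : h ≠ 0) (t : ℕ) :
    ang p h t = π * (2 * (p * t % h : ℕ) + 1) / (2 * h) + (p * t / h : ℕ) * π := by
  have h1 : ((h * (p * t / h) + p * t % h : ℕ) : ℝ) = (p * t : ℕ) := by
    rw [Nat.div_add_mod]
  push_cast at h1
  unfold ang
  have : (2 * p * t + 1 : ℝ) = 2 * (p * t % h : ℕ) + 1 + 2 * h * (p * t / h : ℕ) := by
    linear_combination (-2) * h1
  rw [this]
  field_simp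

lemma ang_of_dvd (hh : h ≠ 0) {t : ℕ} (H : h ∣ t) :
    ∃ w : ℕ, ang p h t = π / (2 * h) + w * π := by
  obtain ⟨w, rfl⟩ := H
  refine ⟨p * w, ?_⟩
  unfold ang; push_cast; field_simp; ring

lemma ang_of_dvd_succ (hh : h ≠ 0) {t : ℕ} (H : h ∣ p * t + 1) :
    ∃ w : ℕ, ang p h t = -(π / (2 * h)) + w * π := by
  obtain ⟨w, hw⟩ := ang_reflect (p := p) hh (t := 0) (t' := t) (by simpa using H)
  exact ⟨w, by rw [hw]; simp [ang]⟩

lemma half_angle_pos (hh : h ≠ 0) : 0 < π / (2 * h) := by positivity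

lemma half_angle_lt (hh : 2 ≤ h) : π / (2 * h) ≤ π / 4 := by
  have : (2 : ℝ) ≤ h := by exact_mod_cast hh
  exact div_le_div_of_nonneg_left pi_pos.le (by norm_num) (by linarith)

lemma cos_half_angle_pos (hh : 2 ≤ h) : 0 < cos (π / (2 * h)) := by
  have h1 := half_angle_lt hh
  have h2 := half_angle_pos (h := h) (by omega)
  exact cos_pos_of_mem_Ioo ⟨by linarith [pi_pos], by linarith [pi_pos]⟩

lemma sin_half_angle_pos (hh : 2 ≤ h) : 0 < sin (π / (2 * h)) := by
  have h1 := half_angle_lt hh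
  have h2 := half_angle_pos (h := h) (by omega)
  exact sin_pos_of_pos_of_lt_pi h2 (by linarith [pi_pos])

/-- Modulo `π` the angle is `(2r + 1) π / (2h)` with `r = p t mod h`. Only `r = 0` and `r = h - 1`
reach the largest `|cos|`; the others stay at least `3π / (2h)` away from multiples of `π`. This
strict gap is what lets the barrier estimates hold for large radius. -/
lemma exists_cos_ang_bound (hh : 2 ≤ h) (hp : p.Coprime h) :
    ∃ δ : ℝ, 0 ≤ δ ∧ δ < cos (π / (2 * h)) ∧
      ∀ t, h ∣ t ∨ h ∣ p * t + 1 ∨ |cos (ang p h t)| ≤ δ := by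
  have h2 : (2 : ℝ) ≤ h := by exact_mod_cast hh
  have hpos : (0 : ℝ) < h := by linarith
  have hlt : cos (3 * (π / (2 * h))) < cos (π / (2 * h)) := by
    apply cos_lt_cos_of_nonneg_of_le_pi (half_angle_pos (by omega)).le
    · have := half_angle_lt hh
      linarith [pi_pos]
    · have := half_angle_pos (h := h) (by omega)
      linarith
  -- The maximum with 0 matters for `h = 2`, where the cosine is negative.
  refine ⟨max 0 (cos (3 * (π / (2 * h)))), le_max_left _ _,
    max_lt (cos_half_angle_pos hh) hlt, fun t => ?_⟩
  by_cases h0 : p * t % h = 0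
  · exact Or.inl (hp.symm.dvd_of_dvd_mul_left (Nat.dvd_of_mod_eq_zero h0))
  by_cases h1 : p * t % h + 1 = h
  · refine Or.inr (Or.inl ?_)
    rw [← Nat.div_add_mod (p * t) h, add_assoc, h1]
    exact (Dvd.intro _ rfl).add (dvd_refl h)
  refine Or.inr (Or.inr ?_)
  have hr := Nat.mod_lt (p * t) (show 0 < h by omega)
  rw [ang_eq_remainder (by omega), abs_cos_add_nat_mul_pi]
  set r := p * t % h
  have hr1 : (1 : ℝ) ≤ r := by exact_mod_cast (by omega : 1 ≤ r)
  have hr2 : (r : ℝ) + 2 ≤ h := by exact_mod_cast (by omega : r + 2 ≤ h)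
  have hb := half_angle_pos (h := h) (by omega)
  have e1 : π * (2 * r + 1) / (2 * h) = (2 * r + 1) * (π / (2 * h)) := by ring
  have e2 : π = (2 * h) * (π / (2 * h)) := by field_simp
  rw [e1]
  set b := π / (2 * h)
  have hle : (2 * r + 1) * b ≤ π := by rw [e2]; gcongr; linarith
  refine le_max_of_le_right (abs_le.2 ⟨?_, ?_⟩)
  · rw [neg_le, ← cos_pi_sub]
    apply cos_le_cos_of_nonneg_of_le_pi (by positivity)
    · have : 0 ≤ (2 * r + 1) * b := by positivity
      linarith
    · rw [e2]; nlinarith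
  · apply cos_le_cos_of_nonneg_of_le_pi (by positivity) hle
    gcongr; linarith

lemma sum_comp_mul_mod (hh : h ≠ 0) (hp : p.Coprime h) (f : ℕ → ℝ) :
    ∑ t ∈ Finset.range h, f (p * t % h) = ∑ r ∈ Finset.range h, f r := by
  have hinj : Set.InjOn (fun t => p * t % h) (Finset.range h) := by
    intro a ha b hb hab
    have h1 : p * a ≡ p * b [MOD h] := hab
    have h2 := Nat.ModEq.cancel_left_of_coprime (by simpa [Nat.coprime_comm] using hp) h1
    simp only [Finset.coe_range, Set.mem_Iio] at ha hb
    exact Nat.ModEq.eq_of_lt_of_lt h2 ha hb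
  have himg : (Finset.range h).image (fun t => p * t % h) = Finset.range h := by
    apply Finset.eq_of_subset_of_card_le
    · intro x hx
      obtain ⟨t, _, rfl⟩ := Finset.mem_image.1 hx
      exact Finset.mem_range.2 (Nat.mod_lt _ (by omega))
    · rw [Finset.card_image_of_injOn hinj]
  conv_rhs => rw [← himg, Finset.sum_image hinj]

/-- Multiplication by `p` permutes the residues modulo `h`, and the sum of sines of the odd
multiples of `π / (2h)` telescopes into cosines. -/
lemma sum_abs_sin_ang (hh : 2 ≤ h) (hp : p.Coprime h) :
    ∑ t ∈ Finset.range h, |sin (ang p h t)| = 1 / sin (π / (2 * h)) := by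
  have hs := sin_half_angle_pos hh
  have hpos : (0 : ℝ) < h := by exact_mod_cast (by omega : 0 < h)
  have h1 : ∀ t, |sin (ang p h t)| =
      (fun r : ℕ => |sin (π * (2 * r + 1) / (2 * h))|) (p * t % h) := fun t => by
    rw [ang_eq_remainder (by omega), abs_sin_add_nat_mul_pi]
  simp_rw [h1]
  rw [sum_comp_mul_mod (by omega) hp (fun r : ℕ => |sin (π * (2 * r + 1) / (2 * h))|)]
  have h2 : ∀ r ∈ Finset.range h, |sin (π * (2 * r + 1) / (2 * h))| =
      (cos (π * r / h) - cos (π * (r + 1 : ℕ) / h)) * (1 / (2 * sin (π / (2 * h)))) := by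
    intro r hr
    have hr' : (r : ℝ) + 1 ≤ h := by exact_mod_cast Finset.mem_range.1 hr
    rw [abs_of_nonneg]
    · rw [cos_sub_cos]
      have e1 : (π * r / h + π * (r + 1 : ℕ) / h) / 2 = π * (2 * r + 1) / (2 * h) := by
        push_cast; field_simp; ring
      have e2 : (π * r / h - π * (r + 1 : ℕ) / h) / 2 = -(π / (2 * h)) := by
        push_cast; field_simp; ring
      rw [e1, e2, sin_neg]
      field_simp
    · apply sin_nonneg_of_nonneg_of_le_pi (by positivity)
      rw [div_le_iff₀ (by positivity)]
      nlinarith [pi_pos]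
  rw [Finset.sum_congr rfl h2, ← Finset.sum_mul,
    Finset.sum_range_sub' (fun r : ℕ => cos (π * r / h))]
  simp only [Nat.cast_zero, mul_zero, zero_div, cos_zero]
  rw [mul_div_assoc, div_self hpos.ne', mul_one, cos_pi]
  field_simp
  norm_num

lemma signedCos_ang_reflect (hh : h ≠ 0) {t t' : ℕ} (H : h ∣ p * (t + t') + 1) :
    signedCos (ang p h t') = -signedCos (ang p h t) := by
  obtain ⟨w, hw⟩ := ang_reflect hh H
  rw [hw, signedCos_add_nat_mul_pi, signedCos_neg]

/-- Partial sums of `signedCos` along the orbit of angles. -/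
def cosSum (p h n : ℕ) : ℝ := ∑ t ∈ Finset.range n, signedCos (ang p h t)

/-- Partial sums of `|sin|` along the orbit of angles. -/
def sinSum (p h n : ℕ) : ℝ := ∑ t ∈ Finset.range n, |sin (ang p h t)|

lemma cosSum_succ (n : ℕ) : cosSum p h (n + 1) = cosSum p h n + signedCos (ang p h n) :=
  Finset.sum_range_succ _ _

lemma sinSum_succ (n : ℕ) : sinSum p h (n + 1) = sinSum p h n + |sin (ang p h n)| :=
  Finset.sum_range_succ _ _

/-- Reversing the block sends each index to its mirror partner, which changes the sign of every
term. -/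
lemma cosSum_eq_zero_of_reflect (hh : h ≠ 0) (a K : ℕ) (H : h ∣ p * (2 * a + K) + 1) :
    ∑ t ∈ Finset.range (K + 1), signedCos (ang p h (a + t)) = 0 := by
  have h1 := Finset.sum_range_reflect (fun t => signedCos (ang p h (a + t))) (K + 1)
  have h2 : ∑ t ∈ Finset.range (K + 1), signedCos (ang p h (a + (K + 1 - 1 - t))) =
      ∑ t ∈ Finset.range (K + 1), -signedCos (ang p h (a + t)) := by
    refine Finset.sum_congr rfl fun t ht => signedCos_ang_reflect hh ?_
    have := Finset.mem_range.1 ht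
    have e : a + t + (a + (K + 1 - 1 - t)) = 2 * a + K := by omega
    rwa [e]
  rw [h2, Finset.sum_neg_distrib] at h1
  linarith

lemma cosSum_of_dvd_succ_lt (hh : h ≠ 0) {n : ℕ} (H : h ∣ p * n + 1) :
    cosSum p h n = cos (π / (2 * h)) := by
  have h1 := cosSum_eq_zero_of_reflect hh 0 n (by simpa using H)
  simp only [zero_add] at h1
  have h2 : cosSum p h (n + 1) = 0 := h1
  rw [cosSum_succ] at h2
  have h3 := signedCos_ang_reflect (p := p) hh (t := 0) (t' := n) (by simpa using H)
  have h4 : signedCos (ang p h 0) = cos (π / (2 * h)) := by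
    have hpos : 0 < sin (π / (2 * h)) := by
      have : (1 : ℝ) ≤ h := by exact_mod_cast (by omega : 1 ≤ h)
      apply sin_pos_of_pos_of_lt_pi (half_angle_pos hh)
      rw [div_lt_iff₀ (by positivity)]
      nlinarith [pi_pos]
    simp [signedCos, ang, Real.sign_of_pos hpos]
  linarith

lemma exists_dvd_succ (hh : 2 ≤ h) (hp : p.Coprime h) : ∃ n, 0 < n ∧ n < h ∧ h ∣ p * n + 1 := by
  obtain ⟨m, hm, hmod⟩ := Nat.exists_mul_mod_eq_one_of_coprime hp (by omega)
  have hm0 : m ≠ 0 := by rintro rfl; simp at hmod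
  refine ⟨h - m, by omega, by omega, ?_⟩
  have h1 : p * (h - m) + p * m = p * h := by rw [← mul_add]; congr 1; omega
  have h2 := Nat.div_add_mod (p * m) h
  rw [hmod] at h2
  have h5 : (p * (h - m) + 1) + h * (p * m / h) = p * h := by omega
  exact (Nat.dvd_add_left (Dvd.intro _ rfl)).1 (h5 ▸ Dvd.intro_left p rfl)

/-- With `p n ≡ -1` modulo `h`, each of the blocks `[0, n]` and `[n + 1, h - 1]` is its own mirror
image. -/
lemma cosSum_period (hh : 2 ≤ h) (hp : p.Coprime h) : cosSum p h h = 0 := by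
  obtain ⟨n, hn0, hnh, hn⟩ := exists_dvd_succ hh hp
  have h1 := cosSum_eq_zero_of_reflect (p := p) (h := h) (by omega) 0 n (by simpa using hn)
  simp only [zero_add] at h1
  have e : h = (n + 1) + (h - n - 1) := by omega
  have h2 : cosSum p h ((n + 1) + (h - n - 1)) = 0 := by
    unfold cosSum
    rw [Finset.sum_range_add, h1, zero_add]
    rcases Nat.eq_zero_or_pos (h - n - 1) with h0 | h0
    · simp [h0]
    · obtain ⟨K, hK⟩ : ∃ K, h - n - 1 = K + 1 := ⟨h - n - 2, by omega⟩
      rw [hK]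
      apply cosSum_eq_zero_of_reflect (by omega)
      have : 2 * (n + 1) + K = n + h := by omega
      rw [this, mul_add, add_right_comm]
      exact hn.add (Dvd.intro_left _ rfl)
  rwa [← e] at h2

lemma cosSum_add_period (hh : 2 ≤ h) (hp : p.Coprime h) (t : ℕ) :
    cosSum p h (t + h) = cosSum p h t := by
  induction t with
  | zero => rw [zero_add, cosSum_period hh hp]; simp [cosSum]
  | succ t ih =>
    rw [add_right_comm, cosSum_succ, cosSum_succ, ih, ang_add_period (by omega),
      signedCos_add_nat_mul_pi]

lemma sinSum_add_period (hh : 2 ≤ h) (hp : p.Coprime h) (t : ℕ) :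
    sinSum p h (t + h) = sinSum p h t + 1 / sin (π / (2 * h)) := by
  induction t with
  | zero => rw [zero_add, ← sum_abs_sin_ang hh hp]; simp [sinSum]
  | succ t ih =>
    rw [add_right_comm, sinSum_succ, sinSum_succ, ih, ang_add_period (by omega),
      abs_sin_add_nat_mul_pi]
    ring

lemma sinSum_mono : Monotone (sinSum p h) :=
  monotone_nat_of_le_succ fun n => by rw [sinSum_succ]; linarith [abs_nonneg (sin (ang p h n))]

lemma sinSum_nonneg (n : ℕ) : 0 ≤ sinSum p h n := Finset.sum_nonneg fun _ _ => abs_nonneg _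

lemma cosSum_add_mul_period (hh : 2 ≤ h) (hp : p.Coprime h) (t m : ℕ) :
    cosSum p h (t + m * h) = cosSum p h t := by
  induction m with
  | zero => simp
  | succ m ih => rw [Nat.succ_mul, ← add_assoc, cosSum_add_period hh hp, ih]

lemma abs_cosSum_le (hh : 2 ≤ h) (hp : p.Coprime h) (t : ℕ) : |cosSum p h t| ≤ h := by
  have h1 : cosSum p h t = cosSum p h (t % h) := by
    conv_lhs => rw [← Nat.mod_add_div t h, mul_comm, cosSum_add_mul_period hh hp]
  rw [h1]
  calc |cosSum p h (t % h)| ≤ ∑ u ∈ Finset.range (t % h), |signedCos (ang p h u)| :=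
        Finset.abs_sum_le_sum_abs _ _
    _ ≤ ∑ u ∈ Finset.range (t % h), (1 : ℝ) :=
        Finset.sum_le_sum fun u _ => (abs_signedCos_le _).trans (abs_cos_le_one _)
    _ = (t % h : ℕ) := by simp
    _ ≤ h := by exact_mod_cast (Nat.mod_lt t (by omega)).le

lemma cosSum_of_dvd (hh : 2 ≤ h) (hp : p.Coprime h) {t : ℕ} (H : h ∣ t) : cosSum p h t = 0 := by
  obtain ⟨w, rfl⟩ := H
  have := cosSum_add_mul_period hh hp 0 w
  rw [zero_add, mul_comm] at this
  rw [this]; simp [cosSum]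

end PiecewiseRotation

end

/-! ### The necklace: centres of its polygons and the barrier conditions -/

noncomputable section

namespace PiecewiseRotation

open Real

variable {p h : ℕ}

/-- The unit vector `λ ^ t * exp (π i / (2 h))`, where `λ = exp (π i p / h)`. -/
def unitDir (p h t : ℕ) : ℂ := Complex.exp (ang p h t * Complex.I)

lemma unitDir_re (t : ℕ) : (unitDir p h t).re = cos (ang p h t) := Complex.exp_ofReal_mul_I_re _

lemma unitDir_im (t : ℕ) : (unitDir p h t).im = sin (ang p h t) := Complex.exp_ofReal_mul_I_im _

lemma unitDir_eq (t : ℕ) :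
    unitDir p h t = cos (ang p h t) + sin (ang p h t) * Complex.I := by
  unfold unitDir; rw [Complex.exp_mul_I]; push_cast; rfl

lemma unitDir_succ (hh : h ≠ 0) (t : ℕ) :
    unitDir p h (t + 1) = mult (π * p / h) * unitDir p h t := by
  unfold unitDir mult
  rw [← Complex.exp_add, ← add_mul, ← Complex.ofReal_add]
  congr 3
  unfold ang; push_cast; field_simp; ring

lemma unitDir_zero : unitDir p h 0 =
    cos (π / (2 * h)) + sin (π / (2 * h)) * Complex.I := by
  rw [unitDir_eq]; simp [ang]

lemma unitDir_eq_pow (hh : h ≠ 0) (t : ℕ) :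
    unitDir p h t = mult (π * p / h) ^ t * unitDir p h 0 := by
  induction t with
  | zero => simp
  | succ t ih => rw [unitDir_succ hh, ih, pow_succ']; ring

lemma exp_add_nat_mul_pi (θ : ℝ) (w : ℕ) :
    Complex.exp ((θ + w * π : ℝ) * Complex.I) = (-1) ^ w * Complex.exp (θ * Complex.I) := by
  push_cast
  rw [add_mul, Complex.exp_add, mul_assoc, Complex.exp_nat_mul, Complex.exp_pi_mul_I]
  ring

lemma unitDir_of_dvd_succ (hh : h ≠ 0) {t : ℕ} (H : h ∣ p * t + 1) : ∃ w : ℕ,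
    unitDir p h t = (-1) ^ w * (cos (π / (2 * h)) - sin (π / (2 * h)) * Complex.I) := by
  obtain ⟨w, hw⟩ := ang_of_dvd_succ hh H
  refine ⟨w, ?_⟩
  rw [unitDir, hw, exp_add_nat_mul_pi, Complex.exp_mul_I, ← Complex.ofReal_cos,
    ← Complex.ofReal_sin, cos_neg, sin_neg]
  push_cast; ring

lemma unitDir_add_period (hh : h ≠ 0) (t : ℕ) :
    unitDir p h (t + h) = (-1) ^ p * unitDir p h t := by
  rw [unitDir, ang_add_period hh, exp_add_nat_mul_pi, unitDir]

lemma abs_sin_half_angle (hh : 2 ≤ h) : |sin (π / (2 * h))| = sin (π / (2 * h)) :=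
  abs_of_pos (sin_half_angle_pos hh)

lemma signedCos_half_angle (hh : 2 ≤ h) : signedCos (π / (2 * h)) = cos (π / (2 * h)) := by
  rw [signedCos, Real.sign_of_pos (sin_half_angle_pos hh), one_mul]

lemma signedCos_of_dvd (hh : 2 ≤ h) {t : ℕ} (H : h ∣ t) :
    signedCos (ang p h t) = cos (π / (2 * h)) := by
  obtain ⟨w, hw⟩ := ang_of_dvd (p := p) (by omega) H
  rw [hw, signedCos_add_nat_mul_pi, signedCos_half_angle hh]

lemma signedCos_of_dvd_succ (hh : 2 ≤ h) {t : ℕ} (H : h ∣ p * t + 1) :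
    signedCos (ang p h t) = -cos (π / (2 * h)) := by
  obtain ⟨w, hw⟩ := ang_of_dvd_succ (p := p) (by omega) H
  rw [hw, signedCos_add_nat_mul_pi, signedCos_neg, signedCos_half_angle hh]

lemma abs_sin_of_dvd (hh : 2 ≤ h) {t : ℕ} (H : h ∣ t) :
    |sin (ang p h t)| = sin (π / (2 * h)) := by
  obtain ⟨w, hw⟩ := ang_of_dvd (p := p) (by omega) H
  rw [hw, abs_sin_add_nat_mul_pi, abs_sin_half_angle hh]

lemma abs_sin_of_dvd_succ (hh : 2 ≤ h) {t : ℕ} (H : h ∣ p * t + 1) :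
    |sin (ang p h t)| = sin (π / (2 * h)) := by
  obtain ⟨w, hw⟩ := ang_of_dvd_succ (p := p) (by omega) H
  rw [hw, abs_sin_add_nat_mul_pi, sin_neg, abs_neg, abs_sin_half_angle hh]

lemma abs_cos_ang_le (hh : 2 ≤ h) (hp : p.Coprime h) (t : ℕ) :
    |cos (ang p h t)| ≤ cos (π / (2 * h)) := by
  obtain ⟨δ, _, hδ, H⟩ := exists_cos_ang_bound hh hp
  rcases H t with h1 | h1 | h1
  · obtain ⟨w, hw⟩ := ang_of_dvd (p := p) (by omega) h1
    rw [hw, abs_cos_add_nat_mul_pi, abs_of_pos (cos_half_angle_pos hh)]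
  · obtain ⟨w, hw⟩ := ang_of_dvd_succ (p := p) (by omega) h1
    rw [hw, abs_cos_add_nat_mul_pi, cos_neg, abs_of_pos (cos_half_angle_pos hh)]
  · exact h1.trans hδ.le

lemma cart_re (a b : ℝ) : ((a : ℂ) + b * Complex.I).re = a := by simp

lemma cart_im (a b : ℝ) : ((a : ℂ) + b * Complex.I).im = b := by simp

lemma cart_mul (a b u v : ℝ) : ((a : ℂ) + b * Complex.I) * (u + v * Complex.I) =
    ((a * u - b * v : ℝ) : ℂ) + (a * v + b * u : ℝ) * Complex.I := by
  push_cast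
  linear_combination (b * v : ℂ) * Complex.I_sq

lemma cart_sub_mul (a b u v : ℝ) : ((a : ℂ) - b * Complex.I) * (u + v * Complex.I) =
    ((a * u + b * v : ℝ) : ℂ) + (a * v - b * u : ℝ) * Complex.I := by
  push_cast
  linear_combination (-(b * v) : ℂ) * Complex.I_sq

/-- The orbit of the centre of a regular polygon in a necklace of periodic polygons which
surrounds the origin at distance about `x`. -/
def ctr (p h : ℕ) (x : ℝ) (t : ℕ) : ℂ :=
  unitDir p h t * ((cos (π / (2 * h)) * (x + 1 / 2) - cosSum p h t : ℝ) +
    (cos (π / (2 * h)) ^ 2 / (2 * sin (π / (2 * h))) - x * sin (π / (2 * h)) +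
      sinSum p h t : ℝ) * Complex.I)

/-- In the frame turning with `unitDir`, subtracting the sign adds `-signedCos` to the real
coordinate and `|sin|` to the imaginary one; hence the two partial sums in `ctr`. The step agrees
with the map whenever the centre is on the side given by `sin (ang p h t)`. -/
lemma ctr_succ (hh : h ≠ 0) (x : ℝ) (t : ℕ) :
    ctr p h x (t + 1) =
      mult (π * p / h) * (ctr p h x t - (Real.sign (sin (ang p h t)) : ℝ)) := by
  have h1 : unitDir p h t * (-(signedCos (ang p h t) : ℝ) + (|sin (ang p h t)| : ℝ) * Complex.I)
      = -(Real.sign (sin (ang p h t)) : ℝ) := by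
    have hcs : ((cos (ang p h t) : ℝ) : ℂ) ^ 2 + ((sin (ang p h t) : ℝ) : ℂ) ^ 2 = 1 := by
      exact_mod_cast cos_sq_add_sin_sq _
    have hs := sin_ang_ne_zero (p := p) hh t
    rw [unitDir_eq, signedCos]
    generalize cos (ang p h t) = u at *
    generalize sin (ang p h t) = v at *
    rcases lt_or_gt_of_ne hs with hs | hs
    · rw [abs_of_neg hs, Real.sign_of_neg hs]
      push_cast
      linear_combination hcs - (v : ℂ) ^ 2 * Complex.I_sq
    · rw [abs_of_pos hs, Real.sign_of_pos hs]
      push_cast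
      linear_combination -hcs + (v : ℂ) ^ 2 * Complex.I_sq
  unfold ctr
  rw [unitDir_succ hh, cosSum_succ, sinSum_succ]
  push_cast at h1 ⊢
  linear_combination mult (π * p / h) * h1

lemma sign_mul_ctr_im (x : ℝ) (t : ℕ) :
    Real.sign (sin (ang p h t)) * (ctr p h x t).im =
      |sin (ang p h t)| * (cos (π / (2 * h)) * (x + 1 / 2) - cosSum p h t) +
      signedCos (ang p h t) *
        (cos (π / (2 * h)) ^ 2 / (2 * sin (π / (2 * h))) - x * sin (π / (2 * h)) +
          sinSum p h t) := by
  have h1 : |sin (ang p h t)| = Real.sign (sin (ang p h t)) * sin (ang p h t) := by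
    rcases lt_trichotomy (sin (ang p h t)) 0 with hs | hs | hs
    · rw [abs_of_neg hs, Real.sign_of_neg hs]; ring
    · simp [hs]
    · rw [abs_of_pos hs, Real.sign_of_pos hs]; ring
  rw [h1, ctr, Complex.mul_im, unitDir_re, unitDir_im, signedCos, cart_re, cart_im]
  ring

/-- The height is the inradius of the regular `2h`-gon with side 1, so the first polygon rests on
the real axis along `[x - 1/2, x + 1/2]`. -/
lemma ctr_zero (hh : 2 ≤ h) (x : ℝ) :
    ctr p h x 0 = x + (cos (π / (2 * h)) / (2 * sin (π / (2 * h))) : ℝ) * Complex.I := by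
  have hs := sin_half_angle_pos hh
  have hcs := cos_sq_add_sin_sq (π / (2 * h))
  unfold ctr
  rw [unitDir_zero]
  set c := cos (π / (2 * h))
  set s := sin (π / (2 * h))
  have e1 : c * (c * (x + 1 / 2) - cosSum p h 0) -
      s * (c ^ 2 / (2 * s) - x * s + sinSum p h 0) = x := by
    simp only [cosSum, sinSum, Finset.range_zero, Finset.sum_empty]
    field_simp
    linear_combination (2 * x) * hcs
  have e2 : c * (c ^ 2 / (2 * s) - x * s + sinSum p h 0) +
      s * (c * (x + 1 / 2) - cosSum p h 0) = c / (2 * s) := by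
    simp only [cosSum, sinSum, Finset.range_zero, Finset.sum_empty]
    field_simp
    linear_combination c * hcs
  rw [cart_mul, e1, e2]

lemma ctr_of_dvd_succ (hh : 2 ≤ h) (x : ℝ) {t : ℕ} (H : h ∣ p * t + 1) :
    ∃ w : ℕ, ctr p h x t = (-1) ^ w *
      ((cos (π / (2 * h)) - sin (π / (2 * h)) * Complex.I) *
      ((cos (π / (2 * h)) * (x - 1 / 2) : ℝ) +
      (cos (π / (2 * h)) ^ 2 / (2 * sin (π / (2 * h))) - x * sin (π / (2 * h)) +
      sinSum p h t : ℝ) * Complex.I)) := by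
  obtain ⟨w, hw⟩ := unitDir_of_dvd_succ (p := p) (by omega) H
  refine ⟨w, ?_⟩
  rw [ctr, hw, cosSum_of_dvd_succ_lt (by omega) H]
  push_cast
  ring

/-- This closes the necklace: the frame is, up to sign, the conjugate of the initial one, and the
value of `sinSum` brings the centre back to the start up to sign. -/
lemma ctr_of_full_turn (hh : 2 ≤ h) (x : ℝ) {t : ℕ} (H : h ∣ p * t + 1)
    (hs : sinSum p h t = 2 * x * sin (π / (2 * h))) :
    ctr p h x t = ctr p h x 0 ∨ ctr p h x t = -ctr p h x 0 := by
  obtain ⟨w, hw⟩ := ctr_of_dvd_succ hh x H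
  have key : (cos (π / (2 * h)) - sin (π / (2 * h)) * Complex.I) *
      ((cos (π / (2 * h)) * (x - 1 / 2) : ℝ) +
      (cos (π / (2 * h)) ^ 2 / (2 * sin (π / (2 * h))) - x * sin (π / (2 * h)) +
      sinSum p h t : ℝ) * Complex.I) = ctr p h x 0 := by
    have hs0 := sin_half_angle_pos hh
    have hcs := cos_sq_add_sin_sq (π / (2 * h))
    rw [ctr_zero hh, hs]
    set c := cos (π / (2 * h))
    set s := sin (π / (2 * h))
    have e1 : c * (c * (x - 1 / 2)) + s * (c ^ 2 / (2 * s) - x * s + 2 * x * s) = x := by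
      field_simp
      linear_combination (2 * x) * hcs
    have e2 : c * (c ^ 2 / (2 * s) - x * s + 2 * x * s) - s * (c * (x - 1 / 2)) =
        c / (2 * s) := by
      field_simp
      linear_combination c * hcs
    rw [cart_sub_mul, e1, e2]
  rw [hw, key]
  rcases neg_one_pow_eq_or ℂ w with h1 | h1 <;> simp [h1]

/-- One period `h` before closing, the polygon hangs, up to sign, from the real axis along `[x -
3/2, x - 1/2]`. It catches the points that would otherwise jump out. -/
lemma ctr_of_last_turn (hh : 2 ≤ h) (x : ℝ) {t : ℕ} (H : h ∣ p * t + 1)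
    (hs : sinSum p h t = 2 * x * sin (π / (2 * h)) - 1 / sin (π / (2 * h))) :
    ∃ w : ℕ, ctr p h x t =
      (-1) ^ w * ((x - 1 : ℝ) -
        (cos (π / (2 * h)) / (2 * sin (π / (2 * h))) : ℝ) * Complex.I) := by
  obtain ⟨w, hw⟩ := ctr_of_dvd_succ hh x H
  refine ⟨w, ?_⟩
  rw [hw]
  congr 1
  have hs0 := sin_half_angle_pos hh
  have hcs := cos_sq_add_sin_sq (π / (2 * h))
  rw [hs]
  set c := cos (π / (2 * h))
  set s := sin (π / (2 * h))
  have e1 : c * (c * (x - 1 / 2)) + s * (c ^ 2 / (2 * s) - x * s + (2 * x * s - 1 / s)) =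
      x - 1 := by
    field_simp
    linear_combination (2 * x) * hcs
  have e2 : c * (c ^ 2 / (2 * s) - x * s + (2 * x * s - 1 / s)) - s * (c * (x - 1 / 2)) =
      -(c / (2 * s)) := by
    field_simp
    linear_combination c * hcs
  rw [cart_sub_mul, e1, e2]
  push_cast
  ring

/-- The conditions under which the polygons centred at `± ctr p h x t`, `t < T`, form a necklace
that no orbit can cross. -/
structure IsBarrier (p h : ℕ) (x : ℝ) (T : ℕ) : Prop where
  two_le : 2 ≤ h
  coprime : p.Coprime h
  le : h ≤ T
  dvd : h ∣ p * T + 1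
  sum : sinSum p h T = 2 * x * sin (π / (2 * h))
  -- The inradius is on the left, so the whole polygon lies in one closed half-plane and moves as a
  -- block.
  far : ∀ t < T, cos (π / (2 * h)) / (2 * sin (π / (2 * h))) ≤
    Real.sign (sin (ang p h t)) * (ctr p h x t).im
  -- Where the bound defining `inside` shrinks, other than in the extreme direction, there must be
  -- room for a unit step.
  large : ∀ t, ¬ h ∣ t → 0 < signedCos (ang p h t) →
    signedCos (ang p h t) * (x + 2) ≤ cos (π / (2 * h)) * (x + 1 / 2) - cosSum p h t

set_option maxHeartbeats 1000000 in
-- Both barrier conditions compare a term linear in `x`, with positive coefficient thanks to the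
-- cosine gap, with bounded terms. The lengths `T = n + M h` close the necklace, and `x` grows with
-- `M`.
lemma exists_barrier (hh : 2 ≤ h) (hp : p.Coprime h) (R : ℝ) :
    ∃ x T, IsBarrier p h x T ∧ R < cos (π / (2 * h)) * (x + 1 / 2) - h := by
  obtain ⟨δ, hδ0, hδ, H⟩ := exists_cos_ang_bound hh hp
  obtain ⟨n, hn0, hnh, hn⟩ := exists_dvd_succ hh hp
  have hc := cos_half_angle_pos hh
  have hs := sin_half_angle_pos hh
  have hcs := cos_sq_add_sin_sq (π / (2 * h))
  have hmod : ∀ T, h ∣ p * T + 1 → ∀ t < T, h ∣ p * t + 1 → t + h ≤ T := by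
    intro T hT t ht htd
    have h1 : h ∣ p * (T - t) := by
      have := Nat.dvd_sub hT htd
      rwa [Nat.add_sub_add_right, ← Nat.mul_sub] at this
    have h2 : h ∣ T - t := hp.symm.dvd_of_dvd_mul_left h1
    have := Nat.le_of_dvd (by omega) h2
    omega
  have hper := sinSum_add_period hh hp
  set c := cos (π / (2 * h)) with hcdef
  set s := sin (π / (2 * h)) with hsdef
  set η := √(1 - δ ^ 2) with hηdef
  have hη : s < η := by
    rw [hηdef]; apply Real.lt_sqrt_of_sq_lt; nlinarith
  have hpos : 0 < η * c - δ * s := by nlinarith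
  have hb : (0 : ℝ) ≤ h := Nat.cast_nonneg h
  -- The three quotients are the thresholds on `x` for `far`, for `large` and for enclosing the
  -- radius `R`. As `sinSum` gains `1 / s` per period, `x ≥ M / (2 s ^ 2)`. The extra 1 forces `M ≥
  -- 1`, hence `h ≤ T`.
  obtain ⟨M, hM⟩ := exists_nat_ge (2 * s ^ 2 * (max (max 0 ((c / (2 * s) + η * h +
    δ * (c ^ 2 / (2 * s))) / (η * c - δ * s))) (max ((h + 2) / (c - δ)) ((|R| + h) / c))) + 1)
  have hsum : ∀ m : ℕ, sinSum p h (n + m * h) = sinSum p h n + m / s := by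
    intro m
    induction m with
    | zero => simp
    | succ m ih => rw [Nat.succ_mul, ← add_assoc, hper, ih]; push_cast; ring
  set X := max (max 0 ((c / (2 * s) + η * h +
    δ * (c ^ 2 / (2 * s))) / (η * c - δ * s))) (max ((h + 2) / (c - δ)) ((|R| + h) / c))
  have hX0 : 0 ≤ X := le_max_of_le_left (le_max_left _ _)
  set x := sinSum p h (n + M * h) / (2 * s) with hx
  have hxX : X ≤ x := by
    rw [hx, le_div_iff₀ (by positivity), hsum]
    have h1 := sinSum_nonneg (p := p) (h := h) n
    have h2 : X * (2 * s) ≤ M / s := by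
      rw [le_div_iff₀ hs]; nlinarith
    linarith
  have hx0 : 0 ≤ x := hX0.trans hxX
  have hx1 : (c / (2 * s) + η * h + δ * (c ^ 2 / (2 * s))) ≤ x * (η * c - δ * s) := by
    rw [← div_le_iff₀ hpos]
    exact ((le_max_right _ _).trans (le_max_left _ _)).trans hxX
  have hx2 : h + 2 ≤ x * (c - δ) := by
    rw [← div_le_iff₀ (by linarith)]
    exact ((le_max_left _ _).trans (le_max_right _ _)).trans hxX
  have hx3 : |R| + h ≤ x * c := by
    rw [← div_le_iff₀ hc]
    exact ((le_max_right _ _).trans (le_max_right _ _)).trans hxX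
  have hM1 : 1 ≤ M := by
    have : (1 : ℝ) ≤ M := le_trans (by nlinarith [sq_nonneg s]) hM
    exact_mod_cast this
  have hT : h ∣ p * (n + M * h) + 1 := by
    rw [mul_add, add_right_comm]
    exact hn.add ((Dvd.intro_left _ rfl).mul_left _)
  have hTsum : sinSum p h (n + M * h) = 2 * x * s := by rw [hx]; field_simp
  refine ⟨x, n + M * h, ⟨hh, hp, by nlinarith, hT, hTsum, ?_, ?_⟩, ?_⟩
  · intro t ht
    rw [sign_mul_ctr_im]
    have hY0 := sinSum_nonneg (p := p) (h := h) t
    have hYT : sinSum p h t ≤ 2 * x * s := hTsum ▸ sinSum_mono ht.le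
    rw [← hcdef, ← hsdef]
    rcases H t with h1 | h1 | h1
    · rw [signedCos_of_dvd hh h1, abs_sin_of_dvd hh h1, cosSum_of_dvd hh hp h1, ← hcdef, ← hsdef]
      have e : s * (c * (x + 1 / 2) - 0) + c * (c ^ 2 / (2 * s) - x * s + sinSum p h t) =
          c / (2 * s) * (s ^ 2 + c ^ 2) + c * sinSum p h t := by field_simp; ring
      rw [e, add_comm (s ^ 2), hcs, mul_one]
      linarith [mul_nonneg hc.le hY0]
    · rw [signedCos_of_dvd_succ hh h1, abs_sin_of_dvd_succ hh h1,
        cosSum_of_dvd_succ_lt (by omega) h1, ← hcdef, ← hsdef]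
      -- An index `t < T` congruent to `T` modulo `h` is at least one full period earlier; this
      -- period pays for the inradius.
      have h2 : sinSum p h t + 1 / s ≤ 2 * x * s := by
        rw [← hper, ← hTsum]
        exact sinSum_mono (hmod _ hT t ht h1)
      have e : s * (c * (x + 1 / 2) - c) + -c * (c ^ 2 / (2 * s) - x * s + sinSum p h t) =
          -(c / (2 * s) * (s ^ 2 + c ^ 2)) + c * (2 * x * s - sinSum p h t) := by
        field_simp; ring
      rw [e, add_comm (s ^ 2), hcs, mul_one]
      have h3 : c * (1 / s) ≤ c * (2 * x * s - sinSum p h t) := by gcongr; linarith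
      have h4 : c * (1 / s) = c / (2 * s) + c / (2 * s) := by field_simp; ring
      linarith
    -- Away from the extreme directions `|sin| ≥ η > s` and `|signedCos| ≤ δ < c`, so `x` enters
    -- with coefficient at least `η c - δ s > 0`.
    · have h2 := abs_cosSum_le hh hp t
      have h3 : η ≤ |sin (ang p h t)| := by
        rw [hηdef]
        apply Real.sqrt_le_iff.2 ⟨abs_nonneg _, ?_⟩
        have := cos_sq_add_sin_sq (ang p h t)
        have h4 : cos (ang p h t) ^ 2 ≤ δ ^ 2 := sq_le_sq' (abs_le.1 h1).1 (abs_le.1 h1).2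
        rw [sq_abs]; linarith
      have h4 : |signedCos (ang p h t)| ≤ δ := (abs_signedCos_le _).trans h1
      have h5 : |c ^ 2 / (2 * s) - x * s + sinSum p h t| ≤ x * s + c ^ 2 / (2 * s) := by
        have : 0 ≤ c ^ 2 / (2 * s) := by positivity
        rw [abs_le]; constructor <;> linarith
      have h6 : |signedCos (ang p h t) * (c ^ 2 / (2 * s) - x * s + sinSum p h t)| ≤
          δ * (x * s + c ^ 2 / (2 * s)) := by
        rw [abs_mul]; gcongr
      have h7 : η * (c * x - h) ≤ |sin (ang p h t)| * (c * (x + 1 / 2) - cosSum p h t) := by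
        have h8 : c * x - h ≤ c * (x + 1 / 2) - cosSum p h t := by
          linarith [(abs_le.1 h2).2]
        have h9 : 0 ≤ c * x - h := by linarith [abs_nonneg R]
        gcongr
      have := (abs_le.1 h6).1
      linarith
  · intro t ht hg
    rcases H t with h1 | h1 | h1
    · exact absurd h1 ht
    · rw [signedCos_of_dvd_succ hh h1] at hg
      linarith
    · have h2 := abs_cosSum_le hh hp t
      have h4 : |signedCos (ang p h t)| ≤ δ := (abs_signedCos_le _).trans h1
      have h5 : |signedCos (ang p h t)| ≤ 1 :=
        (abs_signedCos_le _).trans (abs_cos_le_one _)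
      rw [abs_of_pos hg] at h4 h5
      have := (abs_le.1 h2).2
      linarith [mul_le_mul_of_nonneg_right h4 hx0]
  · have := le_abs_self R
    linarith

end PiecewiseRotation

end

/-! ### The necklace traps orbits -/

noncomputable section

namespace PiecewiseRotation

open Real

variable {p h : ℕ}

/-- The regular polygon of inradius `cot (π / (2 h)) / 2` centred at the origin. -/
def islet (p h : ℕ) : Set ℂ :=
  {u | ∀ t : ℕ, |(mult (π * p / h) ^ t * u).im| ≤ cos (π / (2 * h)) / (2 * sin (π / (2 * h)))}

/-- The region inside the necklace of radius `x`. -/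
def inside (p h : ℕ) (x : ℝ) : Set ℂ :=
  {z | ∀ t : ℕ, |(z * (starRingEnd ℂ) (unitDir p h t)).re| <
    cos (π / (2 * h)) * (x + 1 / 2) - cosSum p h t}

/-- The necklace of radius `x` together with its inside. -/
def trap (p h : ℕ) (x : ℝ) (T : ℕ) : Set ℂ :=
  {z | z ∈ inside p h x ∨
    ∃ t < T, z - ctr p h x t ∈ islet p h ∨ -z - ctr p h x t ∈ islet p h}

lemma neg_mem_islet {u : ℂ} (hu : u ∈ islet p h) : -u ∈ islet p h := fun t => by
  rw [mul_neg, Complex.neg_im, abs_neg]; exact hu t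

lemma mult_mul_mem_islet {u : ℂ} (hu : u ∈ islet p h) :
    mult (π * p / h) * u ∈ islet p h := fun t => by
  rw [← mul_assoc, ← pow_succ]; exact hu (t + 1)

lemma neg_mem_inside {x : ℝ} {z : ℂ} (hz : z ∈ inside p h x) : -z ∈ inside p h x := fun t => by
  rw [neg_mul, Complex.neg_re, abs_neg]; exact hz t

lemma neg_mem_trap {x : ℝ} {T : ℕ} {z : ℂ} (hz : z ∈ trap p h x T) : -z ∈ trap p h x T := by
  rcases hz with hz | ⟨t, ht, hz⟩
  · exact Or.inl (neg_mem_inside hz)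
  · refine Or.inr ⟨t, ht, ?_⟩
    rw [neg_neg]
    exact hz.symm

lemma mul_conj_unitDir_re (z : ℂ) (t : ℕ) :
    (z * (starRingEnd ℂ) (unitDir p h t)).re =
      z.re * cos (ang p h t) + z.im * sin (ang p h t) := by
  rw [Complex.mul_re, Complex.conj_re, Complex.conj_im, unitDir_re, unitDir_im]; ring

lemma unitDir_mul_conj (t : ℕ) : unitDir p h t * (starRingEnd ℂ) (unitDir p h t) = 1 := by
  rw [Complex.mul_conj, Complex.normSq_apply, unitDir_re, unitDir_im]
  have := cos_sq_add_sin_sq (ang p h t)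
  exact_mod_cast (by nlinarith)

lemma mult_pow_eq (hh : h ≠ 0) (t : ℕ) :
    mult (π * p / h) ^ t = unitDir p h t * (starRingEnd ℂ) (unitDir p h 0) := by
  rw [unitDir_eq_pow hh t, mul_assoc, unitDir_mul_conj, mul_one]

/-- By `far` the polygon `t` does not cross the real line, so it is carried onto polygon `t + 1`;
after the last one the necklace closes up to sign. -/
lemma F_mem_trap_of_islet {x : ℝ} {T : ℕ} (B : IsBarrier p h x T) {z : ℂ} (hz0 : z.im ≠ 0)
    {t : ℕ} (ht : t < T) (hz : z - ctr p h x t ∈ islet p h) :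
    F (π * p / h) z ∈ trap p h x T := by
  have hh : h ≠ 0 := by have := B.two_le; omega
  have h1 := B.far t ht
  have h2 := hz 0
  rw [pow_zero, one_mul, Complex.sub_im, abs_le] at h2
  have hH : H z = (Real.sign (sin (ang p h t)) : ℝ) := by
    rcases lt_or_gt_of_ne (sin_ang_ne_zero (p := p) hh t) with hs | hs
    · rw [Real.sign_of_neg hs] at h1 ⊢
      rw [H_of_neg (lt_of_le_of_ne (by linarith) hz0)]
      simp
    · rw [Real.sign_of_pos hs] at h1 ⊢
      rw [H_of_pos (lt_of_le_of_ne (by linarith) hz0.symm)]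
      simp
  have h3 : F (π * p / h) z - ctr p h x (t + 1) ∈ islet p h := by
    rw [ctr_succ hh, F_def, hH]
    have e : mult (π * p / h) * (z - (Real.sign (sin (ang p h t)) : ℝ)) -
        mult (π * p / h) * (ctr p h x t - (Real.sign (sin (ang p h t)) : ℝ)) =
        mult (π * p / h) * (z - ctr p h x t) := by ring
    rw [e]
    exact mult_mul_mem_islet hz
  rcases Nat.lt_or_ge (t + 1) T with h4 | h4
  · exact Or.inr ⟨t + 1, h4, Or.inl h3⟩
  · have e : t + 1 = T := by omega
    rw [e] at h3
    refine Or.inr ⟨0, by omega, ?_⟩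
    rcases ctr_of_full_turn B.two_le x B.dvd B.sum with h5 | h5
    · rw [h5] at h3; exact Or.inl h3
    · rw [h5] at h3
      refine Or.inr ?_
      have := neg_mem_islet h3
      rwa [show -(F (π * p / h) z - -ctr p h x 0) = -F (π * p / h) z - ctr p h x 0 by ring] at this

lemma abs_re_pow_mul_conj_le (hh : 2 ≤ h) (hp : p.Coprime h) (t : ℕ) :
    |(mult (π * p / h) ^ t * (starRingEnd ℂ) (unitDir p h 0)).re| ≤ cos (π / (2 * h)) := by
  obtain ⟨n, hn0, hnh, hn⟩ := exists_dvd_succ hh hp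
  obtain ⟨w, hw⟩ := unitDir_of_dvd_succ (p := p) (by omega) hn
  have h1 : (starRingEnd ℂ) (unitDir p h 0) =
      cos (π / (2 * h)) - sin (π / (2 * h)) * Complex.I := by
    rw [unitDir_zero, map_add, map_mul, Complex.conj_ofReal, Complex.conj_ofReal, Complex.conj_I]
    ring
  have h2 : unitDir p h (t + n) =
      (-1) ^ w * (mult (π * p / h) ^ t * (starRingEnd ℂ) (unitDir p h 0)) := by
    rw [h1, unitDir_eq_pow (by omega), pow_add, mul_assoc, ← unitDir_eq_pow (by omega), hw]
    ring
  have h3 := abs_cos_ang_le hh hp (t + n)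
  rw [← unitDir_re, h2] at h3
  rcases neg_one_pow_eq_or ℂ w with h4 | h4
  · rwa [h4, one_mul] at h3
  · rwa [h4, neg_one_mul, Complex.neg_re, abs_neg] at h3

/-- The triangle spanned by the centre and a side of the regular polygon lies in the polygon. -/
lemma triangle_subset_islet (hh : 2 ≤ h) (hp : p.Coprime h) {A B : ℝ} (hA : 0 ≤ A) (hB : 0 ≤ B)
    (hAB : A + B ≤ 1 / 2) :
    ((A - B : ℝ) : ℂ) - ((A + B) * (cos (π / (2 * h)) / sin (π / (2 * h))) : ℝ) * Complex.I
      ∈ islet p h := by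
  intro t
  have hs := sin_half_angle_pos hh
  have hc := cos_half_angle_pos hh
  have h1 := abs_cos_ang_le hh hp t
  have h2 := abs_re_pow_mul_conj_le hh hp t
  have h0 : mult (π * p / h) ^ t * (((A - B : ℝ) : ℂ) -
      ((A + B) * (cos (π / (2 * h)) / sin (π / (2 * h))) : ℝ) * Complex.I) =
      -((A / sin (π / (2 * h)) : ℝ) * (mult (π * p / h) ^ t * unitDir p h 0) * Complex.I) -
      (B / sin (π / (2 * h)) : ℝ) *
        (mult (π * p / h) ^ t * (starRingEnd ℂ) (unitDir p h 0)) * Complex.I := by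
    rw [unitDir_zero, map_add, map_mul, Complex.conj_ofReal, Complex.conj_ofReal, Complex.conj_I]
    set c := cos (π / (2 * h))
    set s := sin (π / (2 * h))
    have hs' : (s : ℂ) ≠ 0 := by exact_mod_cast hs.ne'
    push_cast
    field_simp
    linear_combination (mult (π * p / h) ^ t * s * (A - B)) * Complex.I_sq
  rw [h0, ← unitDir_eq_pow (by omega)]
  rw [← unitDir_re] at h1
  set U := unitDir p h t
  set W := mult (π * p / h) ^ t * (starRingEnd ℂ) (unitDir p h 0)
  set c := cos (π / (2 * h))
  set s := sin (π / (2 * h))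
  have h3 : (-((A / s : ℝ) * U * Complex.I) - (B / s : ℝ) * W * Complex.I).im =
      -(A / s * U.re + B / s * W.re) := by
    simp [-Complex.ofReal_div]; ring
  rw [h3, abs_neg]
  calc |A / s * U.re + B / s * W.re| ≤ |A / s * U.re| + |B / s * W.re| := abs_add_le _ _
    _ ≤ A / s * c + B / s * c := by
      rw [abs_mul, abs_mul, abs_of_nonneg (by positivity : 0 ≤ A / s),
        abs_of_nonneg (by positivity : 0 ≤ B / s)]
      gcongr
    _ = (A + B) * (c / s) := by field_simp
    _ ≤ 1 / 2 * (c / s) := by gcongr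
    _ = c / (2 * s) := by field_simp

/-- A point that could leave `inside` in the extreme direction is squeezed between the real axis and
two lines bounding a triangle. That triangle is spanned by the centre and the bottom side of a
necklace polygon, so the point is already in the necklace. For all other points the inequalities of
`inside` pass on from index `t` to index `t + 1`. -/
lemma F_mem_trap_of_inside {x : ℝ} {T : ℕ} (B : IsBarrier p h x T) {z : ℂ} (hz0 : 0 < z.im)
    (hz : z ∈ inside p h x) : F (π * p / h) z ∈ trap p h x T := by
  have hh := B.two_le
  have hp := B.coprime
  have hs := sin_half_angle_pos hh
  have hc := cos_half_angle_pos hh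
  obtain ⟨n, hn0, hnh, hn⟩ := exists_dvd_succ hh hp
  have hn1 : -(z.re * cos (π / (2 * h))) + z.im * sin (π / (2 * h)) <
      cos (π / (2 * h)) * (x - 1 / 2) := by
    have h1 := hz n
    obtain ⟨w, hw⟩ := unitDir_of_dvd_succ (p := p) (by omega) hn
    rw [cosSum_of_dvd_succ_lt (by omega) hn, hw, map_mul, map_pow, map_neg, map_one] at h1
    have h2 : |(z * (starRingEnd ℂ)
        (cos (π / (2 * h)) - sin (π / (2 * h)) * Complex.I)).re| <
        cos (π / (2 * h)) * (x + 1 / 2) - cos (π / (2 * h)) := by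
      rcases neg_one_pow_eq_or ℂ w with h4 | h4
      · rwa [h4, one_mul] at h1
      · rwa [h4, neg_one_mul, mul_neg, Complex.neg_re, abs_neg] at h1
    rw [map_sub, map_mul, Complex.conj_ofReal, Complex.conj_ofReal, Complex.conj_I,
      Complex.mul_re] at h2
    have h3 := (abs_lt.1 h2).1
    simp [-Complex.ofReal_cos, -Complex.ofReal_sin] at h3
    linarith
  have h0 := hz 0
  rw [mul_conj_unitDir_re, cosSum_of_dvd hh hp (dvd_zero h),
    show ang p h 0 = π / (2 * h) by simp [ang]] at h0
  have h0' := (abs_lt.1 h0).1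
  by_cases hT : cos (π / (2 * h)) * (x + 1 / 2) - 2 * cos (π / (2 * h)) ≤
      -(z.re * cos (π / (2 * h)) + z.im * sin (π / (2 * h)))
  · -- the orbit enters the necklace
    have hTh : h ∣ p * (T - h) + 1 := by
      have h1 := (Nat.dvd_sub B.dvd (Dvd.intro_left p rfl : h ∣ p * h))
      have h2 : p * T + 1 - p * h = p * (T - h) + 1 := by
        have : p * h ≤ p * T := Nat.mul_le_mul_left _ B.le
        rw [Nat.mul_sub]; omega
      rwa [h2] at h1
    have hsum : sinSum p h (T - h) = 2 * x * sin (π / (2 * h)) - 1 / sin (π / (2 * h)) := by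
      have := sinSum_add_period hh hp (T - h)
      rw [Nat.sub_add_cancel B.le, B.sum] at this
      linarith
    obtain ⟨w, hw⟩ := ctr_of_last_turn hh x hTh hsum
    have hmem : z + ((x - 1 : ℝ) -
        (cos (π / (2 * h)) / (2 * sin (π / (2 * h))) : ℝ) * Complex.I) ∈ islet p h := by
      set c := cos (π / (2 * h))
      set s := sin (π / (2 * h))
      -- barycentric coordinates in the triangle
      have key := triangle_subset_islet (p := p) hh hp
        (A := (1 / 2 - z.im * s / c + (x - 1 + z.re)) / 2)
        (B := (1 / 2 - z.im * s / c - (x - 1 + z.re)) / 2) ?_ ?_ ?_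
      · convert key using 1
        apply Complex.ext
        · simp [-Complex.ofReal_div]; ring
        · simp [-Complex.ofReal_div]
          change z.im + -(c / (2 * s)) = -(_ * (c / s))
          field_simp
          ring
      · have h1 : z.im * s / c < 1 / 2 + (x - 1 + z.re) := by
          rw [div_lt_iff₀ hc]; linarith
        linarith
      · have h1 : z.im * s / c ≤ 1 / 2 - (x - 1 + z.re) := by
          rw [div_le_iff₀ hc]; linarith
        linarith
      · have : 0 ≤ z.im * s / c := by positivity
        linarith
    have hlt : T - h < T := by have := B.le; omega
    rcases neg_one_pow_eq_or ℂ w with h4 | h4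
    · rw [h4, one_mul] at hw
      have h5 := neg_mem_islet hmem
      rw [← hw] at h5
      have h6 := F_mem_trap_of_islet B (z := -z) (by simpa using hz0.ne') hlt
        (by rwa [show -z - ctr p h x (T - h) = -(z + ctr p h x (T - h)) by ring])
      rw [F_neg hz0.ne'] at h6
      simpa using neg_mem_trap h6
    · rw [h4, neg_one_mul] at hw
      refine F_mem_trap_of_islet B hz0.ne' hlt ?_
      rw [hw, sub_neg_eq_add]
      exact hmem
  · left
    have step : ∀ t, |(F (π * p / h) z * (starRingEnd ℂ) (unitDir p h (t + 1))).re| <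
        cos (π / (2 * h)) * (x + 1 / 2) - cosSum p h (t + 1) := by
      intro t
      have e1 : F (π * p / h) z * (starRingEnd ℂ) (unitDir p h (t + 1)) =
          (z - 1) * (starRingEnd ℂ) (unitDir p h t) := by
        rw [F_def, H_of_pos hz0, unitDir_succ (by omega), map_mul]
        have : mult (π * p / h) * (starRingEnd ℂ) (mult (π * p / h)) = 1 := by
          rw [Complex.mul_conj, Complex.normSq_eq_norm_sq, norm_mult]; simp
        linear_combination ((z - 1) * (starRingEnd ℂ) (unitDir p h t)) * this
      have h1 := hz t
      rw [mul_conj_unitDir_re] at h1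
      rw [e1, mul_conj_unitDir_re, cosSum_succ, Complex.sub_re, Complex.sub_im, Complex.one_re,
        Complex.one_im, sub_zero]
      have hsc : signedCos (ang p h t) = Real.sign (sin (ang p h t)) * cos (ang p h t) := rfl
      -- The signed coordinate and the bound both drop by `signedCos`, so one of the two
      -- inequalities is automatic. The other can fail only if `signedCos` is positive.
      have hgoal : signedCos (ang p h t) ≤ 0 ∨
          -(Real.sign (sin (ang p h t)) *
            (z.re * cos (ang p h t) + z.im * sin (ang p h t))) <
          cos (π / (2 * h)) * (x + 1 / 2) - cosSum p h t - 2 * signedCos (ang p h t) := by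
        rcases le_or_gt (signedCos (ang p h t)) 0 with hg | hg
        · exact Or.inl hg
        right
        by_cases ht : h ∣ t
        · rw [signedCos_of_dvd hh ht, cosSum_of_dvd hh hp ht]
          have h2 := not_le.1 hT
          have h3 := signedCos_of_dvd (p := p) hh ht
          have h4 := abs_sin_of_dvd (p := p) hh ht
          rw [hsc] at h3
          rcases lt_or_gt_of_ne (sin_ang_ne_zero (p := p) (show h ≠ 0 by omega) t) with hs' | hs'
          · rw [Real.sign_of_neg hs'] at h3 ⊢
            rw [abs_of_neg hs'] at h4
            rw [show cos (ang p h t) = -cos (π / (2 * h)) by linarith,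
              show sin (ang p h t) = -sin (π / (2 * h)) by linarith]
            linarith
          · rw [Real.sign_of_pos hs'] at h3 ⊢
            rw [abs_of_pos hs'] at h4
            rw [show cos (ang p h t) = cos (π / (2 * h)) by linarith, h4]
            linarith
        · have h2 := B.large t ht hg
          have h3 : -z.re < x - 1 / 2 := by
            have : 0 < z.im * sin (π / (2 * h)) := mul_pos hz0 hs
            have h4 : -z.re * cos (π / (2 * h)) < (x - 1 / 2) * cos (π / (2 * h)) := by linarith
            exact lt_of_mul_lt_mul_right h4 hc.le
          have h5 : 0 ≤ Real.sign (sin (ang p h t)) * sin (ang p h t) := by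
            rcases lt_trichotomy (sin (ang p h t)) 0 with hs' | hs' | hs'
            · rw [Real.sign_of_neg hs']; linarith
            · simp [hs']
            · rw [Real.sign_of_pos hs']; linarith
          have h6 := mul_lt_mul_of_pos_left h3 hg
          have h7 := mul_nonneg hz0.le h5
          rw [hsc] at h6 h2 ⊢
          rw [hsc] at hg
          linarith
      rw [abs_lt] at h1 ⊢
      rw [hsc] at hgoal ⊢
      rcases lt_or_gt_of_ne (sin_ang_ne_zero (p := p) (show h ≠ 0 by omega) t) with hs' | hs'
      · rw [Real.sign_of_neg hs'] at hgoal ⊢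
        rcases hgoal with hgoal | hgoal <;> constructor <;> linarith
      · rw [Real.sign_of_pos hs'] at hgoal ⊢
        rcases hgoal with hgoal | hgoal <;> constructor <;> linarith
    intro t
    -- `step` never produces index 0; it is read off at index `h`, where `unitDir` has changed by a
    -- sign and `cosSum` is again 0.
    rcases t with _ | t
    · have h1 := step (h - 1)
      rw [Nat.sub_add_cancel (by omega)] at h1
      have h2 := unitDir_add_period (p := p) (show h ≠ 0 by omega) 0
      rw [zero_add] at h2
      rw [h2, map_mul, map_pow, map_neg, map_one, cosSum_period hh hp] at h1
      rw [cosSum_of_dvd hh hp (dvd_zero h)]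
      rcases neg_one_pow_eq_or ℂ p with h4 | h4
      · rwa [h4, one_mul] at h1
      · rwa [h4, neg_one_mul, mul_neg, Complex.neg_re, abs_neg] at h1
    · exact step t

lemma F_mem_trap {x : ℝ} {T : ℕ} (B : IsBarrier p h x T) {z : ℂ} (hz0 : z.im ≠ 0)
    (hz : z ∈ trap p h x T) : F (π * p / h) z ∈ trap p h x T := by
  have hneg : ∀ w : ℂ, w.im ≠ 0 → F (π * p / h) (-w) ∈ trap p h x T →
      F (π * p / h) w ∈ trap p h x T := fun w hw h1 => by
    rw [F_neg hw] at h1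
    simpa using neg_mem_trap h1
  rcases hz with hz | ⟨t, ht, hz | hz⟩
  · rcases lt_or_gt_of_ne hz0 with h1 | h1
    · exact hneg z hz0 (F_mem_trap_of_inside B (by simpa using h1) (neg_mem_inside hz))
    · exact F_mem_trap_of_inside B h1 hz
  · exact F_mem_trap_of_islet B hz0 ht hz
  · exact hneg z hz0 (F_mem_trap_of_islet B (by simpa using hz0) ht hz)

lemma isBounded_of_two_directions {a b : ℝ} (ha : a ≠ 0) (hb : b ≠ 0) {S : Set ℂ} {M : ℝ}
    (h1 : ∀ z ∈ S, |z.re * a + z.im * b| ≤ M) (h2 : ∀ z ∈ S, |z.re * a - z.im * b| ≤ M) :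
    Bornology.IsBounded S := by
  rw [isBounded_iff_forall_norm_le]
  refine ⟨M / |a| + M / |b|, fun z hz => (Complex.norm_le_abs_re_add_abs_im z).trans ?_⟩
  have h3 := abs_le.1 (h1 z hz)
  have h4 := abs_le.1 (h2 z hz)
  gcongr
  · rw [le_div_iff₀ (abs_pos.2 ha), ← abs_mul, abs_le]
    constructor <;> linarith [h3.1, h3.2, h4.1, h4.2]
  · rw [le_div_iff₀ (abs_pos.2 hb), ← abs_mul, abs_le]
    constructor <;> linarith [h3.1, h3.2, h4.1, h4.2]

lemma isBounded_inside (hh : 2 ≤ h) (hp : p.Coprime h) (x : ℝ) :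
    Bornology.IsBounded (inside p h x) := by
  obtain ⟨n, hn0, hnh, hn⟩ := exists_dvd_succ hh hp
  have hs := sin_half_angle_pos hh
  have hc := cos_half_angle_pos hh
  refine isBounded_of_two_directions hc.ne' hs.ne' (M := cos (π / (2 * h)) * (x + 1 / 2))
    (fun z hz => ?_) fun z hz => ?_
  · have h0 := hz 0
    rw [mul_conj_unitDir_re, cosSum_of_dvd hh hp (dvd_zero h), sub_zero,
      show ang p h 0 = π / (2 * h) by simp [ang]] at h0
    exact h0.le
  · have h0 := hz n
    obtain ⟨w, hw⟩ := ang_of_dvd_succ (p := p) (by omega) hn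
    rw [mul_conj_unitDir_re, cosSum_of_dvd_succ_lt (by omega) hn, hw, cos_add_nat_mul_pi,
      sin_add_nat_mul_pi, cos_neg, sin_neg] at h0
    have e : z.re * ((-1) ^ w * cos (π / (2 * h))) + z.im * ((-1) ^ w * -sin (π / (2 * h))) =
        (-1) ^ w * (z.re * cos (π / (2 * h)) - z.im * sin (π / (2 * h))) := by ring
    rw [e, abs_mul, abs_pow, abs_neg, abs_one, one_pow, one_mul] at h0
    linarith

lemma isBounded_islet (hh : 2 ≤ h) (hp : p.Coprime h) : Bornology.IsBounded (islet p h) := by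
  obtain ⟨n, hn0, hnh, hn⟩ := exists_dvd_succ hh hp
  have hs := sin_half_angle_pos hh
  have hc := cos_half_angle_pos hh
  obtain ⟨w, hw⟩ := unitDir_of_dvd_succ (p := p) (by omega) hn
  -- `λ ^ n` is `± exp (-π i / h)`, giving a second strip not parallel to the horizontal one.
  have hpow : mult (π * p / h) ^ n = (-1) ^ w *
      (((cos (π / (2 * h)) ^ 2 - sin (π / (2 * h)) ^ 2 : ℝ) : ℂ) -
        (2 * sin (π / (2 * h)) * cos (π / (2 * h)) : ℝ) * Complex.I) := by
    rw [mult_pow_eq (by omega), hw, unitDir_zero, map_add, map_mul, Complex.conj_ofReal,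
      Complex.conj_ofReal, Complex.conj_I]
    push_cast
    linear_combination ((-1) ^ w * Complex.sin (π / (2 * h)) ^ 2) * Complex.I_sq
  rw [isBounded_iff_forall_norm_le]
  set c := cos (π / (2 * h))
  set s := sin (π / (2 * h))
  set M := c / (2 * s)
  refine ⟨(2 * M) / (2 * s * c) + M, fun z hz =>
    (Complex.norm_le_abs_re_add_abs_im z).trans ?_⟩
  have h0 := hz 0
  have h1 := hz n
  rw [pow_zero, one_mul] at h0
  rw [hpow, mul_assoc] at h1
  have h2 : |((((c ^ 2 - s ^ 2 : ℝ) : ℂ) - (2 * s * c : ℝ) * Complex.I) * z).im| ≤ M := by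
    rcases neg_one_pow_eq_or ℂ w with h4 | h4
    · rwa [h4, one_mul] at h1
    · rwa [h4, neg_one_mul, Complex.neg_im, abs_neg] at h1
  have h3 : ((((c ^ 2 - s ^ 2 : ℝ) : ℂ) - (2 * s * c : ℝ) * Complex.I) * z).im =
      (c ^ 2 - s ^ 2) * z.im - 2 * s * c * z.re := by
    rw [Complex.mul_im, Complex.sub_re, Complex.sub_im, Complex.re_ofReal_mul,
      Complex.im_ofReal_mul]
    simp only [Complex.ofReal_re, Complex.ofReal_im, Complex.I_re, Complex.I_im]
    ring
  rw [h3] at h2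
  have hcs : c ^ 2 + s ^ 2 = 1 := cos_sq_add_sin_sq _
  have h5 : |(c ^ 2 - s ^ 2) * z.im| ≤ M := by
    rw [abs_mul]
    have : |c ^ 2 - s ^ 2| ≤ 1 := by
      rw [abs_le]; constructor <;> nlinarith [sq_nonneg c, sq_nonneg s]
    exact (mul_le_of_le_one_left (abs_nonneg _) this).trans h0
  gcongr
  rw [le_div_iff₀ (by positivity), ← abs_of_pos (by positivity : 0 < 2 * s * c), ← abs_mul, abs_le]
  rw [abs_le] at h2 h5
  constructor <;> linarith [h2.1, h2.2, h5.1, h5.2]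

lemma isBounded_trap (hh : 2 ≤ h) (hp : p.Coprime h) (x : ℝ) (T : ℕ) :
    Bornology.IsBounded (trap p h x T) := by
  have h1 : trap p h x T ⊆ inside p h x ∪ ⋃ t ∈ Finset.range T,
      ((fun u => u + ctr p h x t) '' islet p h ∪ (fun u => -u - ctr p h x t) '' islet p h) := by
    rintro z (hz | ⟨t, ht, hz | hz⟩)
    · exact Or.inl hz
    · refine Or.inr (Set.mem_biUnion (Finset.mem_range.2 ht) (Or.inl ⟨_, hz, by simp⟩))
    · refine Or.inr (Set.mem_biUnion (Finset.mem_range.2 ht) (Or.inr ⟨_, hz, by simp⟩))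
  obtain ⟨M, hM⟩ := isBounded_iff_forall_norm_le.1 (isBounded_islet (p := p) hh hp)
  refine (((isBounded_inside hh hp x).union ?_)).subset h1
  rw [Bornology.isBounded_biUnion_finset]
  intro t _
  refine Bornology.IsBounded.union ?_ ?_ <;>
  · rw [isBounded_iff_forall_norm_le]
    refine ⟨M + ‖ctr p h x t‖, ?_⟩
    rintro _ ⟨u, hu, rfl⟩
    have := hM u hu
    first
      | exact (norm_add_le _ _).trans (by linarith)
      | exact (norm_sub_le _ _).trans (by rw [norm_neg]; linarith)

/-- For rational rotation angles every orbit that avoids the real line is bounded. -/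
theorem isBounded_orbit (hh : 2 ≤ h) (hp : p.Coprime h) {z : ℂ}
    (hz : ∀ i : ℕ, ((F (π * p / h))^[i] z).im ≠ 0) :
    Bornology.IsBounded (Set.range fun i : ℕ => (F (π * p / h))^[i] z) := by
  obtain ⟨x, T, B, hx⟩ := exists_barrier hh hp ‖z‖
  refine (isBounded_trap hh hp x T).subset ?_
  rintro _ ⟨i, rfl⟩
  induction i with
  | zero =>
    refine Or.inl fun t => ?_
    have h1 := abs_cosSum_le hh hp t
    have h2 := (Complex.abs_re_le_norm (z * (starRingEnd ℂ) (unitDir p h t)))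
    have h3 : ‖unitDir p h t‖ = 1 := Complex.norm_exp_ofReal_mul_I _
    rw [norm_mul, RCLike.norm_conj, h3, mul_one] at h2
    exact (h2.trans_lt hx).trans_le (by linarith [(abs_le.1 h1).2])
  | succ i ih =>
    simp only [Function.iterate_succ_apply']
    exact F_mem_trap B (hz i) ih

end PiecewiseRotation

end

/-! ### Recurrence: tiles are periodic and bounded -/

noncomputable section

namespace PiecewiseRotation

open Real

lemma mul_pos_of_mul_pos_left {a b c : ℝ} (h1 : 0 < a * b) (h2 : 0 < a * c) : 0 < b * c := by
  rcases mul_pos_iff.1 h1 with h | h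
  · exact mul_pos h.2 (pos_of_mul_pos_right h2 h.1.le)
  · exact mul_pos_of_neg_of_neg h.2 (by nlinarith)

lemma mult_mul_conj (α : ℝ) : mult α * (starRingEnd ℂ) (mult α) = 1 := by
  rw [Complex.mul_conj, Complex.normSq_eq_norm_sq, norm_mult]; simp

lemma conj_mult_pow_mul_iterate (α : ℝ) (z : ℂ) (n : ℕ) :
    (starRingEnd ℂ) (mult α) ^ n * (F α)^[n] z =
      z - ∑ i ∈ Finset.range n, (starRingEnd ℂ) (mult α) ^ i * H ((F α)^[i] z) := by
  induction n with
  | zero => simp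
  | succ n ih =>
    rw [Function.iterate_succ_apply', Finset.sum_range_succ, F_def, pow_succ]
    linear_combination ih + ((starRingEnd ℂ) (mult α) ^ n * ((F α)^[n] z - H ((F α)^[n] z))) *
      mult_mul_conj α

lemma conj_H (z : ℂ) : (starRingEnd ℂ) (H z) = H z := by
  unfold H; split_ifs <;> simp

/-- A point of a tile whose orbit returns to the cell of that point. -/
lemma exists_return {α : ℝ} {z : ℂ} (hz : z ∈ interior (Cell α z))
    (hb : Bornology.IsBounded (Set.range fun i : ℕ => (F α)^[i] z)) :
    ∃ d, 0 < d ∧ (F α)^[d] z ∈ Cell α z := by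
  obtain ⟨r, hr, hball⟩ := Metric.mem_nhds_iff.1 (mem_interior_iff_mem_nhds.1 hz)
  obtain ⟨a, _, φ, hφ, hlim⟩ := tendsto_subseq_of_bounded hb (fun n => Set.mem_range_self n)
  obtain ⟨N, hN⟩ := Metric.cauchySeq_iff'.1 hlim.cauchySeq r hr
  have h1 := hN (N + 1) (by omega)
  have hlt : φ N < φ (N + 1) := hφ (by omega)
  simp only [Function.comp] at h1
  set a := φ N
  set b := φ (N + 1)
  refine ⟨b - a, by omega, ?_⟩
  -- The small displacement between two close iterates is pulled back to `z`. As `y` is still in the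
  -- cell, `F^a y = F^b z`, and injectivity gives `y = F^(b-a) z`.
  set y := z + (mult α ^ a)⁻¹ * ((F α)^[b] z - (F α)^[a] z) with hy
  have hyb : y ∈ Cell α z := by
    apply hball
    rw [Metric.mem_ball, dist_eq_norm, hy, add_sub_cancel_left, norm_mul, norm_inv, norm_pow,
      norm_mult, one_pow, inv_one, one_mul, ← dist_eq_norm]
    exact h1
  have h2 := iterate_of_mem_Cell hyb a
  rw [hy, add_sub_cancel_left, mul_inv_cancel_left₀ (pow_ne_zero _ (mult_ne_zero α)),
    add_sub_cancel, ← hy] at h2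
  have h3 : (F α)^[a] y = (F α)^[a] ((F α)^[b - a] z) := by
    rw [h2, ← Function.iterate_add_apply]; congr 2; omega
  rw [← (F_injective α).iterate a h3]
  exact hyb

lemma iterate_mem_Cell {α : ℝ} {z : ℂ} {d : ℕ} (hd : (F α)^[d] z ∈ Cell α z) {w : ℂ}
    (hw : w ∈ Cell α z) : (F α)^[d] w ∈ Cell α z := by
  intro i
  have h1 := hd i
  have h2 := hw (i + d)
  rw [← Function.iterate_add_apply] at h1 ⊢
  rw [mul_comm] at h1
  exact mul_pos_of_mul_pos_left h1 h2

lemma iterate_mem_interior_Cell {α : ℝ} {z : ℂ} {d : ℕ} (hd : (F α)^[d] z ∈ Cell α z) {w : ℂ}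
    (hw : w ∈ interior (Cell α z)) : (F α)^[d] w ∈ interior (Cell α z) := by
  obtain ⟨r, hr, hball⟩ := Metric.mem_nhds_iff.1 (mem_interior_iff_mem_nhds.1 hw)
  rw [mem_interior_iff_mem_nhds, Metric.mem_nhds_iff]
  refine ⟨r, hr, fun v hv => ?_⟩
  set y := w + (mult α ^ d)⁻¹ * (v - (F α)^[d] w) with hy
  have hyb : y ∈ Cell α z := by
    apply hball
    rw [Metric.mem_ball, dist_eq_norm, hy, add_sub_cancel_left, norm_mul, norm_inv, norm_pow,
      norm_mult, one_pow, inv_one, one_mul, ← dist_eq_norm]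
    exact hv
  have hwC := hball (Metric.mem_ball_self hr)
  have h2 := iterate_of_mem_Cell hyb d
  have h3 := iterate_of_mem_Cell hwC d
  have h4 : (F α)^[d] y = v := by
    have : mult α ^ d * (mult α ^ d)⁻¹ = 1 := mul_inv_cancel₀ (pow_ne_zero _ (mult_ne_zero α))
    rw [h2, hy]
    linear_combination (v - (F α)^[d] w) * this - h3
  rw [← h4]
  exact iterate_mem_Cell hd hyb

/-- The data of a periodic tile. -/
lemma exists_period {α : ℝ} {k : ℕ} (hα : mult α ^ k = 1) {z : ℂ}
    (hz : z ∈ interior (Cell α z))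
    (hb : Bornology.IsBounded (Set.range fun i : ℕ => (F α)^[i] z)) :
    ∃ d, 0 < d ∧ (F α)^[d] z ∈ Cell α z ∧ ∀ w ∈ Cell α z, (F α)^[d * k] w = w := by
  obtain ⟨d, hd, hdC⟩ := exists_return hz hb
  refine ⟨d, hd, hdC, ?_⟩
  have hzC : z ∈ Cell α z := interior_subset hz
  set τ := (F α)^[d * k] z - z with hτ
  have htrans : ∀ w ∈ Cell α z, (F α)^[d * k] w = w + τ := by
    intro w hw
    rw [iterate_of_mem_Cell hw, mul_comm d k, pow_mul, hα, one_pow, mul_comm k d, hτ]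
    ring
  have hmem : ∀ n : ℕ, (F α)^[n * (d * k)] z = z + n * τ ∧ (F α)^[n * (d * k)] z ∈ Cell α z := by
    have hNC : ∀ n : ℕ, (F α)^[d * n] z ∈ Cell α z := by
      intro n
      induction n with
      | zero => simpa using hzC
      | succ n ih =>
        rw [Nat.mul_succ, add_comm, Function.iterate_add_apply]
        exact iterate_mem_Cell hdC ih
    intro n
    induction n with
    | zero => simpa using hzC
    | succ n ih =>
      have e : (n + 1) * (d * k) = d * k + n * (d * k) := by ring
      rw [e, Function.iterate_add_apply]
      refine ⟨?_, iterate_mem_Cell (hNC k) ih.2⟩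
      rw [htrans _ ih.2, ih.1]; push_cast; ring
  have hτ0 : τ = 0 := by
    by_contra hne
    obtain ⟨M, hM⟩ := isBounded_iff_forall_norm_le.1 hb
    obtain ⟨n, hn⟩ := exists_nat_gt ((M + ‖z‖) / ‖τ‖)
    rw [div_lt_iff₀ (norm_pos_iff.2 hne)] at hn
    have h1 := hM _ ⟨n * (d * k), rfl⟩
    simp only at h1
    rw [(hmem n).1] at h1
    have h2 : ‖(n : ℂ) * τ‖ ≤ ‖z + n * τ‖ + ‖z‖ := by
      have := norm_sub_le (z + n * τ) z
      rwa [add_sub_cancel_left] at this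
    rw [norm_mul, Complex.norm_natCast] at h2
    linarith
  intro w hw
  rw [htrans w hw, hτ0, add_zero]

/-- Surjectivity: on the cell, `F^(d(k-1))` inverts `F^d`. -/
lemma image_interior_Cell {α : ℝ} {k : ℕ} (hk : 0 < k) {z : ℂ} {d : ℕ}
    (hdC : (F α)^[d] z ∈ Cell α z) (hid : ∀ w ∈ Cell α z, (F α)^[d * k] w = w) :
    (F α)^[d] '' interior (Cell α z) = interior (Cell α z) := by
  apply Set.Subset.antisymm
  · rintro _ ⟨w, hw, rfl⟩
    exact iterate_mem_interior_Cell hdC hw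
  · intro w hw
    have hn : ∀ n : ℕ, (F α)^[d * n] w ∈ interior (Cell α z) := by
      intro n
      induction n with
      | zero => simpa using hw
      | succ n ih =>
        rw [Nat.mul_succ, add_comm, Function.iterate_add_apply]
        exact iterate_mem_interior_Cell hdC ih
    refine ⟨(F α)^[d * (k - 1)] w, hn _, ?_⟩
    rw [← Function.iterate_add_apply]
    have e : d + d * (k - 1) = d * k := by
      obtain ⟨k, rfl⟩ : ∃ m, k = m + 1 := ⟨k - 1, by omega⟩
      simp; ring
    rw [e]
    exact hid w (interior_subset hw)

/-- On a cell of periodic points the heights of the points of an orbit have a constant sum. -/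
lemma sum_height_eq {α : ℝ} {z : ℂ} {N : ℕ} (hN : (F α)^[N] z = z) (hα : mult α ^ N = 1) {w : ℂ}
    (hw : w ∈ Cell α z) :
    ∑ i ∈ Finset.range N, (H ((F α)^[i] z) * (((F α)^[i] w).im : ℂ)) =
      ∑ i ∈ Finset.range N, (H ((F α)^[i] z) * (((F α)^[i] z).im : ℂ)) := by
  have h1 := conj_mult_pow_mul_iterate α z N
  rw [← map_pow, hα, map_one, one_mul, hN] at h1
  -- Closing up of the orbit of `z` says exactly that this sum vanishes, and it is the coefficient
  -- of `w - z` in the sum of heights.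
  have h2 : ∑ i ∈ Finset.range N, mult α ^ i * H ((F α)^[i] z) = 0 := by
    have h3 : ∑ i ∈ Finset.range N, (starRingEnd ℂ) (mult α) ^ i * H ((F α)^[i] z) = 0 := by
      linear_combination h1
    have h4 := congrArg (starRingEnd ℂ) h3
    simpa [map_sum, conj_H] using h4
  have h3 : ∀ i, (H ((F α)^[i] z) * (((F α)^[i] w).im : ℂ)) =
      H ((F α)^[i] z) * (((F α)^[i] z).im : ℂ) +
        ((H ((F α)^[i] z) * (mult α ^ i * (w - z))).im : ℂ) := by
    intro i
    rw [iterate_of_mem_Cell hw i, Complex.add_im]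
    have : (H ((F α)^[i] z) * (mult α ^ i * (w - z))).im =
        (H ((F α)^[i] z)).re * (mult α ^ i * (w - z)).im := by
      rw [Complex.mul_im, im_H]; ring
    rw [this]
    have h5 : (((H ((F α)^[i] z)).re : ℝ) : ℂ) = H ((F α)^[i] z) :=
      Complex.ext (by simp) (by simp [im_H])
    push_cast
    rw [h5]; ring
  simp_rw [h3]
  rw [Finset.sum_add_distrib, add_eq_left, ← Complex.ofReal_sum, ← Complex.im_sum]
  have : ∑ i ∈ Finset.range N, H ((F α)^[i] z) * (mult α ^ i * (w - z)) =
      (∑ i ∈ Finset.range N, mult α ^ i * H ((F α)^[i] z)) * (w - z) := by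
    rw [Finset.sum_mul]; exact Finset.sum_congr rfl fun i _ => by ring
  rw [this, h2]; simp

lemma H_mul_im_eq_abs {z w : ℂ} (h : 0 < z.im * w.im) : H z * (w.im : ℂ) = (|w.im| : ℝ) := by
  rcases mul_pos_iff.1 h with h | h
  · rw [H_of_pos h.1, abs_of_pos h.2, one_mul]
  · rw [H_of_neg h.1, abs_of_neg h.2]; push_cast; ring

/-- On the cell the heights are absolute values with constant sum, so each is bounded. Those at
times 0 and 1 control two independent directions because `λ` is not real. -/
lemma isBounded_Cell {α : ℝ} (him : (mult α).im ≠ 0) {z : ℂ} {N : ℕ} (hN2 : 2 ≤ N)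
    (hN : (F α)^[N] z = z) (hα : mult α ^ N = 1) (hz : z ∈ Cell α z) :
    Bornology.IsBounded (Cell α z) := by
  set A := ∑ i ∈ Finset.range N, |((F α)^[i] z).im| with hA
  have h1 : ∀ w ∈ Cell α z, ∑ i ∈ Finset.range N, |((F α)^[i] w).im| = A := by
    intro w hw
    have h2 := sum_height_eq hN hα hw
    rw [Finset.sum_congr rfl fun i _ => H_mul_im_eq_abs (hw i),
      Finset.sum_congr rfl fun i _ => H_mul_im_eq_abs (hz i)] at h2
    exact_mod_cast h2
  have h2 : ∀ w ∈ Cell α z, ∀ i < N, |((F α)^[i] w).im| ≤ A := by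
    intro w hw i hi
    rw [← h1 w hw]
    exact Finset.single_le_sum (f := fun i => |((F α)^[i] w).im|) (fun _ _ => abs_nonneg _)
      (Finset.mem_range.2 hi)
  have h3 : ∀ w ∈ Cell α z, ∀ i < N, |(mult α ^ i * (w - z)).im| ≤ 2 * A := by
    intro w hw i hi
    have e : (mult α ^ i * (w - z)).im = ((F α)^[i] w).im - ((F α)^[i] z).im := by
      rw [iterate_of_mem_Cell hw i]; simp
    rw [e]
    have := abs_sub (((F α)^[i] w).im) (((F α)^[i] z).im)
    linarith [h2 w hw i hi, h2 z hz i hi]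
  rw [isBounded_iff_forall_norm_le]
  set a := (mult α).re
  set b := (mult α).im
  have ha : |a| ≤ 1 := (Complex.abs_re_le_norm _).trans (norm_mult α).le
  refine ⟨4 * A / |b| + 2 * A + ‖z‖, fun w hw => ?_⟩
  have h4 := h3 w hw 0 (by omega)
  have h5 := h3 w hw 1 (by omega)
  rw [pow_zero, one_mul] at h4
  rw [pow_one, Complex.mul_im] at h5
  have h6 : |b * (w - z).re| ≤ 4 * A := by
    have h7 : |a * (w - z).im| ≤ 2 * A := by
      rw [abs_mul]; exact (mul_le_of_le_one_left (abs_nonneg _) ha).trans h4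
    rw [abs_le] at h5 h7 ⊢
    constructor <;> linarith [h5.1, h5.2, h7.1, h7.2]
  have h8 : |(w - z).re| ≤ 4 * A / |b| := by
    rw [le_div_iff₀ (abs_pos.2 him), mul_comm, ← abs_mul]; exact h6
  have h9 := Complex.norm_le_abs_re_add_abs_im (w - z)
  have h10 := norm_add_le (w - z) z
  rw [sub_add_cancel] at h10
  linarith

variable {p h : ℕ}

lemma mult_pow_two_mul (hh : h ≠ 0) : mult (π * p / h) ^ (2 * h) = 1 := by
  unfold mult
  rw [← Complex.exp_nat_mul, Complex.exp_eq_one_iff]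
  refine ⟨p, ?_⟩
  have : (h : ℂ) ≠ 0 := by exact_mod_cast hh
  push_cast
  field_simp

lemma mult_im_ne_zero (hh : 2 ≤ h) (hp : p.Coprime h) : (mult (π * p / h)).im ≠ 0 := by
  unfold mult
  rw [Complex.exp_ofReal_mul_I_im]
  intro h0
  obtain ⟨n, hn⟩ := sin_eq_zero_iff.1 h0
  have hπ := pi_ne_zero
  have hh' : (h : ℝ) ≠ 0 := by positivity
  field_simp at hn
  have h1 : n * h = (p : ℤ) := by exact_mod_cast hn
  have h2 : h ∣ p := by
    have : (h : ℤ) ∣ p := ⟨n, by rw [← h1]; ring⟩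
    exact_mod_cast this
  have := Nat.eq_one_of_dvd_coprimes hp h2 (dvd_refl h)
  omega

/-- Every tile is periodic and bounded when the rotation angle is a rational multiple of `π`. -/
theorem tile_periodic (hh : 2 ≤ h) (hp : p.Coprime h) {V : Set ℂ} (hV : IsTile (π * p / h) V) :
    ∃ z ∈ V, V = interior (Cell (π * p / h) z) ∧ Bornology.IsBounded V ∧
      ∃ d, 0 < d ∧ (F (π * p / h))^[d] '' V = V := by
  obtain ⟨z, hz, rfl⟩ := hV
  have hzV : z ∈ connectedComponentIn (regularSet (π * p / h)) z := mem_connectedComponentIn hz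
  have hzne := im_ne_zero_of_mem_regularSet hz
  rw [component_eq hz] at hzV ⊢
  have hpow := mult_pow_two_mul (p := p) (show h ≠ 0 by omega)
  obtain ⟨d, hd, hdC, hid⟩ := exists_period (k := 2 * h) hpow hzV
    (isBounded_orbit hh hp hzne)
  have hzC := interior_subset hzV
  refine ⟨z, hzV, rfl, ?_, d, hd, image_interior_Cell (by omega) hdC hid⟩
  refine (isBounded_Cell (mult_im_ne_zero hh hp) (N := d * (2 * h)) ?_ (hid z hzC) ?_ hzC).subset
    interior_subset
  · nlinarith
  · rw [pow_mul', hpow, one_pow]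

end PiecewiseRotation

end

/-! ### Regions bounded by `2h` lines with equally spaced normals -/

noncomputable section

namespace PiecewiseRotation

open Real

/-- The unit vector `i exp (π i j / h)`. -/
def normalDir (h : ℕ) (j : ℤ) : ℂ := Complex.I * Complex.exp ((π * j / h : ℝ) * Complex.I)

/-- The inner product with the unit vector `normalDir h j`. -/
def lin (h : ℕ) (j : ℤ) (z : ℂ) : ℝ := z.im * cos (π * j / h) - z.re * sin (π * j / h)

/-- The intersection point of the lines `lin h j = H j` and `lin h (j + 1) = H (j + 1)`. -/
def vert (h : ℕ) (H : ℤ → ℝ) (j : ℤ) : ℂ :=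
  ((H j : ℝ) + ((H (j + 1) - cos (π / h) * H j) / sin (π / h) : ℝ) * Complex.I) *
    normalDir h j

/-- The signed length of the side on the line `lin h j = H j` between the vertices
`vert h H (j - 1)` and `vert h H j`. -/
def sideLen (h : ℕ) (H : ℤ → ℝ) (j : ℤ) : ℝ :=
  (H (j + 1) + H (j - 1) - 2 * cos (π / h) * H j) / sin (π / h)

/-- The open region bounded by the lines `lin h j = H j`. -/
def openRegion (h : ℕ) (H : ℤ → ℝ) : Set ℂ := {z | ∀ j, lin h j z < H j}

/-- The closed region bounded by the lines `lin h j = H j`. -/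
def closedRegion (h : ℕ) (H : ℤ → ℝ) : Set ℂ := {z | ∀ j, lin h j z ≤ H j}

variable {h : ℕ} {H : ℤ → ℝ}

lemma sin_pi_div_pos (hh : 2 ≤ h) : 0 < sin (π / h) := by
  have : (2 : ℝ) ≤ h := by exact_mod_cast hh
  apply sin_pos_of_pos_of_lt_pi (by positivity)
  rw [div_lt_iff₀ (by linarith)]
  nlinarith [pi_pos]

lemma lin_add (j : ℤ) (z w : ℂ) : lin h j (z + w) = lin h j z + lin h j w := by
  simp only [lin, Complex.add_re, Complex.add_im]; ring

lemma lin_sub (j : ℤ) (z w : ℂ) : lin h j (z - w) = lin h j z - lin h j w := by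
  simp only [lin, Complex.sub_re, Complex.sub_im]; ring

lemma lin_smul (j : ℤ) (a : ℝ) (z : ℂ) : lin h j (a • z) = a * lin h j z := by
  simp only [lin, Complex.smul_re, Complex.smul_im, smul_eq_mul]; ring

lemma normalDir_re (j : ℤ) : (normalDir h j).re = -sin (π * j / h) := by
  rw [normalDir, Complex.I_mul_re, Complex.exp_ofReal_mul_I_im]

lemma normalDir_im (j : ℤ) : (normalDir h j).im = cos (π * j / h) := by
  rw [normalDir, Complex.I_mul_im, Complex.exp_ofReal_mul_I_re]

lemma norm_normalDir (j : ℤ) : ‖normalDir h j‖ = 1 := by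
  rw [normalDir, norm_mul, Complex.norm_I, Complex.norm_exp_ofReal_mul_I, one_mul]

lemma normalDir_add (j k : ℤ) : normalDir h (j + k) =
    Complex.exp ((π * k / h : ℝ) * Complex.I) * normalDir h j := by
  have : (π * (j + k : ℤ) / h : ℝ) = π * k / h + π * j / h := by push_cast; ring
  rw [normalDir, normalDir, this, Complex.ofReal_add, add_mul, Complex.exp_add]
  ring

lemma lin_mul_normalDir (j k : ℤ) (a b : ℝ) :
    lin h k (((a : ℂ) + b * Complex.I) * normalDir h j) =
      a * cos (π * (k - j : ℤ) / h) + b * sin (π * (k - j : ℤ) / h) := by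
  have e : π * (k - j : ℤ) / h = π * k / h - π * j / h := by push_cast; ring
  rw [e, cos_sub, sin_sub, lin, Complex.mul_re, Complex.mul_im, normalDir_re, normalDir_im,
    cart_re, cart_im]
  ring

lemma lin_add_period (hh : h ≠ 0) (j : ℤ) (z : ℂ) : lin h (j + 2 * h) z = lin h j z := by
  have hh' : (h : ℝ) ≠ 0 := by exact_mod_cast hh
  have e : π * (j + 2 * h : ℤ) / h = π * j / h + 2 * π := by push_cast; field_simp
  rw [lin, e, cos_add_two_pi, sin_add_two_pi, lin]

lemma lin_add_half_period (hh : h ≠ 0) (j : ℤ) (z : ℂ) : lin h (j + h) z = -lin h j z := by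
  have hh' : (h : ℝ) ≠ 0 := by exact_mod_cast hh
  have e : π * (j + h : ℤ) / h = π * j / h + π := by push_cast; field_simp
  rw [lin, e, cos_add_pi, sin_add_pi, lin]; ring

/-- The linear relation between three consecutive normals; its defect on the numbers `H` is what
`sideLen` measures. -/
lemma lin_succ_add_pred (j : ℤ) (z : ℂ) :
    lin h (j + 1) z + lin h (j - 1) z = 2 * cos (π / h) * lin h j z := by
  have e1 : π * (j + 1 : ℤ) / h = π * j / h + π / h := by push_cast; ring
  have e2 : π * (j - 1 : ℤ) / h = π * j / h - π / h := by push_cast; ring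
  unfold lin
  rw [e1, e2, cos_add, sin_add, cos_sub, sin_sub]; ring

lemma periodic_add_mul (per : ∀ j, H (j + 2 * h) = H j) (j w : ℤ) :
    H (j + 2 * h * w) = H j := by
  have : Function.Periodic H (2 * h : ℤ) := per
  have h2 := this.zsmul w j
  rwa [smul_eq_mul, mul_comm w] at h2

lemma periodic_of_emod_eq (per : ∀ j, H (j + 2 * h) = H j) {j k : ℤ}
    (hjk : j ≡ k [ZMOD (2 * h)]) : H j = H k := by
  obtain ⟨w, hw⟩ := hjk.dvd
  rw [show k = j + 2 * h * w by linarith, periodic_add_mul per]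

lemma sideLen_period (per : ∀ j, H (j + 2 * h) = H j) (j : ℤ) :
    sideLen h H (j + 2 * h) = sideLen h H j := by
  unfold sideLen
  rw [per, show j + 2 * (h : ℤ) + 1 = (j + 1) + 2 * h by ring,
    show j + 2 * (h : ℤ) - 1 = (j - 1) + 2 * h by ring, per, per]

lemma vert_period (hh : h ≠ 0) (per : ∀ j, H (j + 2 * h) = H j) (j : ℤ) :
    vert h H (j + 2 * h) = vert h H j := by
  have hh' : (h : ℝ) ≠ 0 := by exact_mod_cast hh
  unfold vert
  rw [per, show j + 2 * (h : ℤ) + 1 = (j + 1) + 2 * h by ring, per]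
  congr 1
  rw [normalDir_add]
  have e : π * (2 * h : ℤ) / h = 2 * π := by push_cast; field_simp
  rw [e]
  push_cast
  rw [Complex.exp_two_pi_mul_I, one_mul]

lemma vert_periodic (hh : h ≠ 0) (per : ∀ j, H (j + 2 * h) = H j) (j w : ℤ) :
    vert h H (j + 2 * h * w) = vert h H j := by
  have : Function.Periodic (vert h H) (2 * h : ℤ) := vert_period hh per
  have h2 := this.zsmul w j
  rwa [smul_eq_mul, mul_comm w] at h2

lemma sideLen_periodic (per : ∀ j, H (j + 2 * h) = H j) (j w : ℤ) :
    sideLen h H (j + 2 * h * w) = sideLen h H j := by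
  have : Function.Periodic (sideLen h H) (2 * h : ℤ) := sideLen_period per
  have h2 := this.zsmul w j
  rwa [smul_eq_mul, mul_comm w] at h2

lemma lin_vert (j : ℤ) : lin h j (vert h H j) = H j := by
  rw [vert, lin_mul_normalDir]; simp

lemma vert_sub_vert (hh : 2 ≤ h) (j : ℤ) : vert h H j - vert h H (j - 1) =
    ((0 : ℝ) + (sideLen h H j : ℝ) * Complex.I) * normalDir h j := by
  have hs := sin_pi_div_pos hh
  unfold vert sideLen
  rw [sub_add_cancel]
  have e1 : normalDir h (j - 1) = (((cos (π / h) : ℝ) : ℂ) + (-sin (π / h) : ℝ) * Complex.I) *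
      normalDir h j := by
    have : (π * (-1 : ℤ) / h : ℝ) = -(π / h) := by push_cast; ring
    rw [sub_eq_add_neg, normalDir_add, this, Complex.exp_mul_I, ← Complex.ofReal_cos,
      ← Complex.ofReal_sin, cos_neg, sin_neg]
  rw [e1, ← mul_assoc, cart_mul, ← sub_mul]
  congr 1
  have hcs := cos_sq_add_sin_sq (π / h)
  apply Complex.ext
  · rw [Complex.sub_re, cart_re, cart_re, cart_re]
    field_simp
    ring
  · rw [Complex.sub_im, cart_im, cart_im, cart_im]
    field_simp
    linear_combination H (j - 1) * hcs

lemma vert_eq_of_sideLen_eq_zero (hh : 2 ≤ h) {j : ℤ} (hj : sideLen h H j = 0) :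
    vert h H j = vert h H (j - 1) := by
  rw [← sub_eq_zero, vert_sub_vert hh, hj]; simp

lemma vert_eq_of_inactive (hh : 2 ≤ h) (j : ℤ) (n : ℕ)
    (hj : ∀ m : ℕ, m < n → sideLen h H (j + m + 1) = 0) : vert h H (j + n) = vert h H j := by
  induction n with
  | zero => simp
  | succ n ih =>
    have h1 := vert_eq_of_sideLen_eq_zero hh (hj n (by omega))
    rw [add_sub_cancel_right] at h1
    push_cast
    rw [← add_assoc, h1]
    exact ih fun m hm => hj m (by omega)

lemma lin_vert_pred (hh : 2 ≤ h) (j : ℤ) : lin h j (vert h H (j - 1)) = H j := by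
  have h1 := vert_sub_vert (H := H) hh j
  have h2 : vert h H (j - 1) = vert h H j - ((0 : ℝ) + (sideLen h H j : ℝ) * Complex.I) *
      normalDir h j := by rw [← h1]; ring
  rw [h2, lin_sub, lin_vert, lin_mul_normalDir]; simp

/-- The distance of a vertex from a side line as a sum over the sides in between. -/
lemma sub_lin_vert_eq_sum (hh : 2 ≤ h) (j : ℤ) (n : ℕ) :
    H j - lin h j (vert h H (j + n)) =
      ∑ m ∈ Finset.range n, sideLen h H (j + m + 1) * sin (π * (m + 1) / h) := by
  induction n with
  | zero => simp [lin_vert]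
  | succ n ih =>
    have h1 := vert_sub_vert (H := H) hh (j + n + 1)
    rw [add_sub_cancel_right] at h1
    have h2 : vert h H (j + n + 1) = vert h H (j + n) +
        ((0 : ℝ) + (sideLen h H (j + n + 1) : ℝ) * Complex.I) *
        normalDir h (j + n + 1) := by rw [← h1]; ring
    rw [Finset.sum_range_succ, ← ih]
    push_cast
    rw [← add_assoc, h2, lin_add, lin_mul_normalDir]
    have e : π * (j - (j + n + 1) : ℤ) / h = -(π * (n + 1) / h) := by push_cast; ring
    rw [e, sin_neg]
    ring

lemma sin_nonneg_of_le (hh : 2 ≤ h) {m : ℕ} (hm : m + 1 ≤ h) : 0 ≤ sin (π * (m + 1) / h) := by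
  have h1 : (m : ℝ) + 1 ≤ h := by exact_mod_cast hm
  have hpos : (0 : ℝ) < h := by exact_mod_cast (by omega : 0 < h)
  apply sin_nonneg_of_nonneg_of_le_pi (by positivity)
  rw [div_le_iff₀ hpos]
  nlinarith [pi_pos]

lemma sin_pos_of_lt (hh : 2 ≤ h) {m : ℕ} (hm : m + 1 < h) : 0 < sin (π * (m + 1) / h) := by
  have h1 : (m : ℝ) + 1 < h := by exact_mod_cast hm
  have hpos : (0 : ℝ) < h := by exact_mod_cast (by omega : 0 < h)
  apply sin_pos_of_pos_of_lt_pi (by positivity)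
  rw [div_lt_iff₀ hpos]
  nlinarith [pi_pos]

lemma sin_nonpos_of_ge (hh : 2 ≤ h) {m : ℕ} (hm : h ≤ m + 1) (hm2 : m + 1 ≤ 2 * h) :
    sin (π * (m + 1) / h) ≤ 0 := by
  have h1 : (h : ℝ) ≤ m + 1 := by exact_mod_cast hm
  have h2 : (m : ℝ) + 1 ≤ 2 * h := by exact_mod_cast hm2
  have hpos : (0 : ℝ) < h := by exact_mod_cast (by omega : 0 < h)
  have e : π * (m + 1) / h = (π * (m + 1) / h - 2 * π) + 2 * π := by ring
  rw [e, sin_add_two_pi]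
  apply sin_nonpos_of_nonpos_of_neg_pi_le
  · rw [sub_nonpos, div_le_iff₀ hpos]; nlinarith [pi_pos]
  · have : π ≤ π * (m + 1) / h := by rw [le_div_iff₀ hpos]; nlinarith [pi_pos]
    linarith

lemma sin_neg_of_gt (hh : 2 ≤ h) {m : ℕ} (hm : h < m + 1) (hm2 : m + 1 < 2 * h) :
    sin (π * (m + 1) / h) < 0 := by
  have h1 : (h : ℝ) < m + 1 := by exact_mod_cast hm
  have h2 : (m : ℝ) + 1 < 2 * h := by exact_mod_cast hm2
  have hpos : (0 : ℝ) < h := by exact_mod_cast (by omega : 0 < h)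
  have e : π * (m + 1) / h = (π * (m + 1) / h - 2 * π) + 2 * π := by ring
  rw [e, sin_add_two_pi]
  apply sin_neg_of_neg_of_neg_pi_lt
  · rw [sub_neg, div_lt_iff₀ hpos]; nlinarith [pi_pos]
  · have : π < π * (m + 1) / h := by rw [lt_div_iff₀ hpos]; nlinarith [pi_pos]
    linarith

/-- The distance of a vertex from a side line as a sum over the sides beyond it. -/
lemma sub_lin_vert_eq_neg_sum (hh : 2 ≤ h) (per : ∀ j, H (j + 2 * h) = H j) (j : ℤ) {n : ℕ}
    (hn : n < 2 * h) :
    H j - lin h j (vert h H (j + n)) =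
      ∑ m ∈ Finset.range (2 * h - 1 - n),
        sideLen h H (j + (n + m : ℕ) + 1) * -sin (π * ((n + m : ℕ) + 1) / h) := by
  have h1 := sub_lin_vert_eq_sum (H := H) hh j (2 * h - 1)
  -- The walk around the polygon ends on line `j` again, so the total sum is zero and its tail is
  -- minus its head.
  have h2 : vert h H (j + (2 * h - 1 : ℕ)) = vert h H (j - 1) := by
    rw [← vert_period (by omega) per (j - 1)]
    congr 1
    push_cast [Nat.cast_sub (show 1 ≤ 2 * h by omega)]
    ring
  rw [h2, lin_vert_pred hh, sub_self] at h1
  have e : 2 * h - 1 = n + (2 * h - 1 - n) := by omega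
  rw [e, Finset.sum_range_add, ← sub_lin_vert_eq_sum hh] at h1
  simp only [mul_neg, Finset.sum_neg_distrib]
  linarith

/-- Up to half a turn all sines in the sum are nonnegative; beyond it the complementary sum has the
right signs. -/
lemma lin_vert_le_of_nat (hh : 2 ≤ h) (per : ∀ j, H (j + 2 * h) = H j)
    (hl : ∀ j, 0 ≤ sideLen h H j) (j : ℤ) {n : ℕ} (hn : n < 2 * h) :
    lin h j (vert h H (j + n)) ≤ H j := by
  rw [← sub_nonneg]
  rcases le_total n h with hnh | hnh
  · rw [sub_lin_vert_eq_sum hh]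
    exact Finset.sum_nonneg fun m hm => mul_nonneg (hl _)
      (sin_nonneg_of_le hh (by have := Finset.mem_range.1 hm; omega))
  · rw [sub_lin_vert_eq_neg_sum hh per j hn]
    exact Finset.sum_nonneg fun m hm => mul_nonneg (hl _) (neg_nonneg.2
      (sin_nonpos_of_ge hh (by omega) (by have := Finset.mem_range.1 hm; omega)))

lemma vert_mem_closedRegion (hh : 2 ≤ h) (per : ∀ j, H (j + 2 * h) = H j)
    (hl : ∀ j, 0 ≤ sideLen h H j) (k : ℤ) : vert h H k ∈ closedRegion h H := by
  intro j
  have hpos : (0 : ℤ) < 2 * h := by omega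
  have h1 := Int.emod_nonneg (k - j) hpos.ne'
  have h2 := Int.emod_lt_of_pos (k - j) hpos
  have h3 := lin_vert_le_of_nat hh per hl j (n := ((k - j) % (2 * h)).toNat) (by omega)
  rw [Int.toNat_of_nonneg h1] at h3
  have h4 := vert_periodic (H := H) (by omega) per (j + (k - j) % (2 * h)) ((k - j) / (2 * h))
  rw [add_assoc, Int.emod_add_mul_ediv, add_sub_cancel] at h4
  rwa [h4]

/-- Strictness needs a side of positive length on the shorter way back to line `j`: `h₁` provides it
before the half-turn, `h₂` after. -/
lemma lin_vert_lt (hh : 2 ≤ h) (per : ∀ j, H (j + 2 * h) = H j)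
    (hl : ∀ j, 0 ≤ sideLen h H j) (j : ℤ) {n m₁ : ℕ} (hn : n + 1 < 2 * h)
    (hm₁ : m₁ < n) (h₁ : 0 < sideLen h H (j + m₁ + 1)) (h₂ : 0 < sideLen h H (j + n + 1)) :
    lin h j (vert h H (j + n)) < H j := by
  rw [← sub_pos]
  rcases lt_or_ge n h with hnh | hnh
  · rw [sub_lin_vert_eq_sum hh]
    exact Finset.sum_pos' (fun m hm => mul_nonneg (hl _)
      (sin_nonneg_of_le hh (by have := Finset.mem_range.1 hm; omega)))
      ⟨m₁, Finset.mem_range.2 hm₁, mul_pos h₁ (sin_pos_of_lt hh (by omega))⟩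
  · rw [sub_lin_vert_eq_neg_sum hh per j (by omega)]
    refine Finset.sum_pos' (fun m hm => mul_nonneg (hl _) (neg_nonneg.2
      (sin_nonpos_of_ge hh (by omega) (by have := Finset.mem_range.1 hm; omega))))
      ⟨0, Finset.mem_range.2 (by omega), mul_pos (by simpa using h₂) (neg_pos.2
        (sin_neg_of_gt hh (by omega) (by omega)))⟩

/-- Every half-turn contains a side of positive length. -/
lemma exists_active (hh : 2 ≤ h) (hne : (openRegion h H).Nonempty)
    (hl : ∀ j, 0 ≤ sideLen h H j) (j : ℤ) :
    ∃ m : ℕ, m + 1 < h ∧ 0 < sideLen h H (j + m + 1) := by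
  obtain ⟨z, hz⟩ := hne
  have h1 := hz j
  have h2 := hz (j + h)
  rw [lin_add_half_period (by omega)] at h2
  have h3 := sub_lin_vert_eq_sum (H := H) hh j h
  have h4 : lin h j (vert h H (j + h)) = -H (j + h) := by
    have := lin_add_half_period (h := h) (by omega) j (vert h H (j + h))
    rw [lin_vert] at this
    linarith
  rw [h4] at h3
  -- The sum in `h3` is `H j + H (j + h)`, the width of a strip with a point in its interior. Its
  -- last term is zero since `sin π = 0`, so if the others vanished the width would too.
  by_contra! hcon
  have h5 : ∑ m ∈ Finset.range h, sideLen h H (j + m + 1) * sin (π * (m + 1) / h) = 0 := by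
    refine Finset.sum_eq_zero fun m hm => ?_
    rcases Nat.lt_or_ge (m + 1) h with h6 | h6
    · rw [le_antisymm (hcon m h6) (hl _), zero_mul]
    · have e : m + 1 = h := by have := Finset.mem_range.1 hm; omega
      have e' : (m : ℝ) + 1 = h := by exact_mod_cast e
      have hpos : (h : ℝ) ≠ 0 := by exact_mod_cast (by omega : h ≠ 0)
      rw [e', mul_div_assoc, div_self hpos, mul_one, sin_pi, mul_zero]
  linarith

/-- The points of a side line in the closed region form the side. -/
lemma mem_segment_of_lin_eq (hh : 2 ≤ h) {j : ℤ} {z : ℂ} (hz : z ∈ closedRegion h H)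
    (hj : lin h j z = H j) : z ∈ segment ℝ (vert h H (j - 1)) (vert h H j) := by
  have hs := sin_pi_div_pos hh
  set u := normalDir h j with hu
  -- coordinates of `z` with respect to the `j`-th direction
  obtain ⟨a, b, hab⟩ : ∃ a b : ℝ, z = ((a : ℂ) + b * Complex.I) * u := by
    refine ⟨(z * u⁻¹).re, (z * u⁻¹).im, ?_⟩
    have : u ≠ 0 := by rw [← norm_pos_iff, hu, norm_normalDir]; exact one_pos
    rw [Complex.re_add_im, inv_mul_cancel_right₀ this]
  have ha : a = H j := by
    rw [hab, hu, lin_mul_normalDir] at hj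
    simpa using hj
  have h1 := hz (j + 1)
  have h2 := hz (j - 1)
  rw [hab, hu, lin_mul_normalDir, ha] at h1 h2
  have e1 : π * (j + 1 - j : ℤ) / h = π / h := by push_cast; ring
  have e2 : π * (j - 1 - j : ℤ) / h = -(π / h) := by push_cast; ring
  rw [e1] at h1
  rw [e2, cos_neg, sin_neg] at h2
  have hd := vert_sub_vert (H := H) hh j
  rw [← hu] at hd
  have hv : vert h H j = ((H j : ℝ) + ((H (j + 1) - cos (π / h) * H j) / sin (π / h) : ℝ) *
    Complex.I) * u := rfl
  set B := (H (j + 1) - cos (π / h) * H j) / sin (π / h) with hB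
  have hlen : sideLen h H j = B - (cos (π / h) * H j - H (j - 1)) / sin (π / h) := by
    rw [hB, sideLen]; field_simp; ring
  have hbB : b ≤ B := by rw [hB, le_div_iff₀ hs]; linarith
  have hbA : B - sideLen h H j ≤ b := by
    rw [hlen, sub_sub_cancel, div_le_iff₀ hs]; linarith
  rcases (show 0 ≤ sideLen h H j by linarith).eq_or_lt with h0 | h0
  · have : b = B := by linarith
    rw [hab, ha, this, ← hv]
    exact right_mem_segment _ _ _
  · rw [segment_eq_image']
    refine ⟨1 - (B - b) / sideLen h H j, ⟨?_, ?_⟩, ?_⟩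
    · rw [sub_nonneg, div_le_one h0]; linarith
    · rw [sub_le_self_iff]; exact div_nonneg (by linarith) h0.le
    · simp only
      have e3 : vert h H (j - 1) = vert h H j - ((0 : ℝ) + (sideLen h H j : ℝ) * Complex.I) * u :=
        by rw [← hd]; ring
      rw [hd, e3, hv, hab, ha]
      have hne : (sideLen h H j : ℂ) ≠ 0 := by exact_mod_cast h0.ne'
      rw [Complex.real_smul]
      push_cast
      field_simp
      ring

lemma continuous_lin (j : ℤ) : Continuous (lin h j) := by
  unfold lin; fun_prop

lemma openRegion_eq_iInter (hh : 2 ≤ h) (per : ∀ j, H (j + 2 * h) = H j) :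
    openRegion h H = ⋂ j ∈ Finset.range (2 * h), {z | lin h j z < H j} := by
  ext z
  simp only [Set.mem_iInter, Set.mem_ofPred_eq, Finset.mem_range]
  refine ⟨fun hz j _ => hz j, fun hz j => ?_⟩
  have hpos : (0 : ℤ) < 2 * h := by omega
  have h1 := Int.emod_nonneg j hpos.ne'
  have h2 := Int.emod_lt_of_pos j hpos
  have h3 := hz (j % (2 * h)).toNat (by omega)
  rw [Int.toNat_of_nonneg h1] at h3
  have hper : ∀ k, (fun j => lin h j z - H j) (k + 2 * h) = (fun j => lin h j z - H j) k := by
    intro k; simp only; rw [per, lin_add_period (by omega)]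
  have h4 := periodic_of_emod_eq (H := fun j => lin h j z - H j) hper (Int.mod_modEq j (2 * h))
  linarith

lemma isOpen_openRegion (hh : 2 ≤ h) (per : ∀ j, H (j + 2 * h) = H j) :
    IsOpen (openRegion h H) := by
  rw [openRegion_eq_iInter hh per]
  exact isOpen_biInter_finset fun j _ => isOpen_lt (continuous_lin _) continuous_const

lemma isClosed_closedRegion : IsClosed (closedRegion h H) := by
  have : closedRegion h H = ⋂ j, {z | lin h j z ≤ H j} := by
    ext z; simp [closedRegion]
  rw [this]
  exact isClosed_iInter fun j => isClosed_le (continuous_lin _) continuous_const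

lemma convex_closedRegion : Convex ℝ (closedRegion h H) := by
  intro u hu v hv a b ha hb hab j
  rw [lin_add, lin_smul, lin_smul]
  calc a * lin h j u + b * lin h j v ≤ a * H j + b * H j := by gcongr; exacts [hu j, hv j]
    _ = H j := by rw [← add_mul, hab, one_mul]

lemma openRegion_subset : openRegion h H ⊆ closedRegion h H := fun _ hz j => (hz j).le

lemma isBounded_closedRegion (hh : 2 ≤ h) : Bornology.IsBounded (closedRegion h H) := by
  have hs := sin_pi_div_pos hh
  rw [isBounded_iff_forall_norm_le]
  set M := max (max |H 0| |H (0 + h)|) (max |H 1| |H (1 + h)|)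
  refine ⟨2 * M / sin (π / h) + M, fun z hz => (Complex.norm_le_abs_re_add_abs_im z).trans ?_⟩
  have h0 : |z.im| ≤ M := by
    have h1 := hz 0
    have h2 := hz (0 + h)
    rw [lin_add_half_period (by omega)] at h2
    have e : lin h 0 z = z.im := by simp [lin]
    rw [e] at h1 h2
    have h3 : |H 0| ≤ M := le_max_of_le_left (le_max_left _ _)
    have h4 : |H (0 + h)| ≤ M := le_max_of_le_left (le_max_right _ _)
    rw [abs_le]
    constructor <;> linarith [le_abs_self (H 0), le_abs_self (H (0 + h))]
  have h1 : |z.im * cos (π / h) - z.re * sin (π / h)| ≤ M := by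
    have h1 := hz 1
    have h2 := hz (1 + h)
    rw [lin_add_half_period (by omega)] at h2
    have e : lin h 1 z = z.im * cos (π / h) - z.re * sin (π / h) := by simp [lin]
    rw [e] at h1 h2
    have h3 : |H 1| ≤ M := le_max_of_le_right (le_max_left _ _)
    have h4 : |H (1 + h)| ≤ M := le_max_of_le_right (le_max_right _ _)
    rw [abs_le]
    constructor <;> linarith [le_abs_self (H 1), le_abs_self (H (1 + h))]
  have h2 : |z.im * cos (π / h)| ≤ M := by
    rw [abs_mul]
    exact (mul_le_of_le_one_right (abs_nonneg _) (abs_cos_le_one _)).trans h0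
  gcongr
  rw [le_div_iff₀ hs, ← abs_of_pos hs, ← abs_mul, abs_le]
  rw [abs_le] at h1 h2
  constructor <;> linarith [h1.1, h1.2, h2.1, h2.2]

lemma closure_openRegion (hne : (openRegion h H).Nonempty) :
    closure (openRegion h H) = closedRegion h H := by
  apply Set.Subset.antisymm (closure_minimal openRegion_subset isClosed_closedRegion)
  intro z hz
  obtain ⟨z₀, hz₀⟩ := hne
  have hlim : Filter.Tendsto (fun t : ℝ => z + t • (z₀ - z)) (nhdsWithin 0 (Set.Ioi 0)) (nhds z) := by
    have : Continuous fun t : ℝ => z + t • (z₀ - z) := by fun_prop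
    have h1 := this.tendsto 0
    simp only [zero_smul, add_zero] at h1
    exact h1.mono_left nhdsWithin_le_nhds
  refine mem_closure_of_tendsto hlim ?_
  filter_upwards [Ioo_mem_nhdsGT (show (0 : ℝ) < 1 by norm_num)] with t ht j
  rw [lin_add, lin_smul, lin_sub]
  have h1 := hz j
  have h2 := hz₀ j
  nlinarith [ht.1, ht.2]

lemma interior_closedRegion (hh : 2 ≤ h) (per : ∀ j, H (j + 2 * h) = H j) :
    interior (closedRegion h H) = openRegion h H := by
  apply Set.Subset.antisymm _ (interior_maximal openRegion_subset (isOpen_openRegion hh per))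
  intro z hz j
  obtain ⟨r, hr, hball⟩ := Metric.mem_nhds_iff.1 (mem_interior_iff_mem_nhds.1 hz)
  set u := normalDir h j with hu
  have hnu : ‖u‖ = 1 := norm_normalDir j
  have h1 : z + (r / 2) • u ∈ closedRegion h H := by
    apply hball
    rw [Metric.mem_ball, dist_eq_norm, add_sub_cancel_left, norm_smul, hnu, mul_one,
      Real.norm_of_nonneg (by positivity)]
    linarith
  have h2 := h1 j
  have h3 : lin h j u = 1 := by
    have := lin_mul_normalDir (h := h) j j 1 0
    rwa [sub_self, Complex.ofReal_one, Complex.ofReal_zero, zero_mul, add_zero, one_mul,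
      Int.cast_zero, mul_zero, zero_div, cos_zero, zero_mul, add_zero, mul_one] at this
  rw [lin_add, lin_smul, h3] at h2
  linarith

end PiecewiseRotation

end

/-! ### From regions to convex polygons -/

noncomputable section

namespace PiecewiseRotation

open Real

variable {h : ℕ} {H : ℤ → ℝ}

lemma eq_of_add_mul_eq {a b : ℕ} {w : ℤ} (ha : a < 2 * h) (hb : b < 2 * h)
    (hab : (a : ℤ) = b + 2 * h * w) : a = b := by
  have h1 : w < 1 := by
    by_contra! hw
    have : 2 * (h : ℤ) * 1 ≤ 2 * h * w := by gcongr
    omega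
  have h2 : -1 < w := by
    by_contra! hw
    have : 2 * (h : ℤ) * w ≤ 2 * h * (-1) := by gcongr
    omega
  have : w = 0 := by omega
  subst this
  omega

/-- `e` enumerates the sides of positive length in counterclockwise order. -/
structure Enumerates (h : ℕ) (H : ℤ → ℝ) {n : ℕ} (e : Fin n → ℕ) : Prop where
  strictMono : StrictMono e
  lt : ∀ i, e i < 2 * h
  active : ∀ i, 0 < sideLen h H (e i)
  surj : ∀ j < 2 * h, 0 < sideLen h H j → ∃ i, e i = j

variable {n : ℕ} {e : Fin n → ℕ}

lemma Enumerates.exists_index (he : Enumerates h H e) (hh : 2 ≤ h)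
    (per : ∀ j, H (j + 2 * h) = H j) {k : ℤ} (hk : 0 < sideLen h H k) :
    ∃ i, ∃ w : ℤ, k = e i + 2 * h * w := by
  have hpos : (0 : ℤ) < 2 * h := by omega
  have h1 := Int.emod_nonneg k hpos.ne'
  have h2 := Int.emod_lt_of_pos k hpos
  have h3 := Int.emod_add_mul_ediv k (2 * h)
  rw [← h3, sideLen_periodic per, ← Int.toNat_of_nonneg h1] at hk
  obtain ⟨i, hi⟩ := he.surj _ (by omega) hk
  refine ⟨i, k / (2 * h), ?_⟩
  rw [hi, Int.toNat_of_nonneg h1, h3]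

/-- Here `w` counts the passage through index `2h`: it is 1 for the last side, whose successor is
the first one, and 0 otherwise. -/
lemma Enumerates.exists_gap (he : Enumerates h H e) (hh : 2 ≤ h)
    (per : ∀ j, H (j + 2 * h) = H j) (hl : ∀ j, 0 ≤ sideLen h H j) (i : Fin n) :
    ∃ N w : ℕ, e (finRotate n i) + 2 * h * w = e i + N + 1 ∧
      ∀ m < N, sideLen h H (e i + m + 1) = 0 := by
  obtain ⟨n, rfl⟩ : ∃ k, n = k + 1 := ⟨n - 1, by have := i.2; omega⟩
  have hzero : ∀ k : ℕ, (∀ i', ∀ w : ℤ, (k : ℤ) ≠ e i' + 2 * h * w) → sideLen h H k = 0 := by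
    intro k hk
    by_contra hne
    obtain ⟨i', w, hw⟩ := he.exists_index hh per (lt_of_le_of_ne (hl k) (Ne.symm hne))
    exact hk i' w hw
  by_cases hi : i.val < n
  · have hrot : finRotate (n + 1) i = ⟨i.val + 1, by omega⟩ := finRotate_of_lt hi
    have h1 : e i < e (finRotate (n + 1) i) :=
      he.strictMono (by rw [hrot, Fin.lt_def]; simp)
    refine ⟨e (finRotate (n + 1) i) - e i - 1, 0, by omega, fun m hm => ?_⟩
    have := hzero (e i + m + 1) fun i' w hw => ?_
    · exact_mod_cast this
    · have h2 := he.lt (finRotate (n + 1) i)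
      have h3 := eq_of_add_mul_eq (h := h) (by omega) (he.lt i') hw
      have h4 : i < i' := he.strictMono.lt_iff_lt.1 (by omega)
      have h5 : i' < finRotate (n + 1) i := he.strictMono.lt_iff_lt.1 (by omega)
      rw [hrot, Fin.lt_def] at h5
      rw [Fin.lt_def] at h4
      simp only at h5
      omega
  · have hi' : i = Fin.last n := Fin.ext (by have := i.2; simp; omega)
    have hrot : finRotate (n + 1) i = 0 := by rw [hi']; exact finRotate_last
    have h0 := he.lt 0
    have hilt := he.lt i
    rw [hrot]
    refine ⟨e 0 + 2 * h - e i - 1, 1, by omega, fun m hm => ?_⟩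
    have := hzero (e i + m + 1) fun i' w hw => ?_
    · exact_mod_cast this
    · have h6 : e 0 ≤ e i' := he.strictMono.monotone (Fin.zero_le _)
      have h7 : e i' ≤ e i := he.strictMono.monotone (by rw [hi']; exact Fin.le_last _)
      rcases Nat.lt_or_ge (e i + m + 1) (2 * h) with h8 | h8
      · have h3 := eq_of_add_mul_eq (h := h) h8 (he.lt i') hw
        omega
      · have h3 := eq_of_add_mul_eq (h := h) (a := e i + m + 1 - 2 * h) (b := e i') (w := w - 1)
          (by omega) (he.lt i') (by rw [mul_sub, mul_one]; omega)
        omega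

lemma Enumerates.vert_next (he : Enumerates h H e) (hh : 2 ≤ h)
    (per : ∀ j, H (j + 2 * h) = H j) (hl : ∀ j, 0 ≤ sideLen h H j) (i : Fin n) :
    vert h H (e (finRotate n i) - 1) = vert h H (e i) := by
  obtain ⟨N, w, h1, h2⟩ := he.exists_gap hh per hl i
  rw [← vert_eq_of_inactive hh (e i) N h2, ← vert_periodic (by omega) per _ w]
  congr 1
  have : (e (finRotate n i) + 2 * h * w : ℤ) = e i + N + 1 := by exact_mod_cast h1
  linarith

/-- Three successive choices of an active side, each fewer than `h` steps after the previous one, do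
not complete a full turn, so they are distinct. -/
lemma Enumerates.three_le (he : Enumerates h H e) (hh : 2 ≤ h)
    (per : ∀ j, H (j + 2 * h) = H j) (hl : ∀ j, 0 ≤ sideLen h H j)
    (hne : (openRegion h H).Nonempty) : 3 ≤ n := by
  obtain ⟨m₀, _, hm₀'⟩ := exists_active hh hne hl 0
  obtain ⟨i₀, w₀, hi₀⟩ := he.exists_index hh per hm₀'
  obtain ⟨m₁, hm₁, hm₁'⟩ := exists_active hh hne hl (e i₀)
  obtain ⟨i₁, w₁, hi₁⟩ := he.exists_index hh per hm₁'
  obtain ⟨m₂, hm₂, hm₂'⟩ := exists_active hh hne hl (e i₀ + m₁ + 1)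
  obtain ⟨i₂, w₂, hi₂⟩ := he.exists_index hh per hm₂'
  have key : ∀ (d : ℕ) (w : ℤ), 0 < d → d < 2 * h → (d : ℤ) ≠ 2 * h * w := by
    intro d w hd hd2 hw
    have := eq_of_add_mul_eq (h := h) (a := d) (b := 0) hd2 (by omega) (by simpa using hw)
    omega
  have h01 : i₀ ≠ i₁ := by
    rintro rfl
    exact key (m₁ + 1) w₁ (by omega) (by omega) (by push_cast; linarith)
  have h02 : i₀ ≠ i₂ := by
    rintro rfl
    exact key (m₁ + m₂ + 2) w₂ (by omega) (by omega) (by push_cast; linarith)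
  have h12 : i₁ ≠ i₂ := by
    rintro rfl
    exact key (m₂ + 1) (w₂ - w₁) (by omega) (by omega) (by push_cast; linarith)
  rw [Ne, Fin.ext_iff] at h01 h02 h12
  have := i₀.2
  have := i₁.2
  have := i₂.2
  omega

lemma Enumerates.exists_vert_eq (he : Enumerates h H e) (hh : 2 ≤ h)
    (per : ∀ j, H (j + 2 * h) = H j) (hl : ∀ j, 0 ≤ sideLen h H j)
    (hne : (openRegion h H).Nonempty) (j : ℤ) : ∃ i, vert h H j = vert h H (e i - 1) := by
  classical
  have hex : ∃ m : ℕ, 0 < sideLen h H (j + m + 1) := by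
    obtain ⟨m, _, hm⟩ := exists_active hh hne hl j
    exact ⟨m, hm⟩
  obtain ⟨i, w, hi⟩ := he.exists_index hh per (Nat.find_spec hex)
  refine ⟨i, ?_⟩
  rw [← vert_eq_of_inactive hh j (Nat.find hex) fun m hm =>
    le_antisymm (not_lt.1 (Nat.find_min hex hm)) (hl _),
    ← vert_periodic (h := h) (by omega) per (e i - 1) w]
  congr 1
  linarith

lemma mul_im_of_side (hh : 2 ≤ h) (j : ℤ) (w : ℂ) :
    ((starRingEnd ℂ) (vert h H j - vert h H (j - 1)) * w).im = -(sideLen h H j * lin h j w) := by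
  rw [vert_sub_vert hh, Complex.mul_im, Complex.conj_re, Complex.conj_im, Complex.mul_re,
    Complex.mul_im, cart_re, cart_im, normalDir_re, normalDir_im, lin]
  ring

/-- An interior point is the midpoint of a segment in the region, and a boundary point lies on a
side, so an extreme point must be an endpoint of a side. -/
lemma extremePoints_closedRegion_subset (he : Enumerates h H e) (hh : 2 ≤ h)
    (per : ∀ j, H (j + 2 * h) = H j) (hl : ∀ j, 0 ≤ sideLen h H j)
    (hne : (openRegion h H).Nonempty) :
    (closedRegion h H).extremePoints ℝ ⊆ Set.range fun i => vert h H (e i - 1) := by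
  intro x hx
  obtain ⟨hxK, hseg⟩ := mem_extremePoints_iff_forall_segment.1 hx
  by_cases hxV : x ∈ openRegion h H
  · exfalso
    obtain ⟨r, hr, hball⟩ := Metric.mem_nhds_iff.1 ((isOpen_openRegion hh per).mem_nhds hxV)
    have h1 : x - (r / 2 : ℝ) ∈ closedRegion h H := openRegion_subset (hball (by
      rw [Metric.mem_ball, dist_eq_norm, sub_sub_cancel_left, norm_neg, Complex.norm_real,
        Real.norm_of_nonneg (by positivity)]; linarith))
    have h2 : x + (r / 2 : ℝ) ∈ closedRegion h H := openRegion_subset (hball (by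
      rw [Metric.mem_ball, dist_eq_norm, add_sub_cancel_left, Complex.norm_real,
        Real.norm_of_nonneg (by positivity)]; linarith))
    have h3 : x ∈ segment ℝ (x - (r / 2 : ℝ)) (x + (r / 2 : ℝ)) :=
      ⟨1 / 2, 1 / 2, by norm_num, by norm_num, by norm_num, by
        simp only [Complex.real_smul]; push_cast; ring⟩
    have hr' : ((r / 2 : ℝ) : ℂ) ≠ 0 := by exact_mod_cast (by positivity : r / 2 ≠ 0)
    rcases hseg _ h1 _ h2 h3 with h4 | h4
    · exact hr' (by linear_combination -h4)
    · exact hr' (by linear_combination h4)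
  · have : ∃ j, H j ≤ lin h j x := by simpa [openRegion] using hxV
    obtain ⟨j, hj⟩ := this
    have h1 := mem_segment_of_lin_eq hh hxK (le_antisymm (hxK j) hj)
    rcases hseg _ (vert_mem_closedRegion hh per hl _) _ (vert_mem_closedRegion hh per hl _) h1
      with h2 | h2
    · obtain ⟨i, hi⟩ := he.exists_vert_eq hh per hl hne (j - 1)
      exact ⟨i, by simp only; rw [← hi, h2]⟩
    · obtain ⟨i, hi⟩ := he.exists_vert_eq hh per hl hne j
      exact ⟨i, by simp only; rw [← hi, h2]⟩

/-- Krein–Milman for the compact region, whose extreme points are among finitely many vertices. -/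
lemma convexHull_vert (he : Enumerates h H e) (hh : 2 ≤ h)
    (per : ∀ j, H (j + 2 * h) = H j) (hl : ∀ j, 0 ≤ sideLen h H j)
    (hne : (openRegion h H).Nonempty) :
    convexHull ℝ (Set.range fun i => vert h H (e i - 1)) = closedRegion h H := by
  apply Set.Subset.antisymm
  · apply convexHull_min _ convex_closedRegion
    rintro _ ⟨i, rfl⟩
    exact vert_mem_closedRegion hh per hl _
  · have hK : IsCompact (closedRegion h H) :=
      Metric.isCompact_of_isClosed_isBounded isClosed_closedRegion (isBounded_closedRegion hh)
    rw [← closure_convexHull_extremePoints hK convex_closedRegion]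
    refine closure_minimal (convexHull_mono
      (extremePoints_closedRegion_subset he hh per hl hne)) ?_
    exact ((Set.finite_range _).isCompact_convexHull ℝ).isClosed

lemma frontier_openRegion (he : Enumerates h H e) (hh : 2 ≤ h)
    (per : ∀ j, H (j + 2 * h) = H j) (hl : ∀ j, 0 ≤ sideLen h H j)
    (hne : (openRegion h H).Nonempty) :
    frontier (openRegion h H) =
      (Polygon.mk fun i => vert h H (e i - 1)).boundary ℝ := by
  have hedge : ∀ i, (Polygon.mk fun i => vert h H (e i - 1)).edgeSet ℝ i =
      segment ℝ (vert h H (e i - 1)) (vert h H (e i)) := by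
    intro i
    rw [Polygon.edgeSet, affineSegment_eq_segment, ← he.vert_next hh per hl i]
  rw [frontier, closure_openRegion hne, (isOpen_openRegion hh per).interior_eq, Polygon.boundary]
  simp_rw [hedge]
  apply Set.Subset.antisymm
  · rintro z ⟨hzK, hzV⟩
    have : ∃ j, H j ≤ lin h j z := by simpa [openRegion] using hzV
    obtain ⟨j, hj⟩ := this
    have h1 := mem_segment_of_lin_eq hh hzK (le_antisymm (hzK j) hj)
    rw [Set.mem_iUnion]
    rcases (hl j).eq_or_lt with h0 | h0
    · rw [vert_eq_of_sideLen_eq_zero hh h0.symm, segment_same, Set.mem_singleton_iff] at h1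
      obtain ⟨i, hi⟩ := he.exists_vert_eq hh per hl hne (j - 1)
      exact ⟨i, by rw [h1, hi]; exact left_mem_segment _ _ _⟩
    · obtain ⟨i, w, hi⟩ := he.exists_index hh per h0
      refine ⟨i, ?_⟩
      rw [hi, vert_periodic (by omega) per,
        show (e i : ℤ) + 2 * h * w - 1 = (e i - 1) + 2 * h * w by ring,
        vert_periodic (by omega) per] at h1
      exact h1
  · refine Set.iUnion_subset fun i z hz => ?_
    refine ⟨convex_closedRegion.segment_subset (vert_mem_closedRegion hh per hl _)
      (vert_mem_closedRegion hh per hl _) hz, fun hzV => ?_⟩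
    obtain ⟨a, b, ha, hb, hab, rfl⟩ := hz
    have h1 := hzV (e i)
    rw [lin_add, lin_smul, lin_smul, lin_vert_pred hh, lin_vert, ← add_mul, hab, one_mul] at h1
    exact lt_irrefl _ h1

lemma isConvexPolygon_vert (he : Enumerates h H e) (hh : 2 ≤ h)
    (per : ∀ j, H (j + 2 * h) = H j) (hl : ∀ j, 0 ≤ sideLen h H j)
    (hne : (openRegion h H).Nonempty) :
    IsConvexPolygon (Polygon.mk fun i => vert h H (e i - 1)) := by
  refine ⟨he.three_le hh per hl hne, fun i j hji hjn => ?_⟩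
  simp only
  rw [he.vert_next hh per hl i, mul_im_of_side hh, lin_sub, lin_vert_pred hh, neg_pos]
  refine mul_neg_of_pos_of_neg (he.active i) (sub_neg.2 ?_)
  obtain ⟨N, w, h1, h2⟩ := he.exists_gap hh per hl i
  have hei := he.lt i
  have hej := he.lt j
  have hne : e j ≠ e i := he.strictMono.injective.ne hji
  -- `s` is the number of index steps from line `e i` to the vertex `P j`. The next active side
  -- comes after `N < s` steps, so `lin_vert_lt` applies.
  obtain ⟨s, w', hs, hs2⟩ : ∃ s w' : ℕ, e j + 2 * h * w' = e i + s + 1 ∧ s + 1 < 2 * h := by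
    rcases lt_or_gt_of_ne hne with h3 | h3
    · exact ⟨e j + 2 * h - e i - 1, 1, by omega, by omega⟩
    · exact ⟨e j - e i - 1, 0, by omega, by omega⟩
  have hsZ : (e j + 2 * h * w' : ℤ) = e i + s + 1 := by exact_mod_cast hs
  have h1Z : (e (finRotate n i) + 2 * h * w : ℤ) = e i + N + 1 := by exact_mod_cast h1
  have hactj : 0 < sideLen h H (e i + s + 1) := by
    rw [← hsZ, sideLen_periodic per]; exact he.active j
  have hactn : 0 < sideLen h H (e i + N + 1) := by
    rw [← h1Z, sideLen_periodic per]; exact he.active _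
  have hNs : N < s := by
    rcases lt_trichotomy s N with h3 | h3 | h3
    · rw [h2 s h3] at hactj; exact absurd hactj (lt_irrefl _)
    · exfalso
      subst h3
      refine hjn (he.strictMono.injective ?_)
      exact eq_of_add_mul_eq (h := h) (w := (w : ℤ) - w') hej (he.lt _) (by
        rw [mul_sub]; linarith)
    · exact h3
  have h4 := lin_vert_lt hh per hl (e i) hs2 hNs hactn hactj
  rw [← vert_periodic (by omega) per _ w', show (e j : ℤ) - 1 + 2 * h * w' = e i + s by linarith]
  exact h4

/-- A region with nonnegative side lengths is bounded by the convex polygon whose sides are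
the sides of positive length. -/
theorem boundedBy_openRegion (he : Enumerates h H e) (hh : 2 ≤ h)
    (per : ∀ j, H (j + 2 * h) = H j) (hl : ∀ j, 0 ≤ sideLen h H j)
    (hne : (openRegion h H).Nonempty) :
    BoundedBy (openRegion h H) (Polygon.mk fun i => vert h H (e i - 1)) := by
  refine ⟨isConvexPolygon_vert he hh per hl hne, frontier_openRegion he hh per hl hne, ?_⟩
  rw [convexHull_vert he hh per hl hne, interior_closedRegion hh per]

lemma exists_enumerates (h : ℕ) (H : ℤ → ℝ) :
    ∃ (n : ℕ) (e : Fin n → ℕ), n ≤ 2 * h ∧ Enumerates h H e := by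
  classical
  set s := (Finset.range (2 * h)).filter fun j : ℕ => 0 < sideLen h H j with hs
  have hmem : ∀ j ∈ s, j < 2 * h ∧ 0 < sideLen h H j := fun j hj => by
    rwa [hs, Finset.mem_filter, Finset.mem_range] at hj
  refine ⟨s.card, s.orderEmbOfFin rfl, ?_, ?_, ?_, ?_, ?_⟩
  · exact (Finset.card_filter_le _ _).trans (by simp)
  · exact (s.orderEmbOfFin rfl).strictMono
  · exact fun i => (hmem _ (Finset.orderEmbOfFin_mem s rfl i)).1
  · exact fun i => (hmem _ (Finset.orderEmbOfFin_mem s rfl i)).2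
  · intro j hj hj'
    have h1 : j ∈ Set.range (s.orderEmbOfFin rfl) := by
      rw [Finset.range_orderEmbOfFin]
      simp [hs, hj, hj']
    exact h1

end PiecewiseRotation

end

/-! ### Support numbers, rotational symmetry and the shape of a tile -/

noncomputable section

namespace PiecewiseRotation

open Real

variable {p h : ℕ}

/-- The support function of a set in the direction `normalDir h j`. -/
def support (h : ℕ) (V : Set ℂ) (j : ℤ) : ℝ := sSup (lin h j '' V)

lemma abs_lin_le (j : ℤ) (z : ℂ) : |lin h j z| ≤ 2 * ‖z‖ := by
  unfold lin
  have h1 : |z.im * cos (π * j / h)| ≤ ‖z‖ := by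
    rw [abs_mul]
    exact (mul_le_of_le_one_right (abs_nonneg _) (abs_cos_le_one _)).trans
      (Complex.abs_im_le_norm z)
  have h2 : |z.re * sin (π * j / h)| ≤ ‖z‖ := by
    rw [abs_mul]
    exact (mul_le_of_le_one_right (abs_nonneg _) (abs_sin_le_one _)).trans
      (Complex.abs_re_le_norm z)
  exact (abs_sub _ _).trans (by linarith)

lemma bddAbove_lin {V : Set ℂ} (hV : Bornology.IsBounded V) (j : ℤ) :
    BddAbove (lin h j '' V) := by
  obtain ⟨M, hM⟩ := isBounded_iff_forall_norm_le.1 hV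
  refine ⟨2 * M, ?_⟩
  rintro _ ⟨w, hw, rfl⟩
  have := abs_lin_le (h := h) j w
  linarith [le_abs_self (lin h j w), hM w hw]

lemma lin_normalDir_self (j : ℤ) : lin h j (normalDir h j) = 1 := by
  have := lin_mul_normalDir (h := h) j j 1 0
  rwa [sub_self, Complex.ofReal_one, Complex.ofReal_zero, zero_mul, add_zero, one_mul,
      Int.cast_zero, mul_zero, zero_div, cos_zero, zero_mul, add_zero, mul_one] at this

lemma lin_lt_support {V : Set ℂ} (hV : Bornology.IsBounded V) (ho : IsOpen V) (j : ℤ) {w : ℂ}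
    (hw : w ∈ V) : lin h j w < support h V j := by
  obtain ⟨r, hr, hball⟩ := Metric.isOpen_iff.1 ho w hw
  have h1 : w + (r / 2) • normalDir h j ∈ V := by
    apply hball
    rw [Metric.mem_ball, dist_eq_norm, add_sub_cancel_left, norm_smul, norm_normalDir, mul_one,
      Real.norm_of_nonneg (by positivity)]
    linarith
  have h2 := le_csSup (bddAbove_lin (h := h) hV j) ⟨_, h1, rfl⟩
  rw [lin_add, lin_smul, lin_normalDir_self] at h2
  unfold support
  linarith

lemma support_le {V : Set ℂ} (hne : V.Nonempty) (j : ℤ) {b : ℝ}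
    (hb : ∀ w ∈ V, lin h j w ≤ b) : support h V j ≤ b := by
  refine csSup_le (hne.image _) ?_
  rintro _ ⟨w, hw, rfl⟩
  exact hb w hw

lemma support_period (hh : h ≠ 0) (V : Set ℂ) (j : ℤ) :
    support h V (j + 2 * h) = support h V j := by
  have : lin h (j + 2 * h) = lin h j := funext fun z => lin_add_period hh j z
  rw [support, this, support]

/-- Take the supremum over `V` in `lin_succ_add_pred`; `cos (π / h) ≥ 0` since `h ≥ 2`. The value 0,
at `h = 2`, is treated apart because one divides by it. -/
lemma sideLen_support_nonneg (hh : 2 ≤ h) {V : Set ℂ} (hV : Bornology.IsBounded V)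
    (ho : IsOpen V) (hne : V.Nonempty) (j : ℤ) : 0 ≤ sideLen h (support h V) j := by
  have hs := sin_pi_div_pos hh
  have hc : 0 ≤ cos (π / h) := by
    have h2 : (2 : ℝ) ≤ h := by exact_mod_cast hh
    have : π / h ≤ π / 2 := div_le_div_of_nonneg_left pi_pos.le (by norm_num) h2
    have h3 : 0 ≤ π / h := by positivity
    exact cos_nonneg_of_neg_pi_div_two_le_of_le (by linarith [pi_pos]) this
  refine div_nonneg ?_ hs.le
  have key : ∀ w ∈ V, 2 * cos (π / h) * lin h j w ≤ support h V (j + 1) + support h V (j - 1) := by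
    intro w hw
    rw [← lin_succ_add_pred]
    exact (add_lt_add (lin_lt_support hV ho _ hw) (lin_lt_support hV ho _ hw)).le
  rcases hc.eq_or_lt with h0 | h0
  · obtain ⟨w, hw⟩ := hne
    have := key w hw
    rw [← h0] at this ⊢
    linarith
  · have h1 : support h V j ≤
        (support h V (j + 1) + support h V (j - 1)) / (2 * cos (π / h)) :=
      support_le hne j fun w hw => by
        rw [le_div_iff₀ (by positivity)]; linarith [key w hw]
    rw [le_div_iff₀ (by positivity)] at h1
    linarith

lemma mult_pow (h p : ℕ) (i : ℕ) :
    mult (π * p / h) ^ i = Complex.exp ((π * (p * i : ℤ) / h : ℝ) * Complex.I) := by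
  unfold mult
  rw [← Complex.exp_nat_mul]
  congr 1
  push_cast
  ring

lemma lin_exp_mul (j k : ℤ) (z : ℂ) :
    lin h (j + k) (Complex.exp ((π * k / h : ℝ) * Complex.I) * z) = lin h j z := by
  have e : π * (j + k : ℤ) / h = π * j / h + π * k / h := by push_cast; ring
  rw [lin, e, cos_add, sin_add, Complex.mul_re, Complex.mul_im, Complex.exp_ofReal_mul_I_re,
    Complex.exp_ofReal_mul_I_im, lin]
  have := cos_sq_add_sin_sq (π * k / h)
  linear_combination (z.im * cos (π * j / h) - z.re * sin (π * j / h)) * this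

lemma lin_zero (z : ℂ) : lin h 0 z = z.im := by simp [lin]

lemma im_mult_pow_mul (i : ℕ) (w : ℂ) :
    (mult (π * p / h) ^ i * w).im = lin h (-(p * i : ℤ)) w := by
  rw [mult_pow, ← lin_zero (h := h), ← lin_exp_mul (-(p * i : ℤ)) (p * i), neg_add_cancel]

/-- Every half-plane defining the cell has one of the `2h` normals, so it contains the half-plane
given by the support number in that direction. -/
lemma tile_eq_openRegion (hh : 2 ≤ h) {z : ℂ} {V : Set ℂ}
    (hV : V = interior (Cell (π * p / h) z)) (hb : Bornology.IsBounded V) (hz : z ∈ V) :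
    V = openRegion h (support h V) := by
  have ho : IsOpen V := hV ▸ isOpen_interior
  apply Set.Subset.antisymm
  · exact fun w hw j => lin_lt_support hb ho j hw
  · have h1 : openRegion h (support h V) ⊆ Cell (π * p / h) z := by
      intro w hw
      rw [mem_Cell_iff]
      intro i
      have hVi : ∀ v ∈ V, 0 < ((F (π * p / h))^[i] z).im *
          (((F (π * p / h))^[i] z).im + (mult (π * p / h) ^ i * (v - z)).im) :=
        fun v hv => mem_Cell_iff.1 (interior_subset (hV ▸ hv)) i
      simp only [im_mult_pow_mul, lin_sub] at hVi ⊢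
      set y := ((F (π * p / h))^[i] z).im
      set j : ℤ := -(p * i : ℤ)
      have hy : y ≠ 0 := by
        rintro hy
        have := hVi z hz
        rw [hy] at this
        simp at this
      rcases lt_or_gt_of_ne hy with hy | hy
      · refine mul_pos_of_neg_of_neg hy ?_
        have h2 : support h V j ≤ lin h j z - y := support_le ⟨z, hz⟩ j fun v hv => by
          nlinarith [hVi v hv]
        linarith [hw j]
      · refine mul_pos hy ?_
        have h2 : support h V (j + h) ≤ y - lin h j z := support_le ⟨z, hz⟩ _ fun v hv => by
          rw [lin_add_half_period (by omega)]
          nlinarith [hVi v hv]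
        have h3 := hw (j + h)
        rw [lin_add_half_period (by omega)] at h3
        linarith
    conv_rhs => rw [hV]
    exact interior_maximal h1
      (isOpen_openRegion hh (support_period (by omega) V))

lemma eq_of_lin_eq (hh : 2 ≤ h) {j : ℤ} {x y : ℂ} (h1 : lin h j x = lin h j y)
    (h2 : lin h (j + 1) x = lin h (j + 1) y) : x = y := by
  have hs := sin_pi_div_pos hh
  have hu : normalDir h j ≠ 0 := by rw [← norm_pos_iff, norm_normalDir]; exact one_pos
  set u := normalDir h j
  set a := ((x - y) * u⁻¹).re
  set b := ((x - y) * u⁻¹).im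
  have hab : x - y = ((a : ℂ) + b * Complex.I) * u := by
    rw [Complex.re_add_im, inv_mul_cancel_right₀ hu]
  have h3 : lin h j (x - y) = 0 := by rw [lin_sub, h1, sub_self]
  have h4 : lin h (j + 1) (x - y) = 0 := by rw [lin_sub, h2, sub_self]
  rw [hab, lin_mul_normalDir] at h3 h4
  have ha : a = 0 := by simpa using h3
  have e1 : π * (j + 1 - j : ℤ) / h = π / h := by push_cast; ring
  rw [ha, e1, zero_mul, zero_add] at h4
  have hb : b = 0 := (mul_eq_zero.1 h4).resolve_right hs.ne'
  rw [ha, hb] at hab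
  simpa [sub_eq_zero] using hab

/-- The support numbers `H` are invariant under the rotation by `k` steps about `o`. -/
def RotInvariant (h : ℕ) (H : ℤ → ℝ) (o : ℂ) (k : ℤ) : Prop :=
  Function.Periodic (fun j => H j - lin h j o) k

variable {H : ℤ → ℝ} {o : ℂ} {k : ℤ}

lemma RotInvariant.sideLen (hk : RotInvariant h H o k) :
    Function.Periodic (sideLen h H) k := by
  intro j
  unfold PiecewiseRotation.sideLen
  have h0 := hk j
  have h1 := hk (j + 1)
  have h2 := hk (j - 1)
  have h3 := lin_succ_add_pred (h := h) j o
  have h4 := lin_succ_add_pred (h := h) (j + k) o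
  simp only at h0 h1 h2
  rw [show j + 1 + k = j + k + 1 by ring] at h1
  rw [show j - 1 + k = j + k - 1 by ring] at h2
  congr 1
  linear_combination h1 + h2 - 2 * cos (π / h) * h0 - h3 + h4

lemma RotInvariant.vert (hh : 2 ≤ h) (hk : RotInvariant h H o k) (j : ℤ) :
    vert h H (j + k) - o =
      Complex.exp ((π * k / h : ℝ) * Complex.I) * (PiecewiseRotation.vert h H j - o) := by
  have h0 := hk j
  have h1 := hk (j + 1)
  have hv : ∀ j, lin h (j + 1) (PiecewiseRotation.vert h H j) = H (j + 1) := fun j => by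
    have := lin_vert_pred (H := H) hh (j + 1)
    rwa [add_sub_cancel_right] at this
  simp only at h0 h1
  refine eq_of_lin_eq hh (j := j + k) ?_ ?_
  · rw [lin_exp_mul, lin_sub, lin_sub, lin_vert, lin_vert, h0]
  · rw [show j + k + 1 = j + 1 + k by ring, lin_exp_mul, lin_sub, lin_sub,
      show j + 1 + k = j + k + 1 by ring, hv, hv, ← h1, show j + 1 + k = j + k + 1 by ring]

/-- On `V` the iterate is `w ↦ L w + c`, which permutes the support lines by a shift of `p l`. As `L
≠ 1` it has the fixed point `c / (1 - L)`, and measured from there the support numbers are merely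
shifted. -/
lemma rotInvariant_support {z : ℂ} {V : Set ℂ}
    (hV : V ⊆ Cell (π * p / h) z) (hb : Bornology.IsBounded V) (ho : IsOpen V) (hz : z ∈ V)
    {l : ℕ} (hl : (F (π * p / h))^[l] '' V = V) (hne : mult (π * p / h) ^ l ≠ 1) :
    ∃ o, RotInvariant h (support h V) o (p * l) := by
  set L := mult (π * p / h) ^ l with hL
  set c := (F (π * p / h))^[l] z - L * z with hc
  have haff : ∀ w ∈ V, (F (π * p / h))^[l] w = L * w + c := fun w hw => by
    rw [iterate_of_mem_Cell (hV hw) l, hc]; ring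
  have hLlin : ∀ (j : ℤ) (w : ℂ), lin h (j + p * l) (L * w) = lin h j w := fun j w => by
    rw [hL, mult_pow]; exact lin_exp_mul _ _ _
  have hsup : ∀ j : ℤ, support h V (j + p * l) = support h V j + lin h (j + p * l) c := by
    intro j
    apply le_antisymm
    · refine support_le ⟨z, hz⟩ _ fun v hv => ?_
      obtain ⟨w, hw, rfl⟩ := hl.symm ▸ hv
      rw [haff w hw, lin_add, hLlin]
      linarith [lin_lt_support (h := h) hb ho j hw]
    · rw [← le_sub_iff_add_le]
      refine support_le ⟨z, hz⟩ _ fun w hw => ?_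
      have h1 : (F (π * p / h))^[l] w ∈ V := hl ▸ Set.mem_image_of_mem _ hw
      have h2 := lin_lt_support (h := h) hb ho (j + p * l) h1
      rw [haff w hw, lin_add, hLlin] at h2
      linarith
  have hne' : 1 - L ≠ 0 := sub_ne_zero.2 (Ne.symm hne)
  refine ⟨c / (1 - L), fun j => ?_⟩
  have h1 : lin h (j + p * l) (c / (1 - L)) =
      lin h j (c / (1 - L)) + lin h (j + p * l) c := by
    rw [← hLlin j, ← lin_add]
    congr 1
    field_simp
    ring
  simp only
  rw [hsup, h1]
  ring

lemma RotInvariant.of_gcd {m : ℤ} (hk : RotInvariant h H o k) (hm : RotInvariant h H o m) :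
    RotInvariant h H o (Int.gcd k m) := by
  rw [RotInvariant, Int.gcd_eq_gcd_ab]
  have h1 := Function.Periodic.zsmul hk (Int.gcdA k m)
  have h2 := Function.Periodic.zsmul hm (Int.gcdB k m)
  rw [smul_eq_mul, mul_comm] at h1 h2
  exact h1.add_period h2

lemma rotInvariant_full (hh : h ≠ 0) (per : ∀ j, H (j + 2 * h) = H j) (o : ℂ) :
    RotInvariant h H o (2 * h) := fun j => by
  simp only
  rw [per, lin_add_period hh]

lemma eq_of_finRotate_invariant {X : Type*} {n : ℕ} {f : Fin n → X}
    (hf : ∀ i, f (finRotate n i) = f i) (i j : Fin n) : f i = f j := by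
  obtain ⟨n, rfl⟩ : ∃ k, n = k + 1 := ⟨n - 1, by have := i.2; omega⟩
  have key : ∀ (m : ℕ) (hm : m < n + 1), f ⟨m, hm⟩ = f 0 := by
    intro m
    induction m with
    | zero => intro _; rfl
    | succ m ih =>
      intro hm
      rw [← ih (by omega), ← hf ⟨m, by omega⟩]
      congr 1
      exact (finRotate_of_lt (by omega)).symm
  rw [key i.1 i.2, key j.1 j.2]

/-- A rotation taking each vertex to the next preserves lengths and angles, so these are constant
along the cycle of vertices. -/
lemma isRegular_of_rotation {n : ℕ} {P : Polygon ℂ n} {ω : ℂ} (hω : ‖ω‖ = 1)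
    (hP : ∀ i, P (finRotate n i) - o = ω * (P i - o)) : IsRegular P := by
  have hω0 : ω ≠ 0 := norm_pos_iff.1 (hω ▸ one_pos)
  have hsub : ∀ i j, P (finRotate n i) - P (finRotate n j) = ω * (P i - P j) := fun i j => by
    linear_combination hP i - hP j
  constructor
  · apply eq_of_finRotate_invariant
    intro i
    rw [dist_eq_norm, dist_eq_norm, hsub, norm_mul, hω, one_mul]
  · apply eq_of_finRotate_invariant
    intro i
    rw [EuclideanGeometry.angle, EuclideanGeometry.angle, vsub_eq_sub, vsub_eq_sub, vsub_eq_sub,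
      vsub_eq_sub, hsub, hsub, Complex.angle_mul_left hω0]

lemma enumerates_all (hpos : ∀ j, 0 < sideLen h H j) :
    Enumerates h H (fun i : Fin (2 * h) => (i : ℕ)) where
  strictMono := fun _ _ hij => hij
  lt := fun i => i.2
  active := fun _ => hpos _
  surj := fun j hj _ => ⟨⟨j, hj⟩, rfl⟩

lemma norm_exp_ofReal_mul_I' (x : ℝ) : ‖Complex.exp ((x : ℂ) * Complex.I)‖ = 1 :=
  Complex.norm_exp_ofReal_mul_I x

/-- If the support numbers are invariant under one step of rotation, the region is a regular
polygon with `2 * h` sides. -/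
lemma regular_of_rotInvariant_one (hh : 2 ≤ h) (per : ∀ j, H (j + 2 * h) = H j)
    (hl : ∀ j, 0 ≤ sideLen h H j) (hne : (openRegion h H).Nonempty)
    (hk : RotInvariant h H o 1) :
    ∃ P : Polygon ℂ (2 * h), BoundedBy (openRegion h H) P ∧ IsRegular P := by
  obtain ⟨m, _, hm⟩ := exists_active hh hne hl 0
  have hpos : ∀ j, 0 < sideLen h H j := fun j => by
    have h1 := hk.sideLen.int_mul (j - (0 + m + 1)) (0 + m + 1)
    rw [mul_one, Int.cast_id, add_sub_cancel] at h1
    rwa [h1]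
  have he := enumerates_all hpos
  refine ⟨_, boundedBy_openRegion he hh per hl hne,
    isRegular_of_rotation (o := o) (norm_exp_ofReal_mul_I' (π * (1 : ℤ) / h)) fun i => ?_⟩
  simp only
  rw [he.vert_next hh per hl, ← hk.vert hh, sub_add_cancel]

/-- If the support numbers are invariant under two steps of rotation, the region is a regular
polygon with `h` sides or a polygon with `2 * h` sides. -/
lemma polygon_of_rotInvariant_two (hh : 2 ≤ h) (per : ∀ j, H (j + 2 * h) = H j)
    (hl : ∀ j, 0 ≤ sideLen h H j) (hne : (openRegion h H).Nonempty)
    (hk : RotInvariant h H o 2) :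
    (∃ P : Polygon ℂ h, BoundedBy (openRegion h H) P ∧ IsRegular P) ∨
      ∃ P : Polygon ℂ (2 * h), BoundedBy (openRegion h H) P := by
  have hpar : ∀ j, sideLen h H j = sideLen h H (j % 2) := fun j => by
    have h1 := hk.sideLen.int_mul (j / 2) (j % 2)
    rwa [mul_comm, Int.cast_id, Int.emod_add_mul_ediv] at h1
  by_cases hpos : ∀ j, 0 < sideLen h H j
  · exact Or.inr ⟨_, boundedBy_openRegion (enumerates_all hpos) hh per hl hne⟩
  left
  obtain ⟨j₀, hj₀⟩ := not_forall.1 hpos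
  obtain ⟨m, _, hm⟩ := exists_active hh hne hl 0
  have hj₀' : sideLen h H j₀ = 0 := le_antisymm (not_lt.1 hj₀) (hl _)
  -- Side lengths depend only on parity; `ε` is the parity class of positive length when the other
  -- one vanishes.
  obtain ⟨ε, hε, hε1, hε0⟩ : ∃ ε : ℕ, ε < 2 ∧ (∀ j : ℤ, j % 2 = ε → 0 < sideLen h H j) ∧
      ∀ j : ℤ, j % 2 ≠ ε → sideLen h H j = 0 := by
    rw [hpar] at hm hj₀'
    have hne2 : j₀ % 2 ≠ (0 + m + 1 : ℤ) % 2 := fun h0 => by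
      rw [h0] at hj₀'; linarith
    have h2 := Int.emod_nonneg (0 + m + 1 : ℤ) (show (2 : ℤ) ≠ 0 by norm_num)
    refine ⟨((0 + m + 1 : ℤ) % 2).toNat, by omega, fun j hj => ?_, fun j hj => ?_⟩
    · rw [Int.toNat_of_nonneg h2] at hj
      rw [hpar, hj]; exact hm
    · rw [Int.toNat_of_nonneg h2] at hj
      rw [hpar, show j % 2 = j₀ % 2 by omega]; exact hj₀'
  have he : Enumerates h H (fun i : Fin h => 2 * (i : ℕ) + ε) :=
    { strictMono := fun i j hij => by
        have : i.1 < j.1 := hij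
        simp only
        omega
      lt := fun i => by have := i.2; omega
      active := fun i => hε1 _ (by push_cast; omega)
      surj := fun j hj hj' => by
        have : (j : ℤ) % 2 = ε := by
          by_contra h0
          rw [hε0 _ h0] at hj'
          exact lt_irrefl _ hj'
        exact ⟨⟨j / 2, by omega⟩, by simp only; omega⟩ }
  refine ⟨_, boundedBy_openRegion he hh per hl hne,
    isRegular_of_rotation (o := o) (norm_exp_ofReal_mul_I' (π * (2 : ℤ) / h)) fun i => ?_⟩
  simp only
  rw [he.vert_next hh per hl, ← hk.vert hh]
  -- The odd one out between two active sides has length zero, so vertices two indices apart are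
  -- consecutive vertices of the polygon.
  have h1 : sideLen h H (((2 * (i : ℕ) + ε : ℕ) : ℤ) + 1) = 0 := hε0 _ (by push_cast; omega)
  have h2 := vert_eq_of_sideLen_eq_zero hh h1
  rw [add_sub_cancel_right] at h2
  rw [← h2]
  congr 2
  ring

/-- The shape and the period of a tile. -/
theorem tile_shape (hh : 2 ≤ h) (hp : p.Coprime h) {V : Set ℂ} (hV : IsTile (π * p / h) V) :
    (∃ (n : ℕ) (P : Polygon ℂ n), BoundedBy V P ∧ n ≤ 2 * h) ∧
    ∃ l : ℕ, IsPeriod (π * p / h) V l ∧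
      (mult (π * p / h) ^ l ≠ 1 → Int.gcd (p * l) (2 * h) = 1 →
        ∃ P : Polygon ℂ (2 * h), BoundedBy V P ∧ IsRegular P) ∧
      (mult (π * p / h) ^ l ≠ 1 → Int.gcd (p * l) (2 * h) = 2 →
        (∃ P : Polygon ℂ h, BoundedBy V P ∧ IsRegular P) ∨
          ∃ P : Polygon ℂ (2 * h), BoundedBy V P) := by
  classical
  obtain ⟨z, hz, hVz, hb, d, hd, hdV⟩ := tile_periodic hh hp hV
  have ho : IsOpen V := hVz ▸ isOpen_interior
  have hreg := tile_eq_openRegion hh hVz hb hz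
  have per := support_period (h := h) (by omega) V
  have hl := sideLen_support_nonneg hh hb ho ⟨z, hz⟩
  have hne : (openRegion h (support h V)).Nonempty := hreg ▸ ⟨z, hz⟩
  have hVC : V ⊆ Cell (π * p / h) z := by
    conv_lhs => rw [hVz]
    exact interior_subset
  refine ⟨?_, ?_⟩
  · obtain ⟨n, e, hn, he⟩ := exists_enumerates h (support h V)
    have := boundedBy_openRegion he hh per hl hne
    rw [← hreg] at this
    exact ⟨n, _, this, hn⟩
  · have hex : ∃ m, 0 < m ∧ (F (π * p / h))^[m] '' V = V := ⟨d, hd, hdV⟩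
    refine ⟨Nat.find hex, ⟨Nat.find_spec hex, fun m hm => Nat.find_min' hex hm⟩, ?_, ?_⟩
    · intro h1 hg
      obtain ⟨o, hk⟩ := rotInvariant_support hVC hb ho hz (Nat.find_spec hex).2 h1
      have hk' := hk.of_gcd (rotInvariant_full (by omega) per o)
      rw [hg] at hk'
      have := regular_of_rotInvariant_one hh per hl hne hk'
      rwa [← hreg] at this
    · intro h1 hg
      obtain ⟨o, hk⟩ := rotInvariant_support hVC hb ho hz (Nat.find_spec hex).2 h1
      have hk' := hk.of_gcd (rotInvariant_full (by omega) per o)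
      rw [hg] at hk'
      have := polygon_of_rotInvariant_two hh per hl hne hk'
      rwa [← hreg] at this

end PiecewiseRotation

end

/-! ### The hexagon for `11π/6` -/

noncomputable section

namespace PiecewiseRotation

open Real

section Hexagon

lemma sqrt_three_mul_self : √3 * √3 = 3 := Real.mul_self_sqrt (by norm_num)

lemma sqrt_three_lt_two : √3 < 2 := by
  rw [Real.sqrt_lt' (by norm_num)]; norm_num

lemma sqrt_three_pos : 0 < √3 := Real.sqrt_pos.2 (by norm_num)

lemma hexAngle_eq : 11 * π / 6 = π * ((11 : ℕ) : ℝ) / ((6 : ℕ) : ℝ) := by push_cast; ring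

lemma hexMult : mult (11 * π / 6) = ((√3 / 2 : ℝ) : ℂ) + (-(1 / 2) : ℝ) * Complex.I := by
  have e : 11 * π / 6 = 2 * π - π / 6 := by ring
  apply Complex.ext
  · rw [mult, Complex.exp_ofReal_mul_I_re, cart_re, e, cos_two_pi_sub, cos_pi_div_six]
  · rw [mult, Complex.exp_ofReal_mul_I_im, cart_im, e, sin_two_pi_sub, sin_pi_div_six]

lemma mul_hexMult {z : ℂ} {x y x' y' : ℝ} (hz : z = (x : ℂ) + y * Complex.I)
    (hx : x * (√3 / 2) + y * (1 / 2) = x') (hy : y * (√3 / 2) - x * (1 / 2) = y') :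
    z * mult (11 * π / 6) = (x' : ℂ) + y' * Complex.I := by
  rw [hz, hexMult, cart_mul, ← hx, ← hy]
  congr 2
  · ring
  · congr 1; ring

lemma hexMult_pow_six : mult (11 * π / 6) ^ 6 = -1 := by
  rw [mult, ← Complex.exp_nat_mul]
  have : ((6 : ℕ) : ℂ) * (((11 * π / 6 : ℝ) : ℂ) * Complex.I) =
      π * Complex.I + 5 * (2 * π * Complex.I) := by push_cast; ring
  rw [this, Complex.exp_add, Complex.exp_pi_mul_I]
  have := Complex.exp_int_mul_two_pi_mul_I 5
  push_cast at this
  rw [this, mul_one]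

/-- The centre of the hexagon. -/
def hexCtr : ℂ := ((1 / 2 + √3 / 3 : ℝ) : ℂ) + (-(√3 / 6) : ℝ) * Complex.I

/-- The centre of the rotation by which the map acts on the lower half-plane. -/
def lowCtr : ℂ := ((-(1 / 2) : ℝ) : ℂ) + (-(1 + √3 / 2) : ℝ) * Complex.I

/-- The hexagon, translated to the origin. -/
def hexCore : Set ℂ :=
  {δ | ∀ k < 3, (mult (11 * π / 6) ^ (4 * k) * δ).im < √3 / 6 ∧
    (mult (11 * π / 6) ^ (4 * k + 9) * δ).im < √3 / 6}

lemma hexMult_pow_add_twelve (n : ℕ) :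
    mult (11 * π / 6) ^ (n + 12) = mult (11 * π / 6) ^ n := by
  rw [pow_add, show (12 : ℕ) = 6 * 2 by norm_num, pow_mul, hexMult_pow_six]; ring

lemma rot_mem_hexCore {δ : ℂ} (hδ : δ ∈ hexCore) :
    mult (11 * π / 6) ^ 4 * δ ∈ hexCore := by
  intro k hk
  have e1 : mult (11 * π / 6) ^ (4 * k) * (mult (11 * π / 6) ^ 4 * δ) =
      mult (11 * π / 6) ^ (4 * (k + 1)) * δ := by ring
  have e2 : mult (11 * π / 6) ^ (4 * k + 9) * (mult (11 * π / 6) ^ 4 * δ) =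
      mult (11 * π / 6) ^ (4 * (k + 1) + 9) * δ := by ring
  rw [e1, e2]
  rcases Nat.lt_or_ge (k + 1) 3 with h | h
  · exact hδ (k + 1) h
  · have h0 := hδ 0 (by norm_num)
    have : k = 2 := by omega
    subst this
    have e3 := hexMult_pow_add_twelve 0
    have e4 := hexMult_pow_add_twelve 9
    exact ⟨by rw [show 4 * (2 + 1) = 0 + 12 by norm_num, e3]; exact h0.1,
      by rw [show 4 * (2 + 1) + 9 = 9 + 12 by norm_num, e4]; exact h0.2⟩

/-- On the lower half-plane the map is the rotation by `λ` about its fixed point `lowCtr`. -/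
lemma lower_orbit {w : ℂ} {n : ℕ}
    (hn : ∀ i < n, (lowCtr + mult (11 * π / 6) ^ i * (w - lowCtr)).im < 0) :
    (F (11 * π / 6))^[n] w = lowCtr + mult (11 * π / 6) ^ n * (w - lowCtr) := by
  have hfix : mult (11 * π / 6) * (lowCtr + 1) = lowCtr := by
    rw [mul_comm]
    refine mul_hexMult (x := 1 / 2) (y := -(1 + √3 / 2)) ?_ ?_ ?_
    · rw [lowCtr]; push_cast; ring
    · ring
    · linear_combination (-1 / 4) * sqrt_three_mul_self
  induction n with
  | zero => simp
  | succ n ih =>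
    rw [Function.iterate_succ_apply', ih fun i hi => hn i (by omega), F_def,
      H_of_neg (hn n (by omega))]
    linear_combination hfix

lemma cart_mul_im (x y : ℝ) (δ : ℂ) :
    (((x : ℂ) + y * Complex.I) * δ).im = x * δ.im + y * δ.re := by
  rw [Complex.mul_im, cart_re, cart_im]

lemma hex_lower {δ : ℂ} (hδ : δ ∈ hexCore) :
    (∀ i < 10, (lowCtr + mult (11 * π / 6) ^ i * (hexCtr + δ - lowCtr)).im < 0) ∧
    lowCtr + mult (11 * π / 6) ^ 10 * (hexCtr + δ - lowCtr) =
      -(hexCtr + mult (11 * π / 6) ^ 4 * δ) := by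
  have hr := sqrt_three_mul_self
  have hr0 := sqrt_three_pos
  have hr2 := sqrt_three_lt_two
  set r := √3 with hrdef
  set L := mult (11 * π / 6) with hL
  have p0 : L ^ 0 = ((1 : ℝ) : ℂ) + (0 : ℝ) * Complex.I := by simp
  have p1 : L ^ 1 = ((r / 2 : ℝ) : ℂ) + (-(1 / 2) : ℝ) * Complex.I := by
    rw [pow_one]; exact hexMult
  have p2 : L ^ 2 = ((1 / 2 : ℝ) : ℂ) + (-(r / 2) : ℝ) * Complex.I := by
    rw [pow_succ]; exact mul_hexMult p1 (by linarith) (by linarith)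
  have p3 : L ^ 3 = ((0 : ℝ) : ℂ) + (-1 : ℝ) * Complex.I := by
    rw [pow_succ]; exact mul_hexMult p2 (by linarith) (by linarith)
  have p4 : L ^ 4 = ((-(1 / 2) : ℝ) : ℂ) + (-(r / 2) : ℝ) * Complex.I := by
    rw [pow_succ]; exact mul_hexMult p3 (by linarith) (by linarith)
  have p5 : L ^ 5 = ((-(r / 2) : ℝ) : ℂ) + (-(1 / 2) : ℝ) * Complex.I := by
    rw [pow_succ]; exact mul_hexMult p4 (by linarith) (by linarith)
  have p6 : L ^ 6 = ((-1 : ℝ) : ℂ) + (0 : ℝ) * Complex.I := by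
    rw [pow_succ]; exact mul_hexMult p5 (by linarith) (by linarith)
  have p7 : L ^ 7 = ((-(r / 2) : ℝ) : ℂ) + (1 / 2 : ℝ) * Complex.I := by
    rw [pow_succ]; exact mul_hexMult p6 (by linarith) (by linarith)
  have p8 : L ^ 8 = ((-(1 / 2) : ℝ) : ℂ) + (r / 2 : ℝ) * Complex.I := by
    rw [pow_succ]; exact mul_hexMult p7 (by linarith) (by linarith)
  have p9 : L ^ 9 = ((0 : ℝ) : ℂ) + (1 : ℝ) * Complex.I := by
    rw [pow_succ]; exact mul_hexMult p8 (by linarith) (by linarith)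
  have p10 : L ^ 10 = ((1 / 2 : ℝ) : ℂ) + (r / 2 : ℝ) * Complex.I := by
    rw [pow_succ]; exact mul_hexMult p9 (by linarith) (by linarith)
  have p13 : L ^ 13 = L ^ 1 := hexMult_pow_add_twelve 1
  have p17 : L ^ 17 = L ^ 5 := hexMult_pow_add_twelve 5
  have hd : hexCtr - lowCtr = ((1 + r / 3 : ℝ) : ℂ) + (1 + r / 3 : ℝ) * Complex.I := by
    rw [hexCtr, lowCtr]; push_cast; ring
  have c0 := hδ 0 (by norm_num)
  have c1 := hδ 1 (by norm_num)
  have c2 := hδ 2 (by norm_num)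
  norm_num only at c0 c1 c2
  rw [p0, p9, cart_mul_im, cart_mul_im] at c0
  rw [p4, p13, p1, cart_mul_im, cart_mul_im] at c1
  rw [p8, p17, p5, cart_mul_im, cart_mul_im] at c2
  obtain ⟨c0, c0'⟩ := c0
  obtain ⟨c1, c1'⟩ := c1
  obtain ⟨c2, c2'⟩ := c2
  constructor
  · have him : ∀ (x y : ℝ), (lowCtr + ((x : ℂ) + y * Complex.I) * (hexCtr + δ - lowCtr)).im =
        -(1 + r / 2) + (x + y) * (1 + r / 3) + (x * δ.im + y * δ.re) := by
      intro x y
      rw [show hexCtr + δ - lowCtr = (hexCtr - lowCtr) + δ by ring, hd, Complex.add_im, lowCtr,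
        cart_im, mul_add, Complex.add_im, cart_mul_im, cart_mul_im, cart_re, cart_im]
      ring
    have hA : |δ.re| ≤ r / 3 := by rw [abs_le]; constructor <;> linarith
    have hB : |δ.im| ≤ r / 3 := by rw [abs_le]; constructor <;> linarith
    -- At times 1 to 8 the hexagon is clear of the real line and a crude bound suffices. Times 0 and
    -- 9 are tight and use the inequalities of `hexCore` exactly.
    have far : ∀ (x y : ℝ), |x| ≤ 1 → |y| ≤ 1 → (x + y) * (1 + r / 3) ≤ r / 3 →
        (lowCtr + ((x : ℂ) + y * Complex.I) * (hexCtr + δ - lowCtr)).im < 0 := by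
      intro x y hx hy hxy
      rw [him]
      have h1 : |x * δ.im| ≤ r / 3 := by
        rw [abs_mul]; exact (mul_le_of_le_one_left (abs_nonneg _) hx).trans hB
      have h2 : |y * δ.re| ≤ r / 3 := by
        rw [abs_mul]; exact (mul_le_of_le_one_left (abs_nonneg _) hy).trans hA
      have := (abs_le.1 h1).2
      have := (abs_le.1 h2).2
      linarith
    have hhalf : |r / 2| ≤ 1 := by rw [abs_le]; constructor <;> linarith
    intro i hi
    interval_cases i
    · rw [p0, him]; linarith
    · rw [p1]; exact far _ _ hhalf (by norm_num [abs_le]) (by nlinarith)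
    · rw [p2]; exact far _ _ (by norm_num [abs_le]) (by rwa [abs_neg]) (by nlinarith)
    · rw [p3]; exact far _ _ (by norm_num) (by norm_num) (by nlinarith)
    · rw [p4]; exact far _ _ (by norm_num [abs_le]) (by rwa [abs_neg]) (by nlinarith)
    · rw [p5]; exact far _ _ (by rwa [abs_neg]) (by norm_num [abs_le]) (by nlinarith)
    · rw [p6]; exact far _ _ (by norm_num) (by norm_num) (by nlinarith)
    · rw [p7]; exact far _ _ (by rwa [abs_neg]) (by norm_num [abs_le]) (by nlinarith)
    · rw [p8]; exact far _ _ (by norm_num [abs_le]) hhalf (by nlinarith)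
    · rw [p9, him]; linarith
  · have p46 : L ^ 10 = -L ^ 4 := by
      rw [show (10 : ℕ) = 4 + 6 by norm_num, pow_add, hexMult_pow_six]; ring
    have h1 : L ^ 10 * (hexCtr - lowCtr) = -hexCtr - lowCtr := by
      rw [p10, hd, cart_mul, hexCtr, lowCtr]
      have e1 : 1 / 2 * (1 + r / 3) - r / 2 * (1 + r / 3) = -(1 / 2 + r / 3) + 1 / 2 := by
        linarith
      have e2 : 1 / 2 * (1 + r / 3) + r / 2 * (1 + r / 3) = r / 6 + (1 + r / 2) := by
        linarith
      rw [e1, e2]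
      push_cast
      ring
    linear_combination h1 + δ * p46

lemma iterate_neg_of_im_ne_zero {α : ℝ} {w : ℂ} {n : ℕ} (hn : ∀ i < n, ((F α)^[i] w).im ≠ 0) :
    (F α)^[n] (-w) = -(F α)^[n] w := by
  induction n with
  | zero => rfl
  | succ n ih =>
    rw [Function.iterate_succ_apply', Function.iterate_succ_apply',
      ih fun i hi => hn i (by omega), F_neg (hn n (by omega))]

/-- Up to the sign, ten steps rotate the hexagon about its centre by `λ ^ 4`, which has order three.
Oddness of the map then governs the next ten steps. -/
lemma hex_ten {δ : ℂ} (hδ : δ ∈ hexCore) :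
    (F (11 * π / 6))^[10] (hexCtr + δ) = -(hexCtr + mult (11 * π / 6) ^ 4 * δ) := by
  rw [lower_orbit (hex_lower hδ).1, (hex_lower hδ).2]

/-- The itinerary of the hexagon: ten steps in the lower half-plane, then ten in the upper. -/
lemma hex_itinerary (n : ℕ) : ∀ δ ∈ hexCore,
    (n % 20 < 10 → ((F (11 * π / 6))^[n] (hexCtr + δ)).im < 0) ∧
    (10 ≤ n % 20 → 0 < ((F (11 * π / 6))^[n] (hexCtr + δ)).im) := by
  induction n using Nat.strong_induction_on with
  | _ n ih =>
    intro δ hδ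
    rcases Nat.lt_or_ge n 10 with h | h
    · refine ⟨fun _ => ?_, fun h2 => by omega⟩
      rw [lower_orbit fun i hi => (hex_lower hδ).1 i (by omega)]
      exact (hex_lower hδ).1 n h
    · have hδ' := rot_mem_hexCore hδ
      have e : (F (11 * π / 6))^[n] (hexCtr + δ) =
          -(F (11 * π / 6))^[n - 10] (hexCtr + mult (11 * π / 6) ^ 4 * δ) := by
        rw [← iterate_neg_of_im_ne_zero, ← hex_ten hδ, ← Function.iterate_add_apply]
        · congr 2; omega
        · intro i hi
          have := ih i (by omega) _ hδ'
          rcases Nat.lt_or_ge (i % 20) 10 with h1 | h1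
          · exact (this.1 h1).ne
          · exact (this.2 h1).ne'
      have := ih (n - 10) (by omega) _ hδ'
      rw [e, Complex.neg_im]
      refine ⟨fun h1 => ?_, fun h1 => ?_⟩
      · linarith [this.2 (by omega)]
      · linarith [this.1 (by omega)]

lemma zero_mem_hexCore : (0 : ℂ) ∈ hexCore := by
  intro k _
  have := sqrt_three_pos
  simp [this]

lemma hexCtr_im : hexCtr.im = -(√3 / 6) := cart_im _ _

lemma hex_iterate_ten : (F (11 * π / 6))^[10] hexCtr = -hexCtr := by
  have := hex_ten zero_mem_hexCore
  simpa using this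

lemma hex_im_ne_zero (n : ℕ) : ((F (11 * π / 6))^[n] hexCtr).im ≠ 0 := by
  have := hex_itinerary n 0 zero_mem_hexCore
  rw [add_zero] at this
  rcases Nat.lt_or_ge (n % 20) 10 with h | h
  · exact (this.1 h).ne
  · exact (this.2 h).ne'

lemma hex_iterate_add_ten (n : ℕ) :
    (F (11 * π / 6))^[n + 10] hexCtr = -(F (11 * π / 6))^[n] hexCtr := by
  rw [Function.iterate_add_apply, hex_iterate_ten,
    iterate_neg_of_im_ne_zero fun i _ => hex_im_ne_zero i]

lemma hex_iterate_nine_im : ((F (11 * π / 6))^[9] hexCtr).im = -(√3 / 6) := by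
  have h1 := hex_iterate_ten
  rw [Function.iterate_succ_apply', F_def] at h1
  have h2 := (hex_itinerary 9 0 zero_mem_hexCore).1 (by norm_num)
  rw [add_zero] at h2
  rw [H_of_neg h2] at h1
  have hr := sqrt_three_mul_self
  generalize (F (11 * π / 6))^[9] hexCtr = w at h1 h2 ⊢
  rw [hexMult, hexCtr] at h1
  have hre := congrArg Complex.re h1
  have him := congrArg Complex.im h1
  rw [Complex.neg_re, cart_re, Complex.mul_re, cart_re, cart_im] at hre
  rw [Complex.neg_im, cart_im, Complex.mul_im, cart_re, cart_im] at him
  simp only [Complex.sub_re, Complex.sub_im, Complex.neg_re, Complex.neg_im, Complex.one_re,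
    Complex.one_im] at hre him
  linear_combination (1 / 2 : ℝ) * hre + (√3 / 2) * him - (w.im / 4 - 1 / 12) * hr

/-- Only the times `10k` and `10k + 9` bind. There the centre has height `±√3/6` and `λ ^ 10 = -λ ^
4`, so the signs cancel and the six inequalities of `hexCore` remain. -/
lemma mem_hexCell_iff {w : ℂ} : w ∈ Cell (11 * π / 6) hexCtr ↔ w - hexCtr ∈ hexCore := by
  constructor
  · intro hw
    rw [mem_Cell_iff] at hw
    have hr := sqrt_three_pos
    have e6 := hexMult_pow_six
    have key : ∀ k, ((F (11 * π / 6))^[10 * k] hexCtr).im = (-1) ^ k * -(√3 / 6) ∧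
        ((F (11 * π / 6))^[10 * k + 9] hexCtr).im = (-1) ^ k * -(√3 / 6) := by
      intro k
      induction k with
      | zero =>
        rw [mul_zero, zero_add, pow_zero, one_mul]
        exact ⟨hexCtr_im, hex_iterate_nine_im⟩
      | succ k ih =>
        rw [Nat.mul_succ, hex_iterate_add_ten, add_right_comm, hex_iterate_add_ten,
          Complex.neg_im, Complex.neg_im, ih.1, ih.2]
        constructor <;> ring
    have hpow : ∀ k j : ℕ, mult (11 * π / 6) ^ (10 * k + j) =
        (-1) ^ k * mult (11 * π / 6) ^ (4 * k + j) := by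
      intro k j
      rw [← e6, ← pow_mul, ← pow_add]; congr 1; ring
    have haux : ∀ (k : ℕ) (x : ℝ), 0 < (-1) ^ k * -(√3 / 6) *
        ((-1) ^ k * -(√3 / 6) + (-1) ^ k * x) → x < √3 / 6 := by
      intro k x h1
      have e : ((-1 : ℝ)) ^ k * (-1) ^ k = 1 := by rw [← mul_pow]; norm_num
      have h2 : (√3 / 6) * (√3 / 6 - x) =
          (-1) ^ k * -(√3 / 6) * ((-1) ^ k * -(√3 / 6) + (-1) ^ k * x) := by
        linear_combination (-(√3 / 6) * (√3 / 6 - x)) * e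
      rw [← h2] at h1
      have := pos_of_mul_pos_right h1 (by positivity)
      linarith
    have him : ∀ (k : ℕ) (u v : ℂ), (((-1 : ℂ)) ^ k * u * v).im = (-1) ^ k * (u * v).im := by
      intro k u v
      rcases neg_one_pow_eq_or ℂ k with h1 | h1
      · rcases Nat.even_or_odd k with h2 | h2
        · rw [h1, h2.neg_one_pow]; simp
        · rw [h2.neg_one_pow] at h1; norm_num at h1
      · rcases Nat.even_or_odd k with h2 | h2
        · rw [h2.neg_one_pow] at h1; norm_num at h1
        · rw [h1, h2.neg_one_pow, mul_assoc, neg_one_mul, Complex.neg_im, neg_one_mul]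
    intro k _
    constructor
    · have h1 := hw (10 * k)
      rw [(key k).1] at h1
      have h2 := hpow k 0
      rw [add_zero, add_zero] at h2
      rw [h2, him] at h1
      exact haux k _ h1
    · have h1 := hw (10 * k + 9)
      rw [(key k).2, hpow k 9, him] at h1
      exact haux k _ h1
  · intro hw i
    have h1 := hex_itinerary i _ hw
    have h2 := hex_itinerary i _ zero_mem_hexCore
    rw [add_zero] at h2
    rw [add_sub_cancel] at h1
    rcases Nat.lt_or_ge (i % 20) 10 with h | h
    · exact mul_pos_of_neg_of_neg (h2.1 h) (h1.1 h)
    · exact mul_pos (h2.2 h) (h1.2 h)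

/-- The support numbers of the hexagon relative to its centre. -/
def hexRadius (j : ℤ) : ℝ := if j % 4 < 2 then √3 / 6 else √3 / 6 * ((1 + √3) / 2)

/-- The support numbers of the hexagon. -/
def hexSupport (j : ℤ) : ℝ := lin 6 j hexCtr + hexRadius j

lemma hexSupport_period (j : ℤ) : hexSupport (j + 2 * (6 : ℕ)) = hexSupport j := by
  have : (j + 2 * ((6 : ℕ) : ℤ)) % 4 = j % 4 := by push_cast; omega
  rw [hexSupport, lin_add_period (by norm_num), hexRadius, this, hexSupport, hexRadius]

lemma hex_cos : cos (π / (6 : ℕ)) = √3 / 2 := by push_cast; exact cos_pi_div_six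

lemma hex_sin : sin (π / (6 : ℕ)) = 1 / 2 := by push_cast; exact sin_pi_div_six

/-- The second value of `hexRadius` is the one for which the six redundant lines pass through
vertices, giving sides of length zero. -/
lemma sideLen_hexSupport (j : ℤ) :
    sideLen 6 hexSupport j = if j % 4 < 2 then √3 / 6 * (3 - √3) else 0 := by
  have hr := sqrt_three_mul_self
  have h1 := lin_succ_add_pred (h := 6) j hexCtr
  rw [hex_cos] at h1
  have h2 : sideLen 6 hexSupport j =
      2 * (hexRadius (j + 1) + hexRadius (j - 1) - √3 * hexRadius j) := by
    rw [sideLen, hex_cos, hex_sin]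
    unfold hexSupport
    linear_combination 2 * h1
  rw [h2]
  unfold hexRadius
  have h3 : j % 4 = 0 ∨ j % 4 = 1 ∨ j % 4 = 2 ∨ j % 4 = 3 := by omega
  rcases h3 with h3 | h3 | h3 | h3
  · rw [if_pos (by omega), if_neg (by omega), if_pos (by omega), if_pos (by omega)]
    ring
  · rw [if_neg (by omega), if_pos (by omega), if_pos (by omega), if_pos (by omega)]
    ring
  · rw [if_neg (by omega), if_pos (by omega), if_neg (by omega), if_neg (by omega)]
    linear_combination (-√3 / 6) * hr
  · rw [if_pos (by omega), if_neg (by omega), if_neg (by omega), if_neg (by omega)]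
    linear_combination (-√3 / 6) * hr

lemma hex_sideLen_pos : 0 < √3 / 6 * (3 - √3) := by
  have := sqrt_three_pos
  have := sqrt_three_lt_two
  exact mul_pos (by linarith) (by linarith)

lemma sideLen_hexSupport_nonneg (j : ℤ) : 0 ≤ sideLen 6 hexSupport j := by
  rw [sideLen_hexSupport]
  split_ifs
  exacts [hex_sideLen_pos.le, le_rfl]

lemma enumerates_hex : Enumerates 6 hexSupport (![0, 1, 4, 5, 8, 9] : Fin 6 → ℕ) where
  strictMono := by decide
  lt := by decide
  active := fun i => by
    rw [sideLen_hexSupport, if_pos (by revert i; decide)]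
    exact hex_sideLen_pos
  surj := fun j hj h => by
    rw [sideLen_hexSupport] at h
    have h4 : (j : ℤ) % 4 < 2 := by
      by_contra h0
      rw [if_neg h0] at h
      exact lt_irrefl _ h
    have h5 : ∀ j : ℕ, j < 2 * 6 → (j : ℤ) % 4 < 2 →
        ∃ i, (![0, 1, 4, 5, 8, 9] : Fin 6 → ℕ) i = j := by
      decide
    exact h5 j hj h4

lemma im_hexMult_pow_mul (i : ℕ) (w : ℂ) :
    (mult (11 * π / 6) ^ i * w).im = lin 6 i w := by
  rw [hexAngle_eq, im_mult_pow_mul]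
  have : Function.Periodic (fun j => lin 6 j w) (2 * (6 : ℕ)) := fun j =>
    lin_add_period (by norm_num) j w
  have h2 := this.int_mul (-i) i
  rw [← h2]
  congr 1
  push_cast
  ring

lemma mem_hexCore_iff {δ : ℂ} : δ ∈ hexCore ↔ ∀ j, lin 6 j δ < hexRadius j := by
  have hr := sqrt_three_mul_self
  have hr0 := sqrt_three_pos
  have hper : ∀ j w : ℤ, lin 6 (j + 12 * w) δ = lin 6 j δ := fun j w => by
    have : Function.Periodic (fun j => lin 6 j δ) (2 * (6 : ℕ)) := fun j =>
      lin_add_period (by norm_num) j δ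
    have h2 := this.int_mul w j
    rw [← h2]
    congr 1
    push_cast
    ring
  constructor
  · intro hδ
    have hA : ∀ j : ℤ, j % 4 < 2 → lin 6 j δ < √3 / 6 := by
      intro j hj
      obtain ⟨c0, c0'⟩ := hδ 0 (by norm_num)
      obtain ⟨c1, c1'⟩ := hδ 1 (by norm_num)
      obtain ⟨c2, c2'⟩ := hδ 2 (by norm_num)
      rw [im_hexMult_pow_mul] at c0 c0' c1 c1' c2 c2'
      have h13 := hper 1 1
      have h17 := hper 5 1
      norm_num at c0 c0' c1 c1' c2 c2' h13 h17
      rw [h13] at c1'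
      rw [h17] at c2'
      have e := hper (j % 12) (j / 12)
      rw [Int.emod_add_mul_ediv] at e
      rw [e]
      have h1 : j % 12 = 0 ∨ j % 12 = 1 ∨ j % 12 = 4 ∨ j % 12 = 5 ∨ j % 12 = 8 ∨ j % 12 = 9 := by
        omega
      rcases h1 with h1 | h1 | h1 | h1 | h1 | h1 <;> rw [h1] <;> assumption
    have hS : ∀ j, lin 6 (j + 1) δ + lin 6 (j - 1) δ = √3 * lin 6 j δ := fun j => by
      rw [lin_succ_add_pred, hex_cos]; ring
    intro j
    unfold hexRadius
    split_ifs with hj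
    · exact hA j hj
    · rcases (by omega : j % 4 = 2 ∨ j % 4 = 3) with h | h
      · have h1 := hA (j - 1) (by omega)
        have h2 := hA (j + 2) (by omega)
        have e1 := hS j
        have e2 := hS (j + 1)
        rw [add_sub_cancel_right, show j + 1 + 1 = j + 2 by ring] at e2
        have h3 := mul_lt_mul_of_pos_left h1 hr0
        -- A redundant normal is a positive combination of the two nearest active ones; the weights
        -- `√3/2` and `1/2` turn `√3/6` into the second value of `hexRadius`.
        have e3 : lin 6 j δ = (√3 * lin 6 (j - 1) δ + lin 6 (j + 2) δ) / 2 := by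
          linear_combination -(√3 / 2) * e1 - (1 / 2) * e2 - (lin 6 j δ / 2) * hr
        rw [e3]
        linarith
      · have h1 := hA (j - 2) (by omega)
        have h2 := hA (j + 1) (by omega)
        have e1 := hS j
        have e2 := hS (j - 1)
        rw [sub_add_cancel, show j - 1 - 1 = j - 2 by ring] at e2
        have h3 := mul_lt_mul_of_pos_left h2 hr0
        have e3 : lin 6 j δ = (√3 * lin 6 (j + 1) δ + lin 6 (j - 2) δ) / 2 := by
          linear_combination -(√3 / 2) * e1 - (1 / 2) * e2 - (lin 6 j δ / 2) * hr
        rw [e3]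
        linarith
  · intro hδ k hk
    rw [im_hexMult_pow_mul, im_hexMult_pow_mul]
    have h1 := hδ ((4 * k : ℕ) : ℤ)
    have h2 := hδ ((4 * k + 9 : ℕ) : ℤ)
    rw [hexRadius, if_pos (by omega)] at h1 h2
    exact ⟨h1, h2⟩

lemma hexCell_eq : Cell (11 * π / 6) hexCtr = openRegion 6 hexSupport := by
  ext w
  rw [mem_hexCell_iff, mem_hexCore_iff]
  refine forall_congr' fun j => ?_
  rw [lin_sub, hexSupport, sub_lt_iff_lt_add']

lemma isOpen_hexCell : IsOpen (Cell (11 * π / 6) hexCtr) := by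
  rw [hexCell_eq]
  exact isOpen_openRegion (by norm_num) hexSupport_period

lemma hexCtr_mem : hexCtr ∈ Cell (11 * π / 6) hexCtr := by
  rw [mem_hexCell_iff, sub_self]; exact zero_mem_hexCore

lemma isTile_hexCell : IsTile (11 * π / 6) (Cell (11 * π / 6) hexCtr) := by
  have h1 : hexCtr ∈ regularSet (11 * π / 6) :=
    interior_Cell_subset _ _ (by rw [isOpen_hexCell.interior_eq]; exact hexCtr_mem)
  exact ⟨hexCtr, h1, by rw [component_eq h1, isOpen_hexCell.interior_eq]⟩

lemma isPeriod_hexCell : IsPeriod (11 * π / 6) (Cell (11 * π / 6) hexCtr) 20 := by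
  have h20 : ∀ n, (F (11 * π / 6))^[n + 20] hexCtr = (F (11 * π / 6))^[n] hexCtr := fun n => by
    rw [show n + 20 = n + 10 + 10 by ring, hex_iterate_add_ten, hex_iterate_add_ten, neg_neg]
  refine ⟨⟨by norm_num, ?_⟩, ?_⟩
  · have h1 := image_interior_Cell (α := 11 * π / 6) (k := 3) (z := hexCtr) (d := 20)
      (by norm_num) (by rw [h20 0]; exact hexCtr_mem) fun w hw => ?_
    · rwa [isOpen_hexCell.interior_eq] at h1
    · have e : mult (11 * π / 6) ^ (20 * 3) = 1 := by
        rw [show 20 * 3 = 6 * 10 by norm_num, pow_mul, hexMult_pow_six]; norm_num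
      rw [iterate_of_mem_Cell hw, e]
      have h60 : (F (11 * π / 6))^[20 * 3] hexCtr = hexCtr := by
        rw [show 20 * 3 = 0 + 20 + 20 + 20 by norm_num, h20, h20, h20]; rfl
      rw [h60]; ring
  · rintro m ⟨hm0, hm⟩
    by_contra! hlt
    have h1 : (F (11 * π / 6))^[m] hexCtr ∈ Cell (11 * π / 6) hexCtr := by
      have h2 := Set.mem_image_of_mem ((F (11 * π / 6))^[m]) hexCtr_mem
      rwa [hm] at h2
    have hit : ∀ n, (n % 20 < 10 → ((F (11 * π / 6))^[n] hexCtr).im < 0) ∧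
        (10 ≤ n % 20 → 0 < ((F (11 * π / 6))^[n] hexCtr).im) := fun n => by
      have := hex_itinerary n 0 zero_mem_hexCore
      rwa [add_zero] at this
    -- Returning to the cell after `m` steps means that the itinerary, ten signs below and ten
    -- above, is invariant under the shift by `m`; this forces `20 ∣ m`.
    have hstep : ∀ i, i < 10 → (i + m) % 20 < 10 := by
      intro i hi
      by_contra! h2
      have h3 := h1 i
      rw [← Function.iterate_add_apply] at h3
      have h4 := (hit i).1 (by omega)
      have h5 := (hit (i + m)).2 h2
      nlinarith
    have h2 := hstep 0 (by norm_num)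
    have h3 := hstep 9 (by norm_num)
    omega

lemma inner_sides (j k : ℤ) {H : ℤ → ℝ} {h : ℕ} (hh : 2 ≤ h) :
    inner ℝ (vert h H j - vert h H (j - 1)) (vert h H k - vert h H (k - 1)) =
      sideLen h H j * sideLen h H k * cos (π * (k - j : ℤ) / h) := by
  have e : π * (k - j : ℤ) / h = π * k / h - π * j / h := by push_cast; ring
  rw [Complex.inner, Complex.mul_re, Complex.conj_re, Complex.conj_im, vert_sub_vert hh,
    vert_sub_vert hh, Complex.mul_re, Complex.mul_re, Complex.mul_im, Complex.mul_im, cart_re,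
    cart_re, cart_im, cart_im, normalDir_re, normalDir_im, normalDir_re, normalDir_im, e, cos_sub]
  ring

lemma exists_hexagon : ∃ V : Set ℂ, IsTile (11 * π / 6) V ∧ IsPeriod (11 * π / 6) V 20 ∧
    ∃ P : Polygon ℂ 6, BoundedBy V P ∧ ¬ IsRegular P := by
  refine ⟨_, isTile_hexCell, isPeriod_hexCell, Polygon.mk fun i =>
    vert 6 hexSupport (((![0, 1, 4, 5, 8, 9] : Fin 6 → ℕ) i : ℤ) - 1), ?_, ?_⟩
  · rw [hexCell_eq]
    exact boundedBy_openRegion enumerates_hex (by norm_num) hexSupport_period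
      sideLen_hexSupport_nonneg (hexCell_eq ▸ ⟨_, hexCtr_mem⟩)
  · rintro ⟨-, hang⟩
    have h6 : (2 : ℕ) ≤ 6 := by norm_num
    have hℓ : ∀ j : ℤ, j % 4 < 2 → sideLen 6 hexSupport j ≠ 0 := fun j hj => by
      rw [sideLen_hexSupport, if_pos hj]; exact hex_sideLen_pos.ne'
    have h3 : vert 6 hexSupport 3 = vert 6 hexSupport 1 := by
      have h2 := vert_eq_of_sideLen_eq_zero (H := hexSupport) h6 (j := 2)
        (by rw [sideLen_hexSupport, if_neg (by norm_num)])
      have h3 := vert_eq_of_sideLen_eq_zero (H := hexSupport) h6 (j := 3)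
        (by rw [sideLen_hexSupport, if_neg (by norm_num)])
      norm_num at h2 h3
      rw [h3, h2]
    have h01 := hang 0 1
    have r0 : finRotate 6 0 = 1 := by decide
    have r1 : finRotate 6 1 = 2 := by decide
    have r2 : finRotate 6 2 = 3 := by decide
    rw [r0, r1, r2, EuclideanGeometry.angle, EuclideanGeometry.angle] at h01
    simp only [vsub_eq_sub] at h01
    have e0 : ((![0, 1, 4, 5, 8, 9] : Fin 6 → ℕ) 0 : ℤ) - 1 = 0 - 1 := rfl
    have e1 : ((![0, 1, 4, 5, 8, 9] : Fin 6 → ℕ) 1 : ℤ) - 1 = 0 := rfl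
    have e2 : ((![0, 1, 4, 5, 8, 9] : Fin 6 → ℕ) 2 : ℤ) - 1 = 3 := rfl
    have e3 : ((![0, 1, 4, 5, 8, 9] : Fin 6 → ℕ) 3 : ℤ) - 1 = 4 := rfl
    rw [e0, e1, e2, e3] at h01
    have i1 := inner_sides (H := hexSupport) 1 4 h6
    have i2 := inner_sides (H := hexSupport) 0 1 h6
    -- Sides 1 and 4 are perpendicular, whereas the normals of sides 0 and 1 differ by `π / 6`. So
    -- two angles of the hexagon differ, although all its sides are equal.
    have c1 : cos (π * (4 - 1 : ℤ) / (6 : ℕ)) = 0 := by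
      rw [show π * (4 - 1 : ℤ) / (6 : ℕ) = π / 2 by push_cast; ring, cos_pi_div_two]
    rw [c1, mul_zero] at i1
    norm_num only at i1 i2
    rw [← h3] at i1 i2
    have a1 : InnerProductGeometry.angle (vert 6 hexSupport 0 - vert 6 hexSupport 3)
        (vert 6 hexSupport 4 - vert 6 hexSupport 3) = π / 2 := by
      rw [← InnerProductGeometry.inner_eq_zero_iff_angle_eq_pi_div_two,
        ← neg_sub (vert 6 hexSupport 3), inner_neg_left, i1, neg_zero]
    rw [a1, ← InnerProductGeometry.inner_eq_zero_iff_angle_eq_pi_div_two,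
      ← neg_sub (vert 6 hexSupport 0), inner_neg_left, neg_eq_zero] at h01
    norm_num only at h01
    rw [i2] at h01
    exact mul_ne_zero (mul_ne_zero (hℓ 0 (by norm_num)) (hℓ 1 (by norm_num)))
      (by simp) h01

end Hexagon

/-! ### Reduction of the rotation number `p / q` to half-turns -/

lemma mult_pow_ne_one {p q l : ℕ} (hq : 3 ≤ q) (hp : p.Coprime q) (hl : l.Coprime q) :
    mult (2 * π * p / q) ^ l ≠ 1 := by
  have h1 : IsPrimitiveRoot (Complex.exp (2 * π * Complex.I * (p / q))) q :=
    Complex.isPrimitiveRoot_exp_of_coprime p q (by omega) hp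
  have h2 : mult (2 * π * p / q) = Complex.exp (2 * π * Complex.I * (p / q)) := by
    rw [mult]; congr 1; push_cast; ring
  rw [h2]
  intro h3
  have h4 := h1.dvd_of_pow_eq_one l h3
  have := Nat.eq_one_of_dvd_coprimes hl h4 (dvd_refl q)
  omega

end PiecewiseRotation

end

theorem theoremB :
    (∀ p q : ℕ, 3 ≤ q → Nat.Coprime p q →
      ∀ V : Set ℂ, PiecewiseRotation.IsTile (2 * Real.pi * p / q) V →
        -- (a)
        (∃ (n : ℕ) (P : Polygon ℂ n), PiecewiseRotation.BoundedBy V P ∧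
          (Even q → n ≤ q) ∧ (Odd q → n ≤ 2 * q)) ∧
        -- (b)
        (∃ l : ℕ, PiecewiseRotation.IsPeriod (2 * Real.pi * p / q) V l ∧
          (Nat.Coprime l q →
            (∃ P : Polygon ℂ q,
              PiecewiseRotation.BoundedBy V P ∧ PiecewiseRotation.IsRegular P) ∨
            (Odd q ∧ ∃ P : Polygon ℂ (2 * q), PiecewiseRotation.BoundedBy V P)))) ∧
    -- (c)
    (∃ V : Set ℂ, PiecewiseRotation.IsTile (11 * Real.pi / 6) V ∧
      PiecewiseRotation.IsPeriod (11 * Real.pi / 6) V 20 ∧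
      ∃ P : Polygon ℂ 6, PiecewiseRotation.BoundedBy V P ∧ ¬ PiecewiseRotation.IsRegular P) := by
  refine ⟨fun p q hq hpq V hV => ?_, PiecewiseRotation.exists_hexagon⟩
  have hne := fun l => PiecewiseRotation.mult_pow_ne_one (l := l) hq hpq
  rcases Nat.even_or_odd q with heven | hodd
  · obtain ⟨h, rfl⟩ := even_iff_two_dvd.1 heven
    -- Even `q`: there are `2h = q` normals, and `p l` is coprime to `2h`.
    have e : 2 * Real.pi * p / ((2 * h : ℕ) : ℝ) = Real.pi * p / h := by
      have : (h : ℝ) ≠ 0 := by exact_mod_cast (by omega : h ≠ 0)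
      push_cast
      field_simp
    rw [e] at hV hne ⊢
    have hp : p.Coprime h := hpq.coprime_dvd_right (Dvd.intro_left 2 rfl)
    obtain ⟨⟨n, P, hP, hn⟩, l, hl, h1, -⟩ := PiecewiseRotation.tile_shape (by omega) hp hV
    refine ⟨⟨n, P, hP, fun _ => hn, fun ho => absurd heven (Nat.not_even_iff_odd.2 ho)⟩,
      l, hl, fun hlq => Or.inl (h1 (hne l hlq) ?_)⟩
    have := Nat.Coprime.mul_left hpq hlq
    exact_mod_cast this
  -- Odd `q`: with `h = q` the numerator becomes `2p`, still coprime to `q`. There are `2q` normals,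
  -- and the shift `2 p l` has gcd 2 with `2q`.
  · have e : 2 * Real.pi * p / q = Real.pi * (2 * p : ℕ) / q := by push_cast; ring
    rw [e] at hV hne ⊢
    have h2 : Nat.Coprime 2 q := (Nat.coprime_two_left).2 hodd
    have hp : (2 * p).Coprime q := Nat.Coprime.mul_left h2 hpq
    obtain ⟨⟨n, P, hP, hn⟩, l, hl, -, h1⟩ := PiecewiseRotation.tile_shape (by omega) hp hV
    refine ⟨⟨n, P, hP, fun he => absurd he (Nat.not_even_iff_odd.2 hodd), fun _ => hn⟩,
      l, hl, fun hlq => ?_⟩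
    have hg : Int.gcd ((2 * p : ℕ) * l) (2 * q) = 2 := by
      have h3 : Nat.gcd (2 * p * l) (2 * q) = 2 := by
        rw [mul_assoc, Nat.gcd_mul_left, Nat.Coprime.mul_left hpq hlq]
      exact_mod_cast h3
    rcases h1 (hne l hlq) hg with h3 | h3
    · exact Or.inl h3
    · exact Or.inr ⟨hodd, h3⟩
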